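/- Let $m,n,k\ge 0$ be integers, let $q$ be an indeterminate, and let $H_k(q^2)$ be the Iwahori–Hecke algebra over $\mathbb{C}(q)$ with generators $h_1,\dots,h_{k-1}$ and relations $h_ih_j=h_jh_i$ for $|i-j|\ge 2$, $h_ih_{i+1}h_i=h_{i+1}h_ih_{i+1}$, and $(h_i+1)(h_i-q^2)=0$. For $\sigma\in S_k$ put $h(\sigma)=h_{i_1}\cdots h_{i_l}$ for a reduced expression $\sigma=s_{i_1}\cdots s_{i_l}$ in the adjacent transpositions $s_i=(i,i+1)$. Let $V=\mathbb{C}(q)^m\oplus\mathbb{C}(q)^n$ be the $\mathbb{Z}_2$-graded space with basis $b_1,\dots,b_{m+n}$, where $b_1,\dots,b_m$ are even ($p(b_a)=0$) and $b_{m+1},\dots,b_{m+n}$ are odd ($p(b_a)=1$). Let $\check R\in\operatorname{End}(V\otimes V)$ be given by $\check R(b_a\otimes b_a)=q^2\,b_a\otimes b_a$ if $b_a$ is even, $\check R(b_a\otimes b_a)=-b_a\otimes b_a$ if $b_a$ is odd, and, for $a\ne b$, $\check R(b_a\otimes b_b)=(-1)^{p(b_a)p(b_b)}q\,b_b\otimes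 b_a+\epsilon_{ab}(q^2-1)\,b_a\otimes b_b$, where $\epsilon_{ab}=1$ if $a<b$ and $\epsilon_{ab}=0$ if $a>b$. Let $\Psi_q:H_k(q^2)\to\operatorname{End}(V^{\otimes k})$ be the representation sending $h_j$ to $\check R$ acting in the $j$-th and $(j+1)$-st tensor slots. For a partition $\lambda\vdash k$ let $S_+$ (respectively $S_-$) be the standard tableau of shape $\lambda$ whose entries increase by one along the rows, row after row (respectively down the columns, column after column), and put $$e_+=\sum_{\sigma}h(\sigma),\qquad e_-=\sum_{\sigma}(-q^2)^{-\ell(\sigma)}h(\sigma),$$ where the first sum is over the row group of $S_+$ and the second over the column group of $S_-$. For a standard tableau $T$ of shape $\lambda$ let $\sigma^T_\pm\in S_k$ be the permutation transforming $S_\pm$ into $T$, let $x_T(q)=h(\sigma^T_-)e_-h(\sigma^T_-)^{-1}h(\sigma^T_+)e_+h(\sigma^T_+)^{-1}$, and let $y_T(q)=\xi^{-1}x_T(q)$, where $\xi\in\mathbb{C}(q)$ is the scalar with $x_T(q)^2=\xi\,x_T(q)$ (Gyoja's $q$-analogue of the Young symmetrizer). Let $I^q_\lambda$ be the two-sided ideal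 of $H_k(q^2)$ generated by the $y_T(q)$ with $T$ a standard tableau of shape $\lambda$. A partition $\lambda$ is of $(m,n)$ hook shape if $\lambda_{m+1}\le n$; let $H(m,n;k)$ be the set of partitions of $k$ of $(m,n)$ hook shape. Then every $I^q_\lambda$, $\lambda\vdash k$, is a simple (that is, minimal nonzero two-sided) ideal, $H_k(q^2)=\bigoplus_{\lambda\vdash k}I^q_\lambda$, and $\Psi_q$ induces isomorphisms of algebras $$H_k(q^2)\Big/\Big(\bigoplus_{\lambda\vdash k,\ \lambda\notin H(m,n;k)}I^q_\lambda\Big)\;\cong\;\Psi_q(H_k(q^2))\;\cong\;\bigoplus_{\lambda\in H(m,n;k)}I^q_\lambda .$$ Moreover, $$V^{\otimes k}=\bigoplus_{T}\,y_T(q)V^{\otimes k},$$ where $T$ runs over all standard tableaux whose shape lies in $H(m,n;k)$. -/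

import Mathlib

open scoped TensorProduct

namespace QuantumSuper

/-! ### The symmetric group and Young tableaux -/

/-- The adjacent transposition `s_i = (i, i+1)` of `S_k` (letters and indices are numbered
from `0`). -/
def adjSwap {k : ℕ} (i : Fin (k - 1)) : Equiv.Perm (Fin k) :=
  Equiv.swap ⟨i.1, by omega⟩ ⟨i.1 + 1, by omega⟩

theorem exists_word {k : ℕ} (σ : Equiv.Perm (Fin k)) :
    ∃ w : List (Fin (k - 1)), (w.map adjSwap).prod = σ := by
  rcases k with _ | n
  · exact ⟨[], Subsingleton.elim _ _⟩
  · have h : σ ∈ Submonoid.closure (Set.range (adjSwap : Fin (n + 1 - 1) → _)) := by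
      have h2 := Equiv.Perm.mclosure_swap_castSucc_succ n
      have h3 : (adjSwap : Fin (n + 1 - 1) → Equiv.Perm (Fin (n + 1)))
          = fun i : Fin n ↦ Equiv.swap i.castSucc i.succ := rfl
      rw [h3, h2]
      trivial
    induction h using Submonoid.closure_induction with
    | mem x hx =>
      obtain ⟨i, rfl⟩ := hx
      exact ⟨[i], by simp⟩
    | one => exact ⟨[], by simp⟩
    | mul x y _ _ hx hy =>
      obtain ⟨u, rfl⟩ := hx
      obtain ⟨v, rfl⟩ := hy
      exact ⟨u ++ v, by simp⟩

/-- The length `ℓ(σ)`: the least number of adjacent transpositions with product `σ`. -/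
noncomputable def length {k : ℕ} (σ : Equiv.Perm (Fin k)) : ℕ :=
  sInf {l | ∃ w : List (Fin (k - 1)), w.length = l ∧ (w.map adjSwap).prod = σ}

theorem exists_reducedWord {k : ℕ} (σ : Equiv.Perm (Fin k)) :
    ∃ w : List (Fin (k - 1)), w.length = length σ ∧ (w.map adjSwap).prod = σ := by
  obtain ⟨w, hw⟩ := exists_word σ
  exact Nat.sInf_mem
    (s := {l | ∃ w : List (Fin (k - 1)), w.length = l ∧ (w.map adjSwap).prod = σ})
    ⟨w.length, w, rfl, hw⟩

/-- A reduced expression of `σ`. -/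
noncomputable def reducedWord {k : ℕ} (σ : Equiv.Perm (Fin k)) : List (Fin (k - 1)) :=
  (exists_reducedWord σ).choose

/-- The partitions of `k`, given by their Young frames. -/
abbrev Shape (k : ℕ) : Type := {μ : YoungDiagram // μ.card = k}

noncomputable instance instDecidableEqShape (k : ℕ) : DecidableEq (Shape k) := Classical.decEq _

/-- `μ` is of `(m, n)` hook shape: its `(m+1)`-st part is at most `n`
(rows are numbered from `0`). -/
def IsHook (m n : ℕ) {k : ℕ} (μ : Shape k) : Prop := μ.1.rowLen m ≤ n

/-- Standard tableaux of shape `μ ⊢ k`: bijective fillings of the cells `(row, column)` of `μ`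
with the `k` letters, increasing along rows and down columns. -/
structure StandardTableau {k : ℕ} (μ : Shape k) where
  entry : {c // c ∈ μ.1.cells} ≃ Fin k
  row_lt : ∀ c d, c.1.1 = d.1.1 → c.1.2 < d.1.2 → entry c < entry d
  col_lt : ∀ c d, c.1.2 = d.1.2 → c.1.1 < d.1.1 → entry c < entry d

noncomputable instance instDecidableEqStandardTableau {k : ℕ} (μ : Shape k) :
    DecidableEq (StandardTableau μ) := Classical.decEq _

/-- The filling of a diagram with `k` cells by the `k` letters whose entries increase with the
values of `f` on the cells, values being compared lexicographically. -/
noncomputable def fillingOf {k : ℕ} (μ : Shape k) (f : ℕ × ℕ ≃ ℕ ×ₗ ℕ) :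
    {c // c ∈ μ.1.cells} ≃ Fin k :=
  (f.subtypeEquiv (by simp)).trans
    ((μ.1.cells.map f.toEmbedding).orderIsoOfFin (by simpa using μ.2)).symm.toEquiv

theorem fillingOf_lt {k : ℕ} (μ : Shape k) (f : ℕ × ℕ ≃ ℕ ×ₗ ℕ) (c d : {c // c ∈ μ.1.cells}) :
    fillingOf μ f c < fillingOf μ f d ↔ f c.1 < f d.1 := by
  simp [fillingOf]

/-- `S₊`: the entries increase by one along the rows, row after row. -/
noncomputable def Splus {k : ℕ} (μ : Shape k) : StandardTableau μ where
  entry := fillingOf μ toLex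
  row_lt c d h1 h2 := by
    rw [fillingOf_lt, Prod.Lex.toLex_lt_toLex]
    exact Or.inr ⟨h1, h2⟩
  col_lt c d _ h2 := by
    rw [fillingOf_lt, Prod.Lex.toLex_lt_toLex]
    exact Or.inl h2

/-- `S₋`: the entries increase by one down the columns, column after column. -/
noncomputable def Sminus {k : ℕ} (μ : Shape k) : StandardTableau μ where
  entry := fillingOf μ ((Equiv.prodComm ℕ ℕ).trans toLex)
  row_lt c d _ h2 := by
    rw [fillingOf_lt]
    exact Prod.Lex.toLex_lt_toLex.2 (Or.inl h2)
  col_lt c d h1 h2 := by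
    rw [fillingOf_lt]
    exact Prod.Lex.toLex_lt_toLex.2 (Or.inr ⟨h1, h2⟩)

/-- The permutation which transforms the tableau `S` into the tableau `T`. -/
def transform {k : ℕ} {μ : Shape k} (S T : StandardTableau μ) : Equiv.Perm (Fin k) :=
  S.entry.symm.trans T.entry

/-- The row group of `T`, as a finite set of permutations. -/
def rowGroup {k : ℕ} {μ : Shape k} (T : StandardTableau μ) : Finset (Equiv.Perm (Fin k)) :=
  Finset.univ.filter fun σ => ∀ a, (T.entry.symm (σ a)).1.1 = (T.entry.symm a).1.1

/-- The column group of `T`, as a finite set of permutations. -/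
def colGroup {k : ℕ} {μ : Shape k} (T : StandardTableau μ) : Finset (Equiv.Perm (Fin k)) :=
  Finset.univ.filter fun σ => ∀ a, (T.entry.symm (σ a)).1.2 = (T.entry.symm a).1.2

/-! ### The Iwahori-Hecke algebra -/

section Algebra

variable {R : Type*} [CommRing R]

/-- The defining relations of the Iwahori-Hecke algebra of type `A` with parameter `q²`. -/
inductive HeckeRel (q : Rˣ) (k : ℕ) :
    FreeAlgebra R (Fin (k - 1)) → FreeAlgebra R (Fin (k - 1)) → Prop
  | comm (i j : Fin (k - 1)) (hij : i.1 + 2 ≤ j.1) :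
      HeckeRel q k (FreeAlgebra.ι R i * FreeAlgebra.ι R j)
        (FreeAlgebra.ι R j * FreeAlgebra.ι R i)
  | braid (i j : Fin (k - 1)) (hij : j.1 = i.1 + 1) :
      HeckeRel q k (FreeAlgebra.ι R i * FreeAlgebra.ι R j * FreeAlgebra.ι R i)
        (FreeAlgebra.ι R j * FreeAlgebra.ι R i * FreeAlgebra.ι R j)
  | quad (i : Fin (k - 1)) :
      HeckeRel q k
        ((FreeAlgebra.ι R i + 1) *
          (FreeAlgebra.ι R i - algebraMap R (FreeAlgebra R (Fin (k - 1))) (q ^ 2))) 0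

/-- The Iwahori-Hecke algebra `H_k(q²)` over `R`. -/
abbrev Hecke (q : Rˣ) (k : ℕ) : Type _ := RingQuot (HeckeRel q k)

/-- The generators `h_i`. -/
noncomputable def gen (q : Rˣ) {k : ℕ} (i : Fin (k - 1)) : Hecke q k :=
  RingQuot.mkAlgHom R (HeckeRel q k) (FreeAlgebra.ι R i)

theorem gen_quad (q : Rˣ) {k : ℕ} (i : Fin (k - 1)) :
    (gen q i + 1) * (gen q i - algebraMap R (Hecke q k) (q ^ 2)) = 0 := by
  have h := RingQuot.mkAlgHom_rel R (HeckeRel.quad (q := q) (k := k) i)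
  rw [map_mul, map_add, map_sub, map_one, map_zero, AlgHom.commutes] at h
  exact h

theorem unit_aux {A : Type*} [Ring A] {g a b : A} (hab : a * b = 1) (ha : a * g = g * a)
    (hb : b * g = g * b) (h : (g + 1) * (g - b) = 0) :
    g * (a * (g + 1 - b)) = 1 ∧ a * (g + 1 - b) * g = 1 := by
  have h1 : g * (g + 1 - b) = b := by
    rw [← sub_eq_zero, ← h]
    noncomm_ring
  have h2 : (g + 1 - b) * g = g * (g + 1 - b) := by
    rw [sub_mul, hb]
    noncomm_ring
  constructor
  · rw [← mul_assoc, ← ha, mul_assoc, h1, hab]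
  · rw [mul_assoc, h2, h1, hab]

theorem gen_unit (q : Rˣ) {k : ℕ} (i : Fin (k - 1)) :
    gen q i * (algebraMap R (Hecke q k) (q⁻¹ ^ 2 : Rˣ) *
      (gen q i + 1 - algebraMap R (Hecke q k) (q ^ 2))) = 1 ∧
    algebraMap R (Hecke q k) (q⁻¹ ^ 2 : Rˣ) *
      (gen q i + 1 - algebraMap R (Hecke q k) (q ^ 2)) * gen q i = 1 :=
  unit_aux (by rw [← map_mul, ← Units.val_pow_eq_pow_val, ← Units.val_mul]; simp)
    (Algebra.commutes _ _) (Algebra.commutes _ _) (gen_quad q i)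

/-- The generators are units, with `h_i⁻¹ = q⁻² (h_i + 1 - q²)`. -/
noncomputable def genUnit (q : Rˣ) {k : ℕ} (i : Fin (k - 1)) : (Hecke q k)ˣ where
  val := gen q i
  inv := algebraMap R (Hecke q k) (q⁻¹ ^ 2 : Rˣ) *
    (gen q i + 1 - algebraMap R (Hecke q k) (q ^ 2))
  val_inv := (gen_unit q i).1
  inv_val := (gen_unit q i).2

/-- `h(σ) = h_{i_1} ⋯ h_{i_l}` for a reduced expression `σ = s_{i_1} ⋯ s_{i_l}`. -/
noncomputable def hPerm (q : Rˣ) {k : ℕ} (σ : Equiv.Perm (Fin k)) : (Hecke q k)ˣ :=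
  ((reducedWord σ).map (genUnit q)).prod

/-- `e₊ = ∑ h(σ)`, over the row group of `S₊`. -/
noncomputable def ePlus (q : Rˣ) {k : ℕ} (μ : Shape k) : Hecke q k :=
  ∑ σ ∈ rowGroup (Splus μ), (hPerm q σ : Hecke q k)

/-- `e₋ = ∑ (-q²)^{-ℓ(σ)} h(σ)`, over the column group of `S₋`. -/
noncomputable def eMinus (q : Rˣ) {k : ℕ} (μ : Shape k) : Hecke q k :=
  ∑ σ ∈ colGroup (Sminus μ), (((-(q ^ 2))⁻¹ ^ length σ : Rˣ) : R) • (hPerm q σ : Hecke q k)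

/-- `x_T(q) = h(σ^T_-) e₋ h(σ^T_-)⁻¹ h(σ^T_+) e₊ h(σ^T_+)⁻¹`. -/
noncomputable def xT (q : Rˣ) {k : ℕ} {μ : Shape k} (T : StandardTableau μ) : Hecke q k :=
  (hPerm q (transform (Sminus μ) T) : Hecke q k) * eMinus q μ *
    ((hPerm q (transform (Sminus μ) T))⁻¹ : (Hecke q k)ˣ) *
    (hPerm q (transform (Splus μ) T) : Hecke q k) * ePlus q μ *
    ((hPerm q (transform (Splus μ) T))⁻¹ : (Hecke q k)ˣ)

variable {K : Type*} [Field K]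

/-- The scalar `ξ` with `x_T(q)² = ξ x_T(q)`. -/
noncomputable def xi (q : Kˣ) {k : ℕ} {μ : Shape k} (T : StandardTableau μ) : K :=
  Classical.epsilon fun ξ : K => xT q T * xT q T = ξ • xT q T

/-- Gyoja's `q`-analogue `y_T(q) = ξ⁻¹ x_T(q)` of the Young symmetrizer. -/
noncomputable def yT (q : Kˣ) {k : ℕ} {μ : Shape k} (T : StandardTableau μ) : Hecke q k :=
  (xi q T)⁻¹ • xT q T

/-- The ideal `I^q_μ` of `H_k(q²)` labelled by `μ`: the two-sided ideal generated by the
`q`-Young symmetrizers of the standard tableaux of shape `μ`. -/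
noncomputable def blockIdeal (q : Kˣ) {k : ℕ} (μ : Shape k) : TwoSidedIdeal (Hecke q k) :=
  TwoSidedIdeal.span (Set.range fun T : StandardTableau μ => yT q T)

/-! ### The action on tensor space -/

/-- `V = R^m ⊕ R^n`, with basis `b_0, …, b_{m+n-1}`; the first `m` basis vectors are even,
the others odd. -/
abbrev V (R : Type*) (m n : ℕ) : Type _ := Fin (m + n) → R

/-- The tensor power `V^{⊗k}`. -/
abbrev TensorV (R : Type*) [CommRing R] (m n k : ℕ) : Type _ := ⨂[R] _ : Fin k, V R m n

/-- The basis of `V^{⊗k}` of the simple tensors `b_{f 0} ⊗ ⋯ ⊗ b_{f (k-1)}`. -/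
noncomputable def tensorBasis (R : Type*) [CommRing R] (m n k : ℕ) :
    Module.Basis (Fin k → Fin (m + n)) R (TensorV R m n k) :=
  Basis.piTensorProduct fun _ => Pi.basisFun R (Fin (m + n))

/-- The parity of `b_a`. -/
def parity (m n : ℕ) (a : Fin (m + n)) : ℕ := if a.1 < m then 0 else 1

/-- The coefficient of `b_a ⊗ b_b` in `Ř (b_a ⊗ b_b)`. -/
noncomputable def Rdiag (q : Rˣ) (m n : ℕ) (a b : Fin (m + n)) : R :=
  if a = b then (if parity m n a = 0 then q ^ 2 else -1) else if a < b then q ^ 2 - 1 else 0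

/-- The coefficient of `b_b ⊗ b_a` in `Ř (b_a ⊗ b_b)`, for `a ≠ b`. -/
noncomputable def Rswap (q : Rˣ) (m n : ℕ) (a b : Fin (m + n)) : R :=
  if a = b then 0 else (-1) ^ (parity m n a * parity m n b) * q

/-- The operator `r_j`: `Ř` in the tensor slots `j` and `j + 1`, where
`Ř (b_a ⊗ b_a) = q² b_a ⊗ b_a` for `b_a` even and `- b_a ⊗ b_a` for `b_a` odd, and, for `a ≠ b`,
`Ř (b_a ⊗ b_b) = (-1)^{p(b_a) p(b_b)} q b_b ⊗ b_a`, plus `(q² - 1) b_a ⊗ b_b` if `a < b`. -/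
noncomputable def rOp (q : Rˣ) (m n k : ℕ) (j : Fin (k - 1)) : Module.End R (TensorV R m n k) :=
  (tensorBasis R m n k).constr R fun f =>
    Rdiag q m n (f ⟨j.1, by omega⟩) (f ⟨j.1 + 1, by omega⟩) • tensorBasis R m n k f +
    Rswap q m n (f ⟨j.1, by omega⟩) (f ⟨j.1 + 1, by omega⟩) • tensorBasis R m n k (f ∘ adjSwap j)

theorem rOp_basis (q : Rˣ) (m n k : ℕ) (j : Fin (k - 1)) (f : Fin k → Fin (m + n)) :
    rOp q m n k j (tensorBasis R m n k f) =
    Rdiag q m n (f ⟨j.1, by omega⟩) (f ⟨j.1 + 1, by omega⟩) • tensorBasis R m n k f +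
    Rswap q m n (f ⟨j.1, by omega⟩) (f ⟨j.1 + 1, by omega⟩) •
      tensorBasis R m n k (f ∘ adjSwap j) := by
  rw [rOp, Module.Basis.constr_basis]

theorem comm_aux {M : Type*} [AddCommGroup M] [Module R M] (a b c d : R)
    (x y z w : M) :
    a • (c • x + d • y) + b • (c • z + d • w) = c • (a • x + b • z) + d • (a • y + b • w) := by
  module

theorem quad_aux {M : Type*} [AddCommGroup M] [Module R M] (a b c d t : R)
    (x y : M) (h1 : a * a + b * d + (1 - t) * a - t = 0) (h2 : b * (a + c + 1 - t) = 0) :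
    a • (a • x + b • y + x) + b • (c • y + d • x + y) - t • (a • x + b • y + x) = 0 := by
  linear_combination (norm := module) h1 • x + h2 • y

theorem rOp_comm (q : Rˣ) (m n k : ℕ) (i j : Fin (k - 1)) (hij : i.1 + 2 ≤ j.1) :
    rOp q m n k i * rOp q m n k j = rOp q m n k j * rOp q m n k i := by
  refine (tensorBasis R m n k).ext fun f => ?_
  have c : (f ∘ adjSwap j) ∘ adjSwap i = (f ∘ adjSwap i) ∘ adjSwap j := by
    funext x
    simp only [Function.comp, adjSwap, Equiv.swap_apply_def, Fin.ext_iff]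
    grind
  have e1 : adjSwap j ⟨i.1, by omega⟩ = (⟨i.1, by omega⟩ : Fin k) := by
    simp only [adjSwap, Equiv.swap_apply_def, Fin.ext_iff]; grind
  have e2 : adjSwap j ⟨i.1 + 1, by omega⟩ = (⟨i.1 + 1, by omega⟩ : Fin k) := by
    simp only [adjSwap, Equiv.swap_apply_def, Fin.ext_iff]; grind
  have e3 : adjSwap i ⟨j.1, by omega⟩ = (⟨j.1, by omega⟩ : Fin k) := by
    simp only [adjSwap, Equiv.swap_apply_def, Fin.ext_iff]; grind
  have e4 : adjSwap i ⟨j.1 + 1, by omega⟩ = (⟨j.1 + 1, by omega⟩ : Fin k) := by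
    simp only [adjSwap, Equiv.swap_apply_def, Fin.ext_iff]; grind
  simp only [Module.End.mul_apply, rOp_basis, map_add, map_smul, Function.comp_apply, e1, e2, e3,
    e4, c]
  exact comm_aux _ _ _ _ _ _ _ _

theorem Rswap_comm (q : Rˣ) (m n : ℕ) (a b : Fin (m + n)) : Rswap q m n a b = Rswap q m n b a := by
  simp only [Rswap, eq_comm (a := a) (b := b), mul_comm (parity m n a)]

theorem Rswap_sq (q : Rˣ) (m n : ℕ) (a b : Fin (m + n)) (h : a ≠ b) :
    Rswap q m n a b * Rswap q m n a b = q ^ 2 := by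
  simp only [Rswap, if_neg h]
  rw [mul_mul_mul_comm, ← mul_pow]
  simp [sq]

theorem rOp_quad (q : Rˣ) (m n k : ℕ) (j : Fin (k - 1)) :
    (rOp q m n k j + 1) * (rOp q m n k j - algebraMap R _ (q ^ 2)) = 0 := by
  refine (tensorBasis R m n k).ext fun f => ?_
  have c : (f ∘ adjSwap j) ∘ adjSwap j = f := by
    funext x
    simp [adjSwap]
  have e1 : adjSwap j ⟨j.1, by omega⟩ = (⟨j.1 + 1, by omega⟩ : Fin k) := by simp [adjSwap]
  have e2 : adjSwap j ⟨j.1 + 1, by omega⟩ = (⟨j.1, by omega⟩ : Fin k) := by simp [adjSwap]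
  simp only [Module.End.mul_apply, LinearMap.sub_apply, LinearMap.add_apply,
    Module.algebraMap_end_apply, Module.End.one_apply, rOp_basis, map_add, map_sub, map_smul,
    Function.comp_apply, e1, e2, c, LinearMap.zero_apply]
  generalize f ⟨j.1, by omega⟩ = a
  generalize f ⟨j.1 + 1, by omega⟩ = b
  have h1 : Rdiag q m n a b * Rdiag q m n a b + Rswap q m n a b * Rswap q m n b a
      + (1 - q ^ 2) * Rdiag q m n a b - q ^ 2 = 0 := by
    rw [← Rswap_comm q m n a b]
    by_cases hab : a = b
    · subst hab
      by_cases hp : parity m n a = 0 <;> simp [Rdiag, Rswap, hp] <;> ring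
    · rw [Rswap_sq q m n a b hab]
      by_cases hl : a < b <;> simp only [Rdiag, if_neg hab, hl, if_true, if_false] <;> ring
  have h2 : Rswap q m n a b * (Rdiag q m n a b + Rdiag q m n b a + 1 - q ^ 2) = 0 := by
    by_cases hab : a = b
    · simp [Rswap, hab]
    · rcases lt_or_gt_of_ne hab with hl | hl <;>
        simp [Rdiag, hab, Ne.symm hab, hl, hl.not_gt]
  exact quad_aux _ _ _ _ _ _ _ h1 h2

theorem braid_aux {M : Type*} [AddCommGroup M] [Module R M]
    {ab ac ba bc cb ab' ac' ba' bc' cb' : R}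
    (x0 x1 x2 x12 x21 x121 : M)
    (h0 : ab * bc * ab + ab' * ac * ba' = bc * ab * bc + bc' * ac * cb')
    (h1 : ab * bc * ab' + ab' * ac * ba = bc * ab' * ac)
    (h2 : ab * bc' * ac = bc * ab * bc' + bc' * ac * cb)
    (h12 : ab' * ac' * bc = bc * ab' * ac')
    (h21 : ab * bc' * ac' = bc' * ac' * ab)
    (h121 : ab' * ac' * bc' = bc' * ac' * ab') :
    ab • (bc • (ab • x0 + ab' • x1) + bc' • (ac • x2 + ac' • x21)) +
      ab' • (ac • (ba • x1 + ba' • x0) + ac' • (bc • x12 + bc' • x121)) =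
    bc • (ab • (bc • x0 + bc' • x2) + ab' • (ac • x1 + ac' • x12)) +
      bc' • (ac • (cb • x2 + cb' • x0) + ac' • (ab • x21 + ab' • x121)) := by
  linear_combination (norm := module) h0 • x0 + h1 • x1 + h2 • x2 + h12 • x12 + h21 • x21 + h121 • x121

theorem Rdiag_self (q : Rˣ) (m n : ℕ) (a : Fin (m + n)) :
    Rdiag q m n a a * Rdiag q m n a a = ((q : R) ^ 2 - 1) * Rdiag q m n a a + (q : R) ^ 2 := by
  by_cases hp : parity m n a = 0 <;> simp [Rdiag, hp] <;> ring

theorem Rdiag_lt (q : Rˣ) (m n : ℕ) {a b : Fin (m + n)} (h : a < b) :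
    Rdiag q m n a b = (q : R) ^ 2 - 1 := by
  simp [Rdiag, h, h.ne]

theorem Rdiag_gt (q : Rˣ) (m n : ℕ) {a b : Fin (m + n)} (h : b < a) : Rdiag q m n a b = 0 := by
  simp [Rdiag, h.ne', h.not_gt]

theorem Rswap_self (q : Rˣ) (m n : ℕ) (a : Fin (m + n)) : Rswap q m n a a = 0 := by
  simp [Rswap]

theorem Rdiag_braid (q : Rˣ) (m n : ℕ) {a b : Fin (m + n)} (c : Fin (m + n)) (hab : a ≠ b) :
    Rdiag q m n a b * Rdiag q m n b c + Rdiag q m n a c * Rdiag q m n b a =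
      Rdiag q m n b c * Rdiag q m n a c := by
  rcases lt_or_gt_of_ne hab with h1 | h1 <;> rcases lt_trichotomy b c with h2 | h2 | h2 <;>
    rcases lt_trichotomy a c with h3 | h3 | h3 <;> first
      | (exfalso; order)
      | subst h2; simp only [Rdiag_lt, Rdiag_gt, h1]; ring
      | subst h3; simp only [Rdiag_lt, Rdiag_gt, h1]; ring
      | simp only [Rdiag_lt, Rdiag_gt, h1, h2, h3]; ring

theorem Rdiag_braid'' (q : Rˣ) (m n : ℕ) {b c : Fin (m + n)} (a : Fin (m + n)) (hbc : b ≠ c) :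
    Rdiag q m n b c * Rdiag q m n a b + Rdiag q m n a c * Rdiag q m n c b =
      Rdiag q m n a b * Rdiag q m n a c := by
  rcases lt_or_gt_of_ne hbc with h1 | h1 <;> rcases lt_trichotomy a b with h2 | h2 | h2 <;>
    rcases lt_trichotomy a c with h3 | h3 | h3 <;> first
      | (exfalso; order)
      | subst h2; simp only [Rdiag_lt, Rdiag_gt, h1]; ring
      | subst h3; simp only [Rdiag_lt, Rdiag_gt, h1]; ring
      | simp only [Rdiag_lt, Rdiag_gt, h1, h2, h3]; ring

theorem Rdiag_braid' (q : Rˣ) (m n : ℕ) (a b c : Fin (m + n)) :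
    Rdiag q m n a b * Rdiag q m n b c * Rdiag q m n a b +
      Rswap q m n a b * Rdiag q m n a c * Rswap q m n b a =
    Rdiag q m n b c * Rdiag q m n a b * Rdiag q m n b c +
      Rswap q m n b c * Rdiag q m n a c * Rswap q m n c b := by
  rw [Rswap_comm q m n b a, Rswap_comm q m n c b]
  by_cases hab : a = b
  · subst hab
    by_cases hac : a = c
    · subst hac
      simp [Rswap_self]
    · have h1 := Rswap_sq q m n a c hac
      have h2 := Rdiag_self q m n a
      rw [Rswap_self]
      rcases lt_or_gt_of_ne hac with h | h
      · rw [Rdiag_lt q m n h]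
        linear_combination ((q : R) ^ 2 - 1) * h2 - ((q : R) ^ 2 - 1) * h1
      · rw [Rdiag_gt q m n h]
        ring
  · by_cases hbc : b = c
    · subst hbc
      have h1 := Rswap_sq q m n a b hab
      have h2 := Rdiag_self q m n b
      rw [Rswap_self]
      rcases lt_or_gt_of_ne hab with h | h
      · rw [Rdiag_lt q m n h]
        linear_combination -((q : R) ^ 2 - 1) * h2 + ((q : R) ^ 2 - 1) * h1
      · rw [Rdiag_gt q m n h]
        ring
    · have h1 := Rswap_sq q m n a b hab
      have h2 := Rswap_sq q m n b c hbc
      have h3 : Rdiag q m n a b * Rdiag q m n b c * (Rdiag q m n a b - Rdiag q m n b c) = 0 := by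
        rcases lt_or_gt_of_ne hab with h | h <;> rcases lt_or_gt_of_ne hbc with h' | h' <;>
          simp only [Rdiag_lt, Rdiag_gt, h, h'] <;> ring
      linear_combination h3 + Rdiag q m n a c * (h1 - h2)

theorem rOp_braid (q : Rˣ) (m n k : ℕ) (i j : Fin (k - 1)) (hij : j.1 = i.1 + 1) :
    rOp q m n k i * rOp q m n k j * rOp q m n k i = rOp q m n k j * rOp q m n k i * rOp q m n k j := by
  refine (tensorBasis R m n k).ext fun f => ?_
  have hk : i.1 + 2 < k := by omega
  have ej : (⟨j.1, by omega⟩ : Fin k) = ⟨i.1 + 1, by omega⟩ := by simp [hij]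
  have ej' : (⟨j.1 + 1, by omega⟩ : Fin k) = ⟨i.1 + 2, by omega⟩ := by simp [hij]
  have a0 : adjSwap i ⟨i.1, by omega⟩ = (⟨i.1 + 1, by omega⟩ : Fin k) := by simp [adjSwap]
  have a1 : adjSwap i ⟨i.1 + 1, by omega⟩ = (⟨i.1, by omega⟩ : Fin k) := by simp [adjSwap]
  have a2 : adjSwap i ⟨i.1 + 2, by omega⟩ = (⟨i.1 + 2, by omega⟩ : Fin k) := by
    simp only [adjSwap, Equiv.swap_apply_def, Fin.ext_iff]; grind
  have b0 : adjSwap j ⟨i.1, by omega⟩ = (⟨i.1, by omega⟩ : Fin k) := by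
    simp only [adjSwap, Equiv.swap_apply_def, Fin.ext_iff]; grind
  have b1 : adjSwap j ⟨i.1 + 1, by omega⟩ = (⟨i.1 + 2, by omega⟩ : Fin k) := by
    simp only [adjSwap, Equiv.swap_apply_def, Fin.ext_iff]; grind
  have b2 : adjSwap j ⟨i.1 + 2, by omega⟩ = (⟨i.1 + 1, by omega⟩ : Fin k) := by
    simp only [adjSwap, Equiv.swap_apply_def, Fin.ext_iff]; grind
  have c1 : (f ∘ adjSwap i) ∘ adjSwap i = f := by
    funext x
    simp [adjSwap]
  have c2 : (f ∘ adjSwap j) ∘ adjSwap j = f := by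
    funext x
    simp [adjSwap]
  have c3 : ((f ∘ adjSwap i) ∘ adjSwap j) ∘ adjSwap i
      = ((f ∘ adjSwap j) ∘ adjSwap i) ∘ adjSwap j := by
    funext x
    simp only [Function.comp, adjSwap, Equiv.swap_apply_def, Fin.ext_iff]
    grind
  simp only [Module.End.mul_apply, rOp_basis, map_add, map_smul, Function.comp_apply, ej, ej',
    a0, a1, a2, b0, b1, b2, c1, c2, c3]
  generalize f ⟨i.1, by omega⟩ = a
  generalize f ⟨i.1 + 1, by omega⟩ = b
  generalize f ⟨i.1 + 2, by omega⟩ = c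
  apply braid_aux
  · exact Rdiag_braid' q m n a b c
  · by_cases hab : a = b
    · subst hab
      simp [Rswap_self]
    · linear_combination Rswap q m n a b * Rdiag_braid q m n c hab
  · by_cases hbc : b = c
    · subst hbc
      simp [Rswap_self]
    · linear_combination -Rswap q m n b c * Rdiag_braid'' q m n a hbc
  all_goals ring

/-- The representation `Ψ_q : H_k(q²) → End(V^{⊗k})` with `h_j ↦ r_j`. -/
noncomputable def Psi (q : Rˣ) (m n k : ℕ) : Hecke q k →ₐ[R] Module.End R (TensorV R m n k) :=
  RingQuot.liftAlgHom R ⟨FreeAlgebra.lift R (rOp q m n k), by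
    rintro _ _ (⟨i, j, hij⟩ | ⟨i, j, hij⟩ | ⟨i⟩)
    · simpa using rOp_comm q m n k i j hij
    · simpa using rOp_braid q m n k i j hij
    · simpa using rOp_quad q m n k i⟩

theorem Psi_gen (q : Rˣ) (m n k : ℕ) (j : Fin (k - 1)) : Psi q m n k (gen q j) = rOp q m n k j := by
  simp [Psi, gen]

end Algebra

/-! ### The field of rational functions -/

/-- The field `ℂ(q)`. -/
def Cq : Type := RatFunc ℂ

noncomputable instance instFieldCq : Field Cq := inferInstanceAs (Field (RatFunc ℂ))

/-- The indeterminate `q`, as a unit of `ℂ(q)`. -/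
noncomputable def qvar : Cqˣ :=
  Units.mk0 (show Cq from (RatFunc.X : RatFunc ℂ)) (RatFunc.X_ne_zero (K := ℂ))

end QuantumSuper

open QuantumSuper

/-!
The statement is proved by comparison with the group algebra at `q = 1`; semisimplicity of the Hecke
algebra and Schur-Weyl duality are not used.

*The algebra.* Matsumoto's theorem (`matsumoto`) shows that the `h(σ)` satisfy the expected
multiplication rules, and their action on the decreasing word of `k` even letters shows that they
form a basis, over every commutative ring (`hBasis`). So the Hecke algebra, the elements `x_T`, and
the matrices of the representation on tensor space are compatible with change of the base ring
(`heckeMap`). This is applied to `ℂ[q, q⁻¹]`, which embeds in `ℂ(q)` and maps to `ℂ` by `q ↦ 1`.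

*Products of symmetrizers.* The products `e₋ h(σ) e₊` depend, up to scalars, only on the double coset
of `σ` with respect to the two Young subgroups. They vanish if the subgroups meet after conjugation
by `σ`, since then a generator acts by `q²` and by `-1` at once (`mul_hPerm_mul_eq_zero`). By the
Gale-Ryser theorem this gives `x_T H x_S = 0` for tableaux of different shapes
(`xT_mul_mul_xT_of_ne`), and for tableaux of the same shape `x_T H x_S` is at most a line
(`exists_xT_mul_mul_xT`). In particular `x_T² = ξ x_T`.

*The group algebra.* At `q = 1` the `x_T` are the Young symmetrizers. They are not nilpotent, and the
elements `x_T π`, where `π` transforms `S` into `T`, are linearly independent, for all pairs `(T, S)`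
of tableaux of the same shape (`linearIndependent_xT_one`). There are `k!` such pairs, because
Young's lattice is differential (`sum_numChains_above`). A determinant then shows that the
corresponding elements form a basis over `ℂ(q)`. So the algebra is the sum of the right ideals
`y_T H`, whose dimensions are at most the numbers of tableaux of the shapes, and the sum is direct by
counting. This yields elements `a_T` with `∑ y_T a_T = 1` and `y_T a_T y_S = 0` for `S ≠ T`
(`exists_dual_yT`), from which all the decompositions are read off.

*Tensor space.* At `q = 1`, the Young symmetrizer of a shape outside the `(m, n)` hook kills tensor
space, by a highest weight argument (`Psi_xT_one_eq_zero`), and for a shape inside the hook it does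
not kill the canonical word (`Psi_xT_one_ne_zero`). Being nonzero lifts from `q = 1` to generic `q`
directly. Vanishing lifts because the rank of the idempotent `Ψ(y_T)` is determined by the trace of
`Ψ(x_T)` (`Psi_xT_eq_zero`). Hence the kernel of `Ψ` is the sum of the blocks outside the hook.
-/

namespace QuantumSuper

/-! ### Inversions and the length function -/

section Perm

variable {k : ℕ}

/-- The lower of the two letters exchanged by `adjSwap i`. -/
def lo (i : Fin (k - 1)) : Fin k := ⟨i.1, by omega⟩

/-- The upper of the two letters exchanged by `adjSwap i`. -/
def hi (i : Fin (k - 1)) : Fin k := ⟨i.1 + 1, by omega⟩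

theorem lo_lt_hi (i : Fin (k - 1)) : lo i < hi i := by simp [lo, hi, Fin.lt_def]

theorem adjSwap_eq (i : Fin (k - 1)) : adjSwap i = Equiv.swap (lo i) (hi i) := rfl

@[simp] theorem adjSwap_lo (i : Fin (k - 1)) : adjSwap i (lo i) = hi i := by simp [adjSwap_eq]

@[simp] theorem adjSwap_hi (i : Fin (k - 1)) : adjSwap i (hi i) = lo i := by simp [adjSwap_eq]

@[simp] theorem adjSwap_mul_self (i : Fin (k - 1)) : adjSwap i * adjSwap i = 1 := by
  simp [adjSwap_eq]

@[simp] theorem adjSwap_inv (i : Fin (k - 1)) : (adjSwap i)⁻¹ = adjSwap i := by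
  simp [adjSwap_eq]

@[simp] theorem adjSwap_symm (i : Fin (k - 1)) : (adjSwap i).symm = adjSwap i :=
  Equiv.symm_swap _ _

@[simp] theorem adjSwap_mul_mul (i : Fin (k - 1)) (σ : Equiv.Perm (Fin k)) :
    adjSwap i * (adjSwap i * σ) = σ := by
  rw [← mul_assoc, adjSwap_mul_self, one_mul]

@[simp] theorem mul_adjSwap_mul (i : Fin (k - 1)) (σ : Equiv.Perm (Fin k)) :
    σ * adjSwap i * adjSwap i = σ := by
  rw [mul_assoc, adjSwap_mul_self, mul_one]

@[simp] theorem adjSwap_adjSwap (i : Fin (k - 1)) (a : Fin k) :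
    adjSwap i (adjSwap i a) = a := by
  simp [adjSwap_eq]

theorem adjSwap_lt (i : Fin (k - 1)) {a b : Fin k} (h : a < b) (h' : ¬ (a = lo i ∧ b = hi i)) :
    adjSwap i a < adjSwap i b := by
  rw [adjSwap_eq, Equiv.swap_apply_def, Equiv.swap_apply_def]
  simp only [lo, hi, Fin.ext_iff, Fin.lt_def] at *
  split_ifs <;> simp_all <;> omega

/-- The inversions of `σ`. -/
def inversions (σ : Equiv.Perm (Fin k)) : Finset (Fin k × Fin k) :=
  Finset.univ.filter fun p => p.1 < p.2 ∧ σ p.2 < σ p.1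

theorem mem_inversions {σ : Equiv.Perm (Fin k)} {p : Fin k × Fin k} :
    p ∈ inversions σ ↔ p.1 < p.2 ∧ σ p.2 < σ p.1 := by simp [inversions]

theorem card_inversions_mul_adjSwap {σ : Equiv.Perm (Fin k)} {i : Fin (k - 1)}
    (h : σ (lo i) < σ (hi i)) :
    (inversions (σ * adjSwap i)).card = (inversions σ).card + 1 := by
  have key : inversions (σ * adjSwap i) = insert (lo i, hi i)
      ((inversions σ).map ((adjSwap i).prodCongr (adjSwap i)).toEmbedding) := by
    ext ⟨a, b⟩
    simp only [Finset.mem_insert, Finset.mem_map_equiv, mem_inversions, Equiv.Perm.coe_mul,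
      Function.comp_apply, Prod.mk.injEq, Equiv.prodCongr_symm, Equiv.prodCongr_apply,
      Prod.map_apply, adjSwap_symm]
    by_cases hab : a = lo i ∧ b = hi i
    · obtain ⟨rfl, rfl⟩ := hab
      simp [h, lo_lt_hi]
    · simp only [hab, false_or]
      constructor
      · rintro ⟨h1, h2⟩
        exact ⟨adjSwap_lt i h1 hab, h2⟩
      · rintro ⟨h1, h2⟩
        refine ⟨?_, h2⟩
        have := adjSwap_lt i h1 (by
          rintro ⟨h3, h4⟩
          rw [h3, h4] at h2
          exact absurd h2 h.not_gt)
        simpa using this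
  rw [key, Finset.card_insert_of_notMem, Finset.card_map]
  simp only [Finset.mem_map_equiv, mem_inversions, Equiv.prodCongr_symm, Equiv.prodCongr_apply,
    Prod.map_apply, adjSwap_symm, adjSwap_lo, adjSwap_hi, not_and]
  intro h1
  exact absurd h1 (lo_lt_hi i).not_gt

theorem card_inversions_mul_adjSwap' {σ : Equiv.Perm (Fin k)} {i : Fin (k - 1)}
    (h : σ (hi i) < σ (lo i)) :
    (inversions (σ * adjSwap i)).card + 1 = (inversions σ).card := by
  have := card_inversions_mul_adjSwap (σ := σ * adjSwap i) (i := i) (by simpa using h)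
  rw [mul_adjSwap_mul] at this
  exact this.symm

theorem card_inversions_inv (σ : Equiv.Perm (Fin k)) :
    (inversions σ⁻¹).card = (inversions σ).card := by
  refine Finset.card_nbij' (fun p => (σ⁻¹ p.2, σ⁻¹ p.1)) (fun p => (σ p.2, σ p.1)) ?_ ?_ ?_ ?_ <;>
    intro p <;> simp [mem_inversions] <;> tauto

theorem card_inversions_prod_le (w : List (Fin (k - 1))) :
    (inversions (w.map adjSwap).prod).card ≤ w.length := by
  induction w using List.reverseRecOn with
  | nil =>
    simp only [List.map_nil, List.prod_nil, List.length_nil, Nat.le_zero, Finset.card_eq_zero]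
    ext p
    simp only [mem_inversions, Equiv.Perm.coe_one, id_eq, Finset.notMem_empty, iff_false, not_and]
    exact fun h => h.not_gt
  | append_singleton w i ih =>
    rw [List.map_append, List.prod_append, List.length_append]
    simp only [List.map_cons, List.map_nil, List.prod_cons, List.prod_nil, mul_one,
      List.length_cons, List.length_nil]
    rcases lt_trichotomy ((w.map adjSwap).prod (lo i)) ((w.map adjSwap).prod (hi i)) with h | h | h
    · rw [card_inversions_mul_adjSwap h]; omega
    · exact absurd ((Equiv.injective _) h) (lo_lt_hi i).ne
    · have := card_inversions_mul_adjSwap' h; omega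

theorem exists_descent {σ : Equiv.Perm (Fin k)} (h : σ ≠ 1) :
    ∃ i : Fin (k - 1), σ (hi i) < σ (lo i) := by
  by_contra! hc
  apply h
  have hm : StrictMono σ := by
    rcases k with _ | n
    · exact fun a => a.elim0
    · rw [Fin.strictMono_iff_lt_succ]
      intro i
      refine lt_of_le_of_ne (hc i) fun h => ?_
      exact absurd (σ.injective h) (lo_lt_hi (k := n + 1) i).ne
  ext a
  have := Subsingleton.elim (StrictMono.orderIsoOfSurjective σ hm σ.surjective) (OrderIso.refl _)
  have h2 := congrArg (fun e : Fin k ≃o Fin k => e a) this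
  simpa using congrArg Fin.val h2

theorem exists_word_card_inversions (n : ℕ) (σ : Equiv.Perm (Fin k))
    (h : (inversions σ).card = n) :
    ∃ w : List (Fin (k - 1)), w.length = n ∧ (w.map adjSwap).prod = σ := by
  induction n generalizing σ with
  | zero =>
    refine ⟨[], rfl, ?_⟩
    by_contra hc
    obtain ⟨i, hi⟩ := exists_descent (Ne.symm hc)
    have := card_inversions_mul_adjSwap' hi
    omega
  | succ n ih =>
    have : σ ≠ 1 := by
      rintro rfl
      have := card_inversions_prod_le (k := k) []
      simp only [List.map_nil, List.prod_nil, List.length_nil] at this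
      omega
    obtain ⟨i, hi⟩ := exists_descent this
    have h1 := card_inversions_mul_adjSwap' hi
    obtain ⟨w, hw, hw'⟩ := ih (σ * adjSwap i) (by omega)
    exact ⟨w ++ [i], by simp [hw], by simp [hw']⟩

theorem length_le (w : List (Fin (k - 1))) : length (w.map adjSwap).prod ≤ w.length :=
  Nat.sInf_le ⟨w, rfl, rfl⟩

theorem length_eq_card_inversions (σ : Equiv.Perm (Fin k)) :
    length σ = (inversions σ).card := by
  apply le_antisymm
  · obtain ⟨w, hw, rfl⟩ := exists_word_card_inversions _ σ rfl
    exact (length_le w).trans hw.le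
  · obtain ⟨w, hw, rfl⟩ := exists_reducedWord σ
    rw [← hw]
    exact card_inversions_prod_le w

theorem length_one : length (1 : Equiv.Perm (Fin k)) = 0 :=
  Nat.le_zero.1 (by simpa using length_le (k := k) [])

theorem length_inv (σ : Equiv.Perm (Fin k)) : length σ⁻¹ = length σ := by
  simp only [length_eq_card_inversions, card_inversions_inv]

theorem length_mul_adjSwap {σ : Equiv.Perm (Fin k)} {i : Fin (k - 1)}
    (h : σ (lo i) < σ (hi i)) : length (σ * adjSwap i) = length σ + 1 := by
  simp only [length_eq_card_inversions, card_inversions_mul_adjSwap h]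

theorem length_adjSwap_mul {σ : Equiv.Perm (Fin k)} {i : Fin (k - 1)}
    (h : σ⁻¹ (lo i) < σ⁻¹ (hi i)) : length (adjSwap i * σ) = length σ + 1 := by
  rw [← length_inv, mul_inv_rev, adjSwap_inv, length_mul_adjSwap h, length_inv]

theorem length_adjSwap_mul' {σ : Equiv.Perm (Fin k)} {i : Fin (k - 1)}
    (h : σ⁻¹ (hi i) < σ⁻¹ (lo i)) : length (adjSwap i * σ) + 1 = length σ := by
  have := length_adjSwap_mul (σ := adjSwap i * σ) (i := i) (by simpa using h)
  simpa using this.symm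

theorem length_mul_adjSwap' {σ : Equiv.Perm (Fin k)} {i : Fin (k - 1)}
    (h : σ (hi i) < σ (lo i)) : length (σ * adjSwap i) + 1 = length σ := by
  have := length_mul_adjSwap (σ := σ * adjSwap i) (i := i) (by simpa using h)
  simpa using this.symm

theorem ascent_or_descent (σ : Equiv.Perm (Fin k)) (i : Fin (k - 1)) :
    σ (lo i) < σ (hi i) ∨ σ (hi i) < σ (lo i) :=
  lt_or_gt_of_ne fun h => absurd (σ.injective h) (lo_lt_hi i).ne

/-! ### The elements `h(σ)` -/

/-- A word is reduced if no shorter word has the same product. -/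
def IsReduced (w : List (Fin (k - 1))) : Prop := length (w.map adjSwap).prod = w.length

theorem IsReduced.tail {i : Fin (k - 1)} {w : List (Fin (k - 1))} (h : IsReduced (i :: w)) :
    IsReduced w ∧ (adjSwap i * (w.map adjSwap).prod)⁻¹ (hi i) <
      (adjSwap i * (w.map adjSwap).prod)⁻¹ (lo i) := by
  unfold IsReduced at *
  rw [List.map_cons, List.prod_cons, List.length_cons] at h
  have h1 := length_le w
  rcases ascent_or_descent (w.map adjSwap).prod⁻¹ i with h2 | h2
  · have := length_adjSwap_mul h2
    exact ⟨by omega, by simpa using h2⟩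
  · have := length_adjSwap_mul' h2
    omega

variable {R : Type*} [CommRing R] (q : Rˣ)

theorem genUnit_comm {i j : Fin (k - 1)} (hij : i.1 + 2 ≤ j.1) :
    genUnit q i * genUnit q j = genUnit q j * genUnit q i := by
  ext
  have h := RingQuot.mkAlgHom_rel R (HeckeRel.comm (q := q) (k := k) i j hij)
  simpa [genUnit, gen] using h

theorem genUnit_braid {i j : Fin (k - 1)} (hij : j.1 = i.1 + 1) :
    genUnit q i * genUnit q j * genUnit q i = genUnit q j * genUnit q i * genUnit q j := by
  ext
  have h := RingQuot.mkAlgHom_rel R (HeckeRel.braid (q := q) (k := k) i j hij)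
  simpa [genUnit, gen] using h

theorem adjSwap_comm {i j : Fin (k - 1)} (hij : i.1 + 2 ≤ j.1) :
    adjSwap i * adjSwap j = adjSwap j * adjSwap i := by
  ext x
  simp only [Equiv.Perm.mul_apply, adjSwap, Equiv.swap_apply_def, Fin.ext_iff]
  grind

theorem adjSwap_braid {i j : Fin (k - 1)} (hij : j.1 = i.1 + 1) :
    adjSwap i * adjSwap j * adjSwap i = adjSwap j * adjSwap i * adjSwap j := by
  ext x
  simp only [Equiv.Perm.mul_apply, adjSwap, Equiv.swap_apply_def, Fin.ext_iff]
  grind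

theorem adjSwap_apply_of_ne {i : Fin (k - 1)} {a : Fin k} (h1 : a ≠ lo i) (h2 : a ≠ hi i) :
    adjSwap i a = a := Equiv.swap_apply_of_ne_of_ne h1 h2

/-- Matsumoto's theorem for the Hecke algebra: two reduced words of the same permutation give
the same product of generators. -/
theorem matsumoto (n : ℕ) (u v : List (Fin (k - 1))) (hn : u.length = n) (hu : IsReduced u)
    (hv : IsReduced v) (h : (u.map adjSwap).prod = (v.map adjSwap).prod) :
    (u.map (genUnit q)).prod = (v.map (genUnit q)).prod := by
  induction n using Nat.strong_induction_on generalizing u v with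
  | _ n ih =>
  have hlen : u.length = v.length := by rw [← hu, ← hv, h]
  rcases u with _ | ⟨i, u⟩
  · rw [List.eq_nil_of_length_eq_zero hlen.symm]
  rcases v with _ | ⟨j, v⟩
  · simp at hlen
  simp only [List.length_cons] at hn hlen
  simp only [List.map_cons, List.prod_cons] at h ⊢
  obtain ⟨hu', hi'⟩ := hu.tail
  obtain ⟨hv', hj'⟩ := hv.tail
  rw [← h] at hj'
  set σ := adjSwap i * (u.map adjSwap).prod with hσ
  have lu : length σ = u.length + 1 := by
    have := hu
    rwa [IsReduced, List.map_cons, List.prod_cons, List.length_cons] at this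
  have eu : (u.map adjSwap).prod = adjSwap i * σ := by simp [hσ]
  have ev : (v.map adjSwap).prod = adjSwap j * σ := by simp [h]
  -- if the words begin with commuting letters, both can be replaced by words beginning with
  -- these two letters; if they begin with a braid, by the two words of the braid
  have far : ∀ {i j : Fin (k - 1)} (u v : List (Fin (k - 1))), u.length < n → v.length < n →
      i.1 + 2 ≤ j.1 → length σ = u.length + 1 → u.length = v.length → IsReduced u → IsReduced v →
      (u.map adjSwap).prod = adjSwap i * σ → (v.map adjSwap).prod = adjSwap j * σ →
      σ⁻¹ (hi i) < σ⁻¹ (lo i) → σ⁻¹ (hi j) < σ⁻¹ (lo j) →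
      genUnit q i * (u.map (genUnit q)).prod = genUnit q j * (v.map (genUnit q)).prod := by
    intro i j u v hun hvn hij lσ huv ru rv eu ev hi' hj'
    have l1 : length (adjSwap j * σ) + 1 = length σ := length_adjSwap_mul' hj'
    have l2 : length (adjSwap i * (adjSwap j * σ)) + 1 = length (adjSwap j * σ) := by
      apply length_adjSwap_mul'
      rw [mul_inv_rev, Equiv.Perm.mul_apply, Equiv.Perm.mul_apply, adjSwap_inv,
        adjSwap_apply_of_ne, adjSwap_apply_of_ne]
      · exact hi'
      all_goals simp only [lo, hi, ne_eq, Fin.ext_iff]; omega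
    obtain ⟨w, hw, hw'⟩ := exists_reducedWord (adjSwap i * (adjSwap j * σ))
    have e1 : ((j :: w).map adjSwap).prod = adjSwap i * σ := by
      rw [List.map_cons, List.prod_cons, hw', ← mul_assoc, ← mul_assoc, ← adjSwap_comm hij,
        mul_assoc (adjSwap i), adjSwap_mul_self, mul_one]
    have e2 : ((i :: w).map adjSwap).prod = adjSwap j * σ := by
      rw [List.map_cons, List.prod_cons, hw', adjSwap_mul_mul]
    have r1 : IsReduced (j :: w) := by
      rw [IsReduced, e1, ← eu, ru, List.length_cons]; omega
    have r2 : IsReduced (i :: w) := by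
      rw [IsReduced, e2, List.length_cons]; omega
    rw [ih _ hun u (j :: w) rfl ru r1 (by rw [eu, e1]),
      ih _ hvn v (i :: w) rfl rv r2 (by rw [ev, e2])]
    simp only [List.map_cons, List.prod_cons, ← mul_assoc, genUnit_comm q hij]
  have near : ∀ {i j : Fin (k - 1)} (u v : List (Fin (k - 1))), u.length < n → v.length < n →
      j.1 = i.1 + 1 → length σ = u.length + 1 → u.length = v.length → IsReduced u → IsReduced v →
      (u.map adjSwap).prod = adjSwap i * σ → (v.map adjSwap).prod = adjSwap j * σ →
      σ⁻¹ (hi i) < σ⁻¹ (lo i) → σ⁻¹ (hi j) < σ⁻¹ (lo j) →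
      genUnit q i * (u.map (genUnit q)).prod = genUnit q j * (v.map (genUnit q)).prod := by
    intro i j u v hun hvn hij lσ huv ru rv eu ev hi' hj'
    have e : lo j = hi i := by simp [lo, hi, hij]
    have a1 : adjSwap i (hi j) = hi j := by
      apply adjSwap_apply_of_ne <;> simp only [lo, hi, ne_eq, Fin.ext_iff] <;> omega
    have a2 : adjSwap j (lo i) = lo i := by
      apply adjSwap_apply_of_ne <;> simp only [lo, hi, ne_eq, Fin.ext_iff] <;> omega
    have l1 : length (adjSwap j * σ) + 1 = length σ := length_adjSwap_mul' hj'
    have l2 : length (adjSwap i * (adjSwap j * σ)) + 1 = length (adjSwap j * σ) := by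
      apply length_adjSwap_mul'
      rw [mul_inv_rev, Equiv.Perm.mul_apply, Equiv.Perm.mul_apply, adjSwap_inv, a2, ← e,
        adjSwap_lo]
      exact (e ▸ hj').trans hi'
    have l3 : length (adjSwap j * (adjSwap i * (adjSwap j * σ))) + 1 =
        length (adjSwap i * (adjSwap j * σ)) := by
      apply length_adjSwap_mul'
      simp only [mul_inv_rev, Equiv.Perm.mul_apply, adjSwap_inv]
      rw [a1, adjSwap_hi, e, adjSwap_hi, a2, ← e]
      exact e ▸ hi'
    obtain ⟨w, hw, hw'⟩ := exists_reducedWord (adjSwap j * (adjSwap i * (adjSwap j * σ)))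
    have e1 : ((j :: i :: w).map adjSwap).prod = adjSwap i * σ := by
      have h3 : adjSwap j * (adjSwap i * (adjSwap j * (adjSwap i * (adjSwap j * σ)))) =
          adjSwap i * σ := by
        have := adjSwap_braid hij
        calc _ = (adjSwap j * adjSwap i * adjSwap j) * (adjSwap i * (adjSwap j * σ)) := by
              simp only [mul_assoc]
          _ = _ := by
              rw [← this]
              simp only [mul_assoc, adjSwap_mul_mul]
      simpa only [List.map_cons, List.prod_cons, hw'] using h3
    have e2 : ((i :: j :: w).map adjSwap).prod = adjSwap j * σ := by
      simp only [List.map_cons, List.prod_cons, hw', adjSwap_mul_mul]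
    have r1 : IsReduced (j :: i :: w) := by
      rw [IsReduced, e1, ← eu, ru, List.length_cons, List.length_cons]; omega
    have r2 : IsReduced (i :: j :: w) := by
      rw [IsReduced, e2, List.length_cons, List.length_cons]; omega
    rw [ih _ hun u (j :: i :: w) rfl ru r1 (by rw [eu, e1]),
      ih _ hvn v (i :: j :: w) rfl rv r2 (by rw [ev, e2])]
    simp only [List.map_cons, List.prod_cons, ← mul_assoc, genUnit_braid q hij]
  rcases lt_trichotomy i.1 j.1 with hij | hij | hij
  · by_cases h2 : i.1 + 2 ≤ j.1
    · exact far u v (by omega) (by omega) h2 lu (by omega) hu' hv' eu ev hi' hj'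
    · exact near u v (by omega) (by omega) (by omega) lu (by omega) hu' hv' eu ev hi' hj'
  · obtain rfl : i = j := Fin.ext hij
    rw [ih u.length (by omega) u v rfl hu' hv' (by rw [eu, ev])]
  · by_cases h2 : j.1 + 2 ≤ i.1
    · exact (far v u (by omega) (by omega) h2 (by omega) (by omega) hv' hu' ev eu hj' hi').symm
    · exact (near v u (by omega) (by omega) (by omega) (by omega) (by omega) hv' hu' ev eu
        hj' hi').symm

theorem hPerm_prod {w : List (Fin (k - 1))} (h : IsReduced w) :
    hPerm q (w.map adjSwap).prod = (w.map (genUnit q)).prod := by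
  obtain ⟨h1, h2⟩ : (reducedWord (w.map adjSwap).prod).length = _ ∧
    ((reducedWord (w.map adjSwap).prod).map adjSwap).prod = _ :=
    (exists_reducedWord (w.map adjSwap).prod).choose_spec
  refine matsumoto q _ _ _ rfl ?_ h h2
  unfold IsReduced
  rw [h2]
  exact h1.symm

theorem hPerm_adjSwap_mul {σ : Equiv.Perm (Fin k)} {i : Fin (k - 1)}
    (h : σ⁻¹ (lo i) < σ⁻¹ (hi i)) : hPerm q (adjSwap i * σ) = genUnit q i * hPerm q σ := by
  obtain ⟨w, hw, rfl⟩ := exists_reducedWord σ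
  have h1 := length_adjSwap_mul h
  have h2 : IsReduced (i :: w) := by
    rw [IsReduced, List.map_cons, List.prod_cons, h1, List.length_cons, hw]
  have := hPerm_prod q h2
  rw [List.map_cons, List.prod_cons, List.map_cons, List.prod_cons] at this
  rw [this, hPerm_prod q hw.symm]

theorem hPerm_mul_adjSwap {σ : Equiv.Perm (Fin k)} {i : Fin (k - 1)}
    (h : σ (lo i) < σ (hi i)) : hPerm q (σ * adjSwap i) = hPerm q σ * genUnit q i := by
  obtain ⟨w, hw, rfl⟩ := exists_reducedWord σ
  have h1 := length_mul_adjSwap h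
  have h2 : IsReduced (w ++ [i]) := by
    simpa [IsReduced, hw] using h1
  have := hPerm_prod q h2
  simp only [List.map_append, List.prod_append, List.map_cons, List.map_nil, List.prod_cons,
    List.prod_nil, mul_one] at this
  rw [this, hPerm_prod q hw.symm]

theorem hPerm_one : hPerm q (1 : Equiv.Perm (Fin k)) = 1 := by
  have : IsReduced ([] : List (Fin (k - 1))) := by simp [IsReduced, length_one]
  simpa using hPerm_prod q this

/-- Induction along a reduced expression, adding letters on the left. -/
theorem perm_induction_left {P : Equiv.Perm (Fin k) → Prop} (one : P 1)
    (step : ∀ (i : Fin (k - 1)) (σ : Equiv.Perm (Fin k)), σ⁻¹ (lo i) < σ⁻¹ (hi i) → P σ →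
      P (adjSwap i * σ)) (σ : Equiv.Perm (Fin k)) : P σ := by
  induction h : length σ using Nat.strong_induction_on generalizing σ with
  | _ n ih =>
  by_cases h1 : σ = 1
  · rwa [h1]
  · obtain ⟨i, hi⟩ := exists_descent (inv_ne_one.2 h1)
    have h2 := length_adjSwap_mul' hi
    have := step i (adjSwap i * σ) (by simpa using hi) (ih _ (by omega) _ rfl)
    simpa using this

end Perm

/-! ### The basis of the Hecke algebra -/

section Basis

variable {k : ℕ} {R : Type*} [CommRing R] (q : Rˣ)

theorem gen_mul_gen (i : Fin (k - 1)) :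
    gen q i * gen q i = ((q : R) ^ 2 - 1) • gen q i + ((q : R) ^ 2) • 1 := by
  have h := gen_quad q i
  rw [Algebra.algebraMap_eq_smul_one, mul_sub, add_mul, one_mul, mul_smul_comm, mul_one] at h
  linear_combination (norm := module) h

theorem gen_mul_hPerm {σ : Equiv.Perm (Fin k)} {i : Fin (k - 1)}
    (h : σ⁻¹ (lo i) < σ⁻¹ (hi i)) :
    gen q i * (hPerm q σ : Hecke q k) = (hPerm q (adjSwap i * σ) : Hecke q k) := by
  rw [hPerm_adjSwap_mul q h]
  rfl

theorem hPerm_mul_gen {σ : Equiv.Perm (Fin k)} {i : Fin (k - 1)}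
    (h : σ (lo i) < σ (hi i)) :
    (hPerm q σ : Hecke q k) * gen q i = (hPerm q (σ * adjSwap i) : Hecke q k) := by
  rw [hPerm_mul_adjSwap q h]
  rfl

theorem gen_mul_hPerm' {σ : Equiv.Perm (Fin k)} {i : Fin (k - 1)}
    (h : σ⁻¹ (hi i) < σ⁻¹ (lo i)) :
    gen q i * (hPerm q σ : Hecke q k) = ((q : R) ^ 2 - 1) • (hPerm q σ : Hecke q k) +
      ((q : R) ^ 2) • (hPerm q (adjSwap i * σ) : Hecke q k) := by
  have h1 := gen_mul_hPerm q (σ := adjSwap i * σ) (i := i) (by simpa using h)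
  rw [adjSwap_mul_mul] at h1
  rw [← h1, ← mul_assoc, gen_mul_gen, add_mul, smul_mul_assoc, smul_mul_assoc, one_mul]

/-- A submodule of the Hecke algebra which contains `1` and is stable under left multiplication by
the generators is everything. -/
theorem eq_top_of_gen_mul_mem (N : Submodule R (Hecke q k)) (h1 : (1 : Hecke q k) ∈ N)
    (hN : ∀ i, ∀ x ∈ N, gen q i * x ∈ N) : N = ⊤ := by
  refine Submodule.eq_top_iff'.2 fun x => ?_
  suffices h : ∀ y : FreeAlgebra R (Fin (k - 1)), ∀ v ∈ N,
      RingQuot.mkAlgHom R (HeckeRel q k) y * v ∈ N by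
    obtain ⟨y, rfl⟩ := RingQuot.mkAlgHom_surjective R (HeckeRel q k) x
    simpa using h y 1 h1
  intro y
  induction y using FreeAlgebra.induction with
  | grade0 r =>
    intro v hv
    rw [AlgHom.commutes, ← Algebra.smul_def]
    exact N.smul_mem r hv
  | grade1 i => exact hN i
  | mul a b ha hb =>
    intro v hv
    rw [map_mul, mul_assoc]
    exact ha _ (hb _ hv)
  | add a b ha hb =>
    intro v hv
    rw [map_add, add_mul]
    exact N.add_mem (ha _ hv) (hb _ hv)

/-- The span of the `h(σ)` is stable under multiplication by the generators. -/
theorem span_hPerm : Submodule.span R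
    (Set.range fun σ : Equiv.Perm (Fin k) => (hPerm q σ : Hecke q k)) = ⊤ := by
  apply eq_top_of_gen_mul_mem
  · exact Submodule.subset_span ⟨1, by simp [hPerm_one]⟩
  · intro i x hx
    induction hx using Submodule.span_induction with
    | mem x hx =>
      obtain ⟨σ, rfl⟩ := hx
      rcases ascent_or_descent σ⁻¹ i with h | h
      · simp only [gen_mul_hPerm q h]
        exact Submodule.subset_span ⟨_, rfl⟩
      · simp only [gen_mul_hPerm' q h]
        exact Submodule.add_mem _ (Submodule.smul_mem _ _ (Submodule.subset_span ⟨_, rfl⟩))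
          (Submodule.smul_mem _ _ (Submodule.subset_span ⟨_, rfl⟩))
    | zero => simp
    | add x y _ _ hx hy => rw [mul_add]; exact Submodule.add_mem _ hx hy
    | smul a x _ hx => rw [mul_smul_comm]; exact Submodule.smul_mem _ _ hx

/-- The strictly decreasing word in `k` even letters. -/
def revWord (k : ℕ) : Fin k → Fin (k + 0) := fun a => ⟨(Fin.rev a).1, by omega⟩

/-- On the decreasing word every factor of a reduced expression of `σ` acts by a transposition of
slots and the scalar `q`. -/
theorem Psi_hPerm_revWord (σ : Equiv.Perm (Fin k)) :
    Psi q k 0 k (hPerm q σ) (tensorBasis R k 0 k (revWord k)) =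
      (q ^ length σ : Rˣ) • tensorBasis R k 0 k (revWord k ∘ (σ⁻¹ : Equiv.Perm (Fin k))) := by
  induction σ using perm_induction_left with
  | one => simp [hPerm_one, length_one]
  | step i σ h ih =>
    rw [length_adjSwap_mul h, ← gen_mul_hPerm q h, map_mul, Module.End.mul_apply, ih, Psi_gen,
      Units.smul_def, map_smul, rOp_basis]
    have h1 : revWord k (σ⁻¹ (hi i)) < revWord k (σ⁻¹ (lo i)) := by
      simpa only [revWord, Fin.lt_def] using Fin.rev_lt_rev.2 h
    have h2 : (revWord k ∘ (σ⁻¹ : Equiv.Perm (Fin k))) ∘ adjSwap i =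
        revWord k ∘ ((adjSwap i * σ)⁻¹ : Equiv.Perm (Fin k)) := by
      rw [mul_inv_rev, adjSwap_inv, Equiv.Perm.coe_mul, Function.comp_assoc]
    have h3 : Rdiag q k 0 (revWord k (σ⁻¹ (lo i))) (revWord k (σ⁻¹ (hi i))) = 0 :=
      Rdiag_gt q k 0 h1
    have h4 : Rswap q k 0 (revWord k (σ⁻¹ (lo i))) (revWord k (σ⁻¹ (hi i))) = q := by
      have : ∀ a : Fin (k + 0), parity k 0 a = 0 := fun a => if_pos a.2
      rw [Rswap, if_neg h1.ne', this, zero_mul, pow_zero, one_mul]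
    change _ • (Rdiag q k 0 (revWord k (σ⁻¹ (lo i))) (revWord k (σ⁻¹ (hi i))) • _ +
      Rswap q k 0 (revWord k (σ⁻¹ (lo i))) (revWord k (σ⁻¹ (hi i))) • _) = _
    rw [h3, h4, h2, zero_smul, zero_add, smul_smul, pow_succ, Units.smul_def, Units.val_mul]

theorem revWord_injective (k : ℕ) : Function.Injective (revWord k) := by
  intro a b h
  exact Fin.rev_injective (Fin.ext (congrArg Fin.val h))

theorem linearIndependent_hPerm : LinearIndependent R
    (fun σ : Equiv.Perm (Fin k) => (hPerm q σ : Hecke q k)) := by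
  let φ : Hecke q k →ₗ[R] TensorV R k 0 k :=
    (LinearMap.applyₗ (tensorBasis R k 0 k (revWord k))).comp (Psi q k 0 k).toLinearMap
  refine LinearIndependent.of_comp φ ?_
  have h1 : φ ∘ (fun σ : Equiv.Perm (Fin k) => (hPerm q σ : Hecke q k)) =
      (fun σ : Equiv.Perm (Fin k) => (q ^ length σ : Rˣ)) •
        (tensorBasis R k 0 k ∘ fun σ : Equiv.Perm (Fin k) =>
          revWord k ∘ (σ⁻¹ : Equiv.Perm (Fin k))) := by
    funext σ
    exact Psi_hPerm_revWord q σ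
  rw [h1]
  refine ((tensorBasis R k 0 k).linearIndependent.comp _ ?_).units_smul _
  intro σ τ h
  refine inv_injective (Equiv.ext fun a => revWord_injective k ?_)
  exact congrFun h a

/-- The basis of the elements `h(σ)` of the Hecke algebra. -/
noncomputable def hBasis : Module.Basis (Equiv.Perm (Fin k)) R (Hecke q k) :=
  Module.Basis.mk (linearIndependent_hPerm q) (span_hPerm q).ge

@[simp] theorem hBasis_apply (σ : Equiv.Perm (Fin k)) : hBasis q σ = (hPerm q σ : Hecke q k) :=
  Module.Basis.mk_apply _ _ _

instance : Module.Free R (Hecke q k) := Module.Free.of_basis (hBasis q)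

instance : Module.Finite R (Hecke q k) := Module.Finite.of_basis (hBasis q)

end Basis

/-! ### Change of the base ring -/

section BaseChange

variable {k : ℕ} {R S : Type*} [CommRing R] [CommRing S] [Algebra R S] {q : Rˣ} {q' : Sˣ}

/-- The homomorphism between Hecke algebras which extends a homomorphism of base rings. -/
noncomputable def heckeMap (k : ℕ) (h : algebraMap R S q = q') : Hecke q k →ₐ[R] Hecke q' k :=
  RingQuot.liftAlgHom R ⟨FreeAlgebra.lift R (gen q'), by
    rintro _ _ (⟨i, j, hij⟩ | ⟨i, j, hij⟩ | ⟨i⟩)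
    · simpa [genUnit] using congrArg Units.val (genUnit_comm q' hij)
    · simpa [genUnit] using congrArg Units.val (genUnit_braid q' hij)
    · have h1 := gen_quad q' i
      rw [← h, ← map_pow, ← IsScalarTower.algebraMap_apply R S (Hecke q' k)] at h1
      simpa using h1⟩

variable (h : algebraMap R S q = q')

theorem heckeMap_gen (i : Fin (k - 1)) : heckeMap k h (gen q i) = gen q' i := by
  simp [heckeMap, gen]

theorem units_map_hPerm (σ : Equiv.Perm (Fin k)) :
    Units.map (heckeMap k h : Hecke q k →* Hecke q' k) (hPerm q σ) = hPerm q' σ := by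
  rw [hPerm, hPerm, map_list_prod, List.map_map]
  congr 2
  funext i
  ext
  exact heckeMap_gen h i

theorem heckeMap_hPerm (σ : Equiv.Perm (Fin k)) :
    heckeMap k h (hPerm q σ : Hecke q k) = (hPerm q' σ : Hecke q' k) :=
  congrArg Units.val (units_map_hPerm h σ)

theorem heckeMap_hPerm_inv (σ : Equiv.Perm (Fin k)) :
    heckeMap k h ((hPerm q σ)⁻¹ : (Hecke q k)ˣ) = ((hPerm q' σ)⁻¹ : (Hecke q' k)ˣ) := by
  rw [← units_map_hPerm h, ← map_inv]
  rfl

theorem heckeMap_smul (r : R) (x : Hecke q k) :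
    heckeMap k h (r • x) = algebraMap R S r • heckeMap k h x := by
  rw [map_smul, algebraMap_smul]

theorem heckeMap_ePlus (μ : Shape k) : heckeMap k h (ePlus q μ) = ePlus q' μ := by
  simp only [ePlus, map_sum, heckeMap_hPerm]

theorem algebraMap_neg_sq_inv_pow (h : algebraMap R S q = q') (n : ℕ) :
    algebraMap R S ((-(q ^ 2))⁻¹ ^ n : Rˣ) = ((-(q' ^ 2))⁻¹ ^ n : Sˣ) := by
  have h1 : Units.map (algebraMap R S : R →* S) (-(q ^ 2)) = -(q' ^ 2) := by
    ext
    simp [h]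
  rw [← h1, ← map_inv, ← map_pow]
  rfl

theorem heckeMap_eMinus (μ : Shape k) : heckeMap k h (eMinus q μ) = eMinus q' μ := by
  simp only [eMinus, map_sum, heckeMap_smul, heckeMap_hPerm, algebraMap_neg_sq_inv_pow h]

theorem heckeMap_xT {μ : Shape k} (T : StandardTableau μ) :
    heckeMap k h (xT q T) = xT q' T := by
  simp only [xT, map_mul, heckeMap_hPerm, heckeMap_hPerm_inv, heckeMap_ePlus, heckeMap_eMinus]

theorem hBasis_repr_heckeMap (x : Hecke q k) (σ : Equiv.Perm (Fin k)) :
    (hBasis q').repr (heckeMap k h x) σ = algebraMap R S ((hBasis q).repr x σ) := by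
  conv_lhs => rw [← (hBasis q).sum_repr x]
  simp only [map_sum, heckeMap_smul, hBasis_apply, heckeMap_hPerm]
  simp only [← hBasis_apply, map_smul, Module.Basis.repr_self, Finsupp.coe_finsetSum,
    Finset.sum_apply, Finsupp.smul_apply, smul_eq_mul, Finsupp.single_apply, mul_ite, mul_one,
    mul_zero, Finset.sum_ite_eq', Finset.mem_univ, if_true]

theorem heckeMap_injective (hinj : Function.Injective (algebraMap R S)) :
    Function.Injective (heckeMap k h) := by
  rw [injective_iff_map_eq_zero]
  intro x hx
  refine (hBasis q).ext_elem fun σ => hinj ?_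
  rw [← hBasis_repr_heckeMap h, hx]
  simp

theorem algebraMap_Rdiag (h : algebraMap R S q = q') (m n : ℕ) (a b : Fin (m + n)) :
    algebraMap R S (Rdiag q m n a b) = Rdiag q' m n a b := by
  simp only [Rdiag, apply_ite (algebraMap R S), map_sub, map_pow, map_neg, map_one, map_zero, h]

theorem algebraMap_Rswap (h : algebraMap R S q = q') (m n : ℕ) (a b : Fin (m + n)) :
    algebraMap R S (Rswap q m n a b) = Rswap q' m n a b := by
  simp only [Rswap, apply_ite (algebraMap R S), map_mul, map_pow, map_neg, map_one, map_zero, h]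

/-- The matrix of the action of `x` on tensor space is defined over the smaller base ring. -/
theorem toMatrix_Psi_heckeMap (m n : ℕ) (x : Hecke q k) :
    LinearMap.toMatrix (tensorBasis S m n k) (tensorBasis S m n k)
        (Psi q' m n k (heckeMap k h x)) =
      (LinearMap.toMatrix (tensorBasis R m n k) (tensorBasis R m n k) (Psi q m n k x)).map
        (algebraMap R S) := by
  let f : Hecke q k →ₐ[R] Matrix (Fin k → Fin (m + n)) (Fin k → Fin (m + n)) S :=
    ((LinearMap.toMatrixAlgEquiv (tensorBasis S m n k)).toAlgHom.restrictScalars R).comp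
      (((Psi q' m n k).restrictScalars R).comp (heckeMap k h))
  let g : Hecke q k →ₐ[R] Matrix (Fin k → Fin (m + n)) (Fin k → Fin (m + n)) S :=
    (Algebra.ofId R S).mapMatrix.comp
      ((LinearMap.toMatrixAlgEquiv (tensorBasis R m n k)).toAlgHom.comp (Psi q m n k))
  have hfg : f = g := by
    refine RingQuot.ringQuot_ext' R _ _ (FreeAlgebra.hom_ext (funext fun i => ?_))
    change f (gen q i) = g (gen q i)
    ext a b
    simp only [f, g, AlgHom.comp_apply, AlgHom.restrictScalars_apply, heckeMap_gen, Psi_gen,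
      AlgHom.mapMatrix_apply, Matrix.map_apply, Algebra.ofId_apply]
    change LinearMap.toMatrix (tensorBasis S m n k) (tensorBasis S m n k) (rOp q' m n k i) a b =
      algebraMap R S
        (LinearMap.toMatrix (tensorBasis R m n k) (tensorBasis R m n k) (rOp q m n k i) a b)
    simp only [LinearMap.toMatrix_apply, rOp_basis, map_add, map_smul, Module.Basis.repr_self,
      Finsupp.add_apply, Finsupp.smul_apply, Finsupp.single_apply, smul_eq_mul, map_mul,
      algebraMap_Rdiag h, algebraMap_Rswap h, apply_ite (algebraMap R S), map_one, map_zero]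
  exact congrArg (fun φ : Hecke q k →ₐ[R] Matrix _ _ S => φ x) hfg

theorem Psi_heckeMap_eq_zero (hinj : Function.Injective (algebraMap R S)) (m n : ℕ)
    {x : Hecke q k} (hx : Psi q' m n k (heckeMap k h x) = 0) : Psi q m n k x = 0 := by
  have h1 := toMatrix_Psi_heckeMap h m n x
  rw [hx, map_zero] at h1
  refine (LinearMap.toMatrix (tensorBasis R m n k) (tensorBasis R m n k)).injective ?_
  ext a b
  refine hinj ?_
  rw [← Matrix.map_apply (f := algebraMap R S), ← h1]
  simp

theorem trace_Psi_heckeMap (m n : ℕ) (x : Hecke q k) :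
    LinearMap.trace S _ (Psi q' m n k (heckeMap k h x)) =
      algebraMap R S (LinearMap.trace R _ (Psi q m n k x)) := by
  rw [LinearMap.trace_eq_matrix_trace S (tensorBasis S m n k),
    LinearMap.trace_eq_matrix_trace R (tensorBasis R m n k), toMatrix_Psi_heckeMap]
  simp only [Matrix.trace, Matrix.diag_apply, Matrix.map_apply, map_sum]

theorem heckeMap_matrix_det {ι : Type*} [Fintype ι] [DecidableEq ι]
    (e : ι ≃ Equiv.Perm (Fin k)) (v : ι → Hecke q k) :
    (Matrix.of fun i j => (hBasis q').repr (heckeMap k h (v i)) (e j)).det =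
      algebraMap R S (Matrix.of fun i j => (hBasis q).repr (v i) (e j)).det := by
  rw [RingHom.map_det]
  congr 1
  ext i j
  simp [hBasis_repr_heckeMap h]

end BaseChange

/-! ### Symmetrizers and double cosets -/

section Symmetrizer

variable {k : ℕ} {R : Type*} [CommRing R] (q : Rˣ)

theorem adjSwap_mul_ne (i : Fin (k - 1)) (σ : Equiv.Perm (Fin k)) : adjSwap i * σ ≠ σ := by
  intro h
  rw [mul_eq_right] at h
  have := congrArg (fun τ : Equiv.Perm (Fin k) => τ (lo i)) h
  exact (lo_lt_hi i).ne' (by simpa using this)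

theorem mul_adjSwap_ne (i : Fin (k - 1)) (σ : Equiv.Perm (Fin k)) : σ * adjSwap i ≠ σ := by
  intro h
  rw [mul_eq_left] at h
  have := congrArg (fun τ : Equiv.Perm (Fin k) => τ (lo i)) h
  exact (lo_lt_hi i).ne' (by simpa using this)

theorem hPerm_mul_gen' {σ : Equiv.Perm (Fin k)} {i : Fin (k - 1)}
    (h : σ (hi i) < σ (lo i)) :
    (hPerm q σ : Hecke q k) * gen q i = ((q : R) ^ 2 - 1) • (hPerm q σ : Hecke q k) +
      ((q : R) ^ 2) • (hPerm q (σ * adjSwap i) : Hecke q k) := by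
  have h1 := hPerm_mul_gen q (σ := σ * adjSwap i) (i := i) (by simpa using h)
  rw [mul_adjSwap_mul] at h1
  rw [← h1, mul_assoc, gen_mul_gen, mul_add, mul_smul_comm, mul_smul_comm, mul_one]

/-- The sum `∑ c ^ ℓ(σ) h(σ)` over a set of permutations. For `c = 1` and `c = -q⁻²` these are the
`q`-symmetrizers and the `q`-antisymmetrizers. -/
noncomputable def weightedSum (c : Rˣ) (P : Finset (Equiv.Perm (Fin k))) : Hecke q k :=
  ∑ σ ∈ P, ((c ^ length σ : Rˣ) : R) • (hPerm q σ : Hecke q k)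

/-- The terms of `σ` and `s_i σ` combine to an eigenvector of `h_i`, of eigenvalue `c q²`, which is
`q²` or `-1` by the assumption on `c`. -/
theorem gen_mul_weightedSum {c : Rˣ} (hc : (1 - (c : R)) * (1 + c * (q : R) ^ 2) = 0)
    {P : Finset (Equiv.Perm (Fin k))} {i : Fin (k - 1)} (hP : ∀ σ ∈ P, adjSwap i * σ ∈ P) :
    gen q i * weightedSum q c P = ((c : R) * (q : R) ^ 2) • weightedSum q c P := by
  have key : ∀ σ : Equiv.Perm (Fin k), σ⁻¹ (lo i) < σ⁻¹ (hi i) →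
      ((c ^ length σ : Rˣ) : R) • (gen q i * (hPerm q σ : Hecke q k) -
        ((c : R) * (q : R) ^ 2) • (hPerm q σ : Hecke q k)) +
      ((c ^ length (adjSwap i * σ) : Rˣ) : R) • (gen q i * (hPerm q (adjSwap i * σ) : Hecke q k) -
        ((c : R) * (q : R) ^ 2) • (hPerm q (adjSwap i * σ) : Hecke q k)) = 0 := by
    intro σ h
    rw [gen_mul_hPerm q h, gen_mul_hPerm' q (σ := adjSwap i * σ) (by simpa using h),
      adjSwap_mul_mul, length_adjSwap_mul h, pow_succ c, Units.val_mul]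
    linear_combination (norm := module) (((c ^ length σ : Rˣ) : R) * hc) •
      (hPerm q (adjSwap i * σ) : Hecke q k)
  rw [← sub_eq_zero, weightedSum, Finset.mul_sum, Finset.smul_sum, ← Finset.sum_sub_distrib]
  refine Finset.sum_involution (fun σ _ => adjSwap i * σ) ?_ (fun σ _ _ => adjSwap_mul_ne i σ)
    (fun σ hσ => hP σ hσ) (fun σ _ => adjSwap_mul_mul i σ)
  intro σ _
  rcases ascent_or_descent σ⁻¹ i with h | h
  · rw [← key σ h]
    simp only [mul_smul_comm, smul_sub, smul_comm ((c : R) * (q : R) ^ 2)]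
  · rw [← key (adjSwap i * σ) (by simpa using h)]
    simp only [mul_smul_comm, smul_sub, smul_comm ((c : R) * (q : R) ^ 2), adjSwap_mul_mul]
    rw [add_comm]

theorem weightedSum_mul_gen {c : Rˣ} (hc : (1 - (c : R)) * (1 + c * (q : R) ^ 2) = 0)
    {P : Finset (Equiv.Perm (Fin k))} {i : Fin (k - 1)} (hP : ∀ σ ∈ P, σ * adjSwap i ∈ P) :
    weightedSum q c P * gen q i = ((c : R) * (q : R) ^ 2) • weightedSum q c P := by
  have key : ∀ σ : Equiv.Perm (Fin k), σ (lo i) < σ (hi i) →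
      ((c ^ length σ : Rˣ) : R) • ((hPerm q σ : Hecke q k) * gen q i -
        ((c : R) * (q : R) ^ 2) • (hPerm q σ : Hecke q k)) +
      ((c ^ length (σ * adjSwap i) : Rˣ) : R) • ((hPerm q (σ * adjSwap i) : Hecke q k) * gen q i -
        ((c : R) * (q : R) ^ 2) • (hPerm q (σ * adjSwap i) : Hecke q k)) = 0 := by
    intro σ h
    rw [hPerm_mul_gen q h, hPerm_mul_gen' q (σ := σ * adjSwap i) (by simpa using h),
      mul_adjSwap_mul, length_mul_adjSwap h, pow_succ c, Units.val_mul]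
    linear_combination (norm := module) (((c ^ length σ : Rˣ) : R) * hc) •
      (hPerm q (σ * adjSwap i) : Hecke q k)
  rw [← sub_eq_zero, weightedSum, Finset.sum_mul, Finset.smul_sum, ← Finset.sum_sub_distrib]
  refine Finset.sum_involution (fun σ _ => σ * adjSwap i) ?_ (fun σ _ _ => mul_adjSwap_ne i σ)
    (fun σ hσ => hP σ hσ) (fun σ _ => mul_adjSwap_mul i σ)
  intro σ _
  rcases ascent_or_descent σ i with h | h
  · rw [← key σ h]
    simp only [smul_mul_assoc, smul_sub, smul_comm ((c : R) * (q : R) ^ 2)]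
  · rw [← key (σ * adjSwap i) (by simpa using h)]
    simp only [smul_mul_assoc, smul_sub, smul_comm ((c : R) * (q : R) ^ 2), mul_adjSwap_mul]
    rw [add_comm]

/-- The row of the letter `a` in the tableau `T`. -/
def rowOf {μ : Shape k} (T : StandardTableau μ) (a : Fin k) : ℕ := (T.entry.symm a).1.1

/-- The column of the letter `a` in the tableau `T`. -/
def colOf {μ : Shape k} (T : StandardTableau μ) (a : Fin k) : ℕ := (T.entry.symm a).1.2

theorem mem_rowGroup {μ : Shape k} {T : StandardTableau μ} {σ : Equiv.Perm (Fin k)} :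
    σ ∈ rowGroup T ↔ ∀ a, rowOf T (σ a) = rowOf T a := by simp [rowGroup, rowOf]

theorem mem_colGroup {μ : Shape k} {T : StandardTableau μ} {σ : Equiv.Perm (Fin k)} :
    σ ∈ colGroup T ↔ ∀ a, colOf T (σ a) = colOf T a := by simp [colGroup, colOf]

theorem comp_adjSwap {ρ : Fin k → ℕ} {i : Fin (k - 1)} (h : ρ (lo i) = ρ (hi i)) (a : Fin k) :
    ρ (adjSwap i a) = ρ a := by
  rw [adjSwap_eq, Equiv.swap_apply_def]
  split_ifs with h1 h2
  · rw [h1, h]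
  · rw [h2, h]
  · rfl

theorem ePlus_eq (μ : Shape k) : ePlus q μ = weightedSum q 1 (rowGroup (Splus μ)) := by
  simp [ePlus, weightedSum]

theorem eMinus_eq (μ : Shape k) :
    eMinus q μ = weightedSum q (-(q ^ 2))⁻¹ (colGroup (Sminus μ)) := rfl

theorem neg_sq_inv_mul : (((-(q ^ 2))⁻¹ : Rˣ) : R) * (q : R) ^ 2 = -1 := by
  rw [inv_neg, Units.val_neg, neg_mul, ← Units.val_pow_eq_pow_val, Units.inv_mul]

theorem gen_mul_ePlus {μ : Shape k} {i : Fin (k - 1)}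
    (h : rowOf (Splus μ) (lo i) = rowOf (Splus μ) (hi i)) :
    gen q i * ePlus q μ = ((q : R) ^ 2) • ePlus q μ := by
  rw [ePlus_eq, gen_mul_weightedSum q (by simp), Units.val_one, one_mul]
  intro σ hσ
  rw [mem_rowGroup] at *
  intro a
  rw [Equiv.Perm.mul_apply, comp_adjSwap h, hσ]

theorem ePlus_mul_gen {μ : Shape k} {i : Fin (k - 1)}
    (h : rowOf (Splus μ) (lo i) = rowOf (Splus μ) (hi i)) :
    ePlus q μ * gen q i = ((q : R) ^ 2) • ePlus q μ := by
  rw [ePlus_eq, weightedSum_mul_gen q (by simp), Units.val_one, one_mul]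
  intro σ hσ
  rw [mem_rowGroup] at *
  intro a
  rw [Equiv.Perm.mul_apply, hσ, comp_adjSwap h]

theorem gen_mul_eMinus {μ : Shape k} {i : Fin (k - 1)}
    (h : colOf (Sminus μ) (lo i) = colOf (Sminus μ) (hi i)) :
    gen q i * eMinus q μ = (-1 : R) • eMinus q μ := by
  rw [eMinus_eq, gen_mul_weightedSum q (by rw [neg_sq_inv_mul]; ring), neg_sq_inv_mul]
  intro σ hσ
  rw [mem_colGroup] at *
  intro a
  rw [Equiv.Perm.mul_apply, comp_adjSwap h, hσ]

theorem eMinus_mul_gen {μ : Shape k} {i : Fin (k - 1)}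
    (h : colOf (Sminus μ) (lo i) = colOf (Sminus μ) (hi i)) :
    eMinus q μ * gen q i = (-1 : R) • eMinus q μ := by
  rw [eMinus_eq, weightedSum_mul_gen q (by rw [neg_sq_inv_mul]; ring), neg_sq_inv_mul]
  intro σ hσ
  rw [mem_colGroup] at *
  intro a
  rw [Equiv.Perm.mul_apply, hσ, comp_adjSwap h]

theorem monotone_rowOf_Splus (μ : Shape k) : Monotone (rowOf (Splus μ)) := by
  intro a b h
  rcases h.lt_or_eq with h | h
  · have h1 := (fillingOf_lt μ toLex ((Splus μ).entry.symm a) ((Splus μ).entry.symm b)).1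
      (by change (Splus μ).entry _ < (Splus μ).entry _; simpa using h)
    rw [Prod.Lex.toLex_lt_toLex] at h1
    rcases h1 with h1 | h1
    · exact h1.le
    · exact h1.1.le
  · rw [h]

theorem monotone_colOf_Sminus (μ : Shape k) : Monotone (colOf (Sminus μ)) := by
  intro a b h
  rcases h.lt_or_eq with h | h
  · have h1 := (fillingOf_lt μ ((Equiv.prodComm ℕ ℕ).trans toLex)
      ((Sminus μ).entry.symm a) ((Sminus μ).entry.symm b)).1
      (by change (Sminus μ).entry _ < (Sminus μ).entry _; simpa using h)
    have h2 := Prod.Lex.toLex_lt_toLex.1 h1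
    rcases h2 with h2 | h2
    · exact h2.le
    · exact h2.1.le
  · rw [h]

end Symmetrizer

section DoubleCoset

variable {k : ℕ}

theorem perm_inv_apply (σ : Equiv.Perm (Fin k)) (a : Fin k) : σ⁻¹ (σ a) = a := by simp

theorem perm_apply_inv (σ : Equiv.Perm (Fin k)) (a : Fin k) : σ (σ⁻¹ a) = a := by simp

/-- A map which increases at each adjacent pair of letters inside a block increases on the block,
because the blocks of a monotone function are intervals. -/
theorem lt_of_block_ascent {ρ : Fin k → ℕ} (hρ : Monotone ρ) {f : Fin k → Fin k}
    (hf : ∀ i : Fin (k - 1), ρ (lo i) = ρ (hi i) → f (lo i) < f (hi i)) {a b : Fin k}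
    (hab : a < b) (h : ρ a = ρ b) : f a < f b := by
  obtain ⟨d, hd⟩ : ∃ d, b.1 = a.1 + d + 1 := ⟨b.1 - a.1 - 1, by have := Fin.lt_def.1 hab; omega⟩
  induction d generalizing b with
  | zero =>
    have := hf ⟨a.1, by omega⟩
    have e1 : lo (⟨a.1, by omega⟩ : Fin (k - 1)) = a := rfl
    have e2 : hi (⟨a.1, by omega⟩ : Fin (k - 1)) = b := Fin.ext (by simp [hi, hd])
    rw [e1, e2] at this
    exact this h
  | succ d ih =>
    let c : Fin k := ⟨a.1 + d + 1, by omega⟩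
    have hac : a < c := Fin.lt_def.2 (by simp only [c]; omega)
    have hcb : c < b := Fin.lt_def.2 (by simp only [c]; omega)
    have h1 : ρ a = ρ c := le_antisymm (hρ hac.le) (h ▸ hρ hcb.le)
    have := hf ⟨c.1, by simp only [c]; omega⟩
    have e1 : lo (⟨c.1, by simp only [c]; omega⟩ : Fin (k - 1)) = c := rfl
    have e2 : hi (⟨c.1, by simp only [c]; omega⟩ : Fin (k - 1)) = b :=
      Fin.ext (by simp only [hi, c]; omega)
    rw [e1, e2] at this
    exact (ih hac h1 rfl).trans (this (h1 ▸ h))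

/-- `σ` has minimal length in its double coset with respect to the Young subgroups which preserve
the blocks of `ρ` and of `κ`. -/
def IsMinimal (ρ κ : Fin k → ℕ) (σ : Equiv.Perm (Fin k)) : Prop :=
  (∀ i : Fin (k - 1), ρ (lo i) = ρ (hi i) → σ⁻¹ (lo i) < σ⁻¹ (hi i)) ∧
    ∀ i : Fin (k - 1), κ (lo i) = κ (hi i) → σ (lo i) < σ (hi i)

/-- No two letters lie in the same block of `κ` while their images under `σ` lie in the same block of
`ρ`: the Young subgroups of `κ` and `ρ` meet trivially after conjugation by `σ`. -/
def Separates (ρ κ : Fin k → ℕ) (σ : Equiv.Perm (Fin k)) : Prop :=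
  Function.Injective fun x => (ρ (σ x), κ x)

variable {K : Type*} [Field K] {q : Kˣ} {e e' : Hecke q k} {α β : K} {ρ κ : Fin k → ℕ}

/-- Every product `e h(σ) e'` reduces to one with `σ` minimal in its double coset: a factor `h_i` of
`h(σ)` which belongs to one of the Young subgroups is absorbed by `e` or `e'`. -/
theorem exists_isMinimal
    (he : ∀ i : Fin (k - 1), ρ (lo i) = ρ (hi i) → e * gen q i = α • e)
    (he' : ∀ i : Fin (k - 1), κ (lo i) = κ (hi i) → gen q i * e' = β • e')
    (σ : Equiv.Perm (Fin k)) :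
    ∃ (c : K) (τ : Equiv.Perm (Fin k)), IsMinimal ρ κ τ ∧ (Separates ρ κ τ ↔ Separates ρ κ σ) ∧
      e * (hPerm q σ : Hecke q k) * e' = c • (e * (hPerm q τ : Hecke q k) * e') := by
  induction h : length σ using Nat.strong_induction_on generalizing σ with
  | _ n ih =>
  by_cases h1 : ∃ i : Fin (k - 1), ρ (lo i) = ρ (hi i) ∧ σ⁻¹ (hi i) < σ⁻¹ (lo i)
  · obtain ⟨i, hi1, hi2⟩ := h1
    have h2 := length_adjSwap_mul' hi2
    obtain ⟨c, τ, hτ, hs, hc⟩ := ih _ (by omega) (adjSwap i * σ) rfl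
    refine ⟨α * c, τ, hτ, hs.trans ?_, ?_⟩
    · simp only [Separates, Equiv.Perm.mul_apply, comp_adjSwap hi1]
    · have h3 := gen_mul_hPerm q (σ := adjSwap i * σ) (i := i) (by simpa using hi2)
      rw [adjSwap_mul_mul] at h3
      rw [← h3, ← mul_assoc, he i hi1, smul_mul_assoc, smul_mul_assoc, hc, smul_smul]
  by_cases h2 : ∃ i : Fin (k - 1), κ (lo i) = κ (hi i) ∧ σ (hi i) < σ (lo i)
  · obtain ⟨i, hi1, hi2⟩ := h2
    have h2 := length_mul_adjSwap' hi2
    obtain ⟨c, τ, hτ, hs, hc⟩ := ih _ (by omega) (σ * adjSwap i) rfl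
    refine ⟨β * c, τ, hτ, hs.trans ?_, ?_⟩
    · have : (fun x => (ρ ((σ * adjSwap i) x), κ x)) =
          (fun x => (ρ (σ x), κ x)) ∘ adjSwap i := by
        funext x
        simp [comp_adjSwap hi1]
      rw [Separates, this, Separates]
      exact (adjSwap i).injective_comp _
    · have h3 := hPerm_mul_gen q (σ := σ * adjSwap i) (i := i) (by simpa using hi2)
      rw [mul_adjSwap_mul] at h3
      rw [← h3, mul_assoc, mul_assoc, he' i hi1, mul_smul_comm, mul_smul_comm, ← mul_assoc, hc,
        smul_smul]
  push Not at h1 h2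
  refine ⟨1, σ, ⟨fun i hi => ?_, fun i hi => ?_⟩, Iff.rfl, (one_smul _ _).symm⟩
  · exact (ascent_or_descent σ⁻¹ i).resolve_right (h1 i hi).not_gt
  · exact (ascent_or_descent σ i).resolve_right (h2 i hi).not_gt

/-- If `σ` is minimal in its double coset and the two Young subgroups meet after conjugation by `σ`,
then they share a generator, `s_i σ = σ s_j`, and moving it through `h(σ)` shows that the product is
multiplied by `α` and by `β` at the same time. -/
theorem mul_hPerm_mul_eq_zero (hρ : Monotone ρ) (hκ : Monotone κ) (hαβ : α ≠ β)
    (he : ∀ i : Fin (k - 1), ρ (lo i) = ρ (hi i) → e * gen q i = α • e)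
    (he' : ∀ i : Fin (k - 1), κ (lo i) = κ (hi i) → gen q i * e' = β • e')
    {σ : Equiv.Perm (Fin k)} (hσ : IsMinimal ρ κ σ) (hs : ¬ Separates ρ κ σ) :
    e * (hPerm q σ : Hecke q k) * e' = 0 := by
  have inc1 : ∀ {a b : Fin k}, a < b → ρ a = ρ b → σ⁻¹ a < σ⁻¹ b :=
    fun hab h => lt_of_block_ascent hρ hσ.1 hab h
  have inc2 : ∀ {a b : Fin k}, a < b → κ a = κ b → σ a < σ b :=
    fun hab h => lt_of_block_ascent hκ hσ.2 hab h
  obtain ⟨x, y, hxy, h1, h2⟩ : ∃ x y, σ x < σ y ∧ ρ (σ x) = ρ (σ y) ∧ κ x = κ y := by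
    simp only [Separates, Function.Injective, not_forall, Prod.mk.injEq] at hs
    obtain ⟨x, y, ⟨h1, h2⟩, h3⟩ := hs
    rcases lt_or_gt_of_ne (fun h => h3 (σ.injective h)) with h | h
    · exact ⟨x, y, h, h1, h2⟩
    · exact ⟨y, x, h, h1.symm, h2.symm⟩
  have lxy := Fin.lt_def.1 hxy
  have hk : (σ x).1 < k - 1 := by omega
  obtain ⟨i, hi'⟩ : ∃ i : Fin (k - 1), lo i = σ x := ⟨⟨(σ x).1, hk⟩, rfl⟩
  have hi2 : hi i ≤ σ y := by
    have := congrArg Fin.val hi'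
    simp only [lo] at this
    simp only [Fin.le_def, hi]
    omega
  have e1 : ρ (lo i) = ρ (hi i) :=
    le_antisymm (hρ (lo_lt_hi i).le) (by rw [hi', h1]; exact hρ hi2)
  have l1 : x < σ⁻¹ (hi i) := by
    have := inc1 (lo_lt_hi i) e1
    rwa [hi', perm_inv_apply] at this
  have l2 : σ⁻¹ (hi i) ≤ y := by
    rcases hi2.lt_or_eq with h | h
    · have := inc1 h (by rw [← e1, hi', h1])
      rw [perm_inv_apply] at this
      exact this.le
    · rw [h, perm_inv_apply]
  have e2 : κ x = κ (σ⁻¹ (hi i)) := le_antisymm (hκ l1.le) (h2 ▸ hκ l2)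
  have hx : x.1 < k - 1 := by have := Fin.lt_def.1 l1; omega
  obtain ⟨j, hj⟩ : ∃ j : Fin (k - 1), lo j = x := ⟨⟨x.1, hx⟩, rfl⟩
  have hj2 : hi j ≤ σ⁻¹ (hi i) := by
    have := congrArg Fin.val hj
    have := Fin.lt_def.1 l1
    simp only [lo] at *
    simp only [Fin.le_def, hi] at *
    omega
  have hjx : κ (lo j) = κ (hi j) := by
    refine le_antisymm (hκ (lo_lt_hi j).le) ?_
    rw [hj, e2]
    exact hκ hj2
  have hj3 : hi j = σ⁻¹ (hi i) := by
    by_contra hne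
    have l3 := inc2 (lt_of_le_of_ne hj2 hne) (by rw [← hjx, hj, e2])
    have l4 := inc2 (lo_lt_hi j) hjx
    rw [perm_apply_inv] at l3
    rw [hj, ← hi'] at l4
    simp only [lo, hi, Fin.lt_def] at l3 l4
    omega
  have comm : adjSwap i * σ = σ * adjSwap j := by
    rw [adjSwap_eq, adjSwap_eq, hj3, hj, Equiv.mul_swap_eq_swap_mul, hi',
      perm_apply_inv]
  have h3 := gen_mul_hPerm q (hσ.1 i e1)
  rw [comm, ← hPerm_mul_gen q (hσ.2 j hjx)] at h3
  have h4 : α • (e * (hPerm q σ : Hecke q k) * e') = β • (e * (hPerm q σ : Hecke q k) * e') := by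
    rw [← smul_mul_assoc, ← smul_mul_assoc, ← he i e1, mul_assoc e, h3, ← mul_assoc, mul_assoc,
      he' j hjx, mul_smul_comm]
  have h5 : (α - β) • (e * (hPerm q σ : Hecke q k) * e') = 0 := by
    linear_combination (norm := module) h4
  exact (smul_eq_zero.1 h5).resolve_left (sub_ne_zero.2 hαβ)

/-- If the two Young subgroups always meet after conjugation, then `e H e' = 0`. -/
theorem mul_mul_eq_zero_of_forall_not_separates (hρ : Monotone ρ) (hκ : Monotone κ) (hαβ : α ≠ β)
    (he : ∀ i : Fin (k - 1), ρ (lo i) = ρ (hi i) → e * gen q i = α • e)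
    (he' : ∀ i : Fin (k - 1), κ (lo i) = κ (hi i) → gen q i * e' = β • e')
    (hs : ∀ σ, ¬ Separates ρ κ σ) (x : Hecke q k) : e * x * e' = 0 := by
  rw [← (hBasis q).sum_repr x, Finset.mul_sum, Finset.sum_mul]
  refine Finset.sum_eq_zero fun σ _ => ?_
  obtain ⟨c, τ, hτ, -, h⟩ := exists_isMinimal he he' σ
  rw [hBasis_apply, mul_smul_comm, smul_mul_assoc, h,
    mul_hPerm_mul_eq_zero hρ hκ hαβ he he' hτ (hs τ), smul_zero, smul_zero]

/-- If there is only one double coset of trivial intersection, then `e H e'` is at most a line. -/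
theorem exists_mul_mul_eq_smul (hρ : Monotone ρ) (hκ : Monotone κ) (hαβ : α ≠ β)
    (he : ∀ i : Fin (k - 1), ρ (lo i) = ρ (hi i) → e * gen q i = α • e)
    (he' : ∀ i : Fin (k - 1), κ (lo i) = κ (hi i) → gen q i * e' = β • e')
    {π : Equiv.Perm (Fin k)} (hπ : ∀ σ, IsMinimal ρ κ σ → Separates ρ κ σ → σ = π)
    (x : Hecke q k) : ∃ c : K, e * x * e' = c • (e * (hPerm q π : Hecke q k) * e') := by
  have key : ∀ σ : Equiv.Perm (Fin k), ∃ c : K, e * (hPerm q σ : Hecke q k) * e' =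
      c • (e * (hPerm q π : Hecke q k) * e') := by
    intro σ
    obtain ⟨c, τ, hτ, -, h⟩ := exists_isMinimal he he' σ
    by_cases hs : Separates ρ κ τ
    · exact ⟨c, by rw [h, hπ τ hτ hs]⟩
    · exact ⟨0, by rw [h, mul_hPerm_mul_eq_zero hρ hκ hαβ he he' hτ hs, smul_zero, zero_smul]⟩
  choose c hc using key
  refine ⟨∑ σ, (hBasis q).repr x σ * c σ, ?_⟩
  conv_lhs => rw [← (hBasis q).sum_repr x]
  rw [Finset.mul_sum, Finset.sum_mul, Finset.sum_smul]
  refine Finset.sum_congr rfl fun σ _ => ?_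
  rw [hBasis_apply, mul_smul_comm, smul_mul_assoc, hc, smul_smul]

end DoubleCoset

/-! ### Comparing shapes -/

section Shapes

variable {k : ℕ}

theorem rowOf_entry {μ : Shape k} (T : StandardTableau μ) (c : {c // c ∈ μ.1.cells}) :
    rowOf T (T.entry c) = c.1.1 := by simp [rowOf]

theorem colOf_entry {μ : Shape k} (T : StandardTableau μ) (c : {c // c ∈ μ.1.cells}) :
    colOf T (T.entry c) = c.1.2 := by simp [colOf]

theorem rowOf_colOf_mem {μ : Shape k} (T : StandardTableau μ) (a : Fin k) :
    (rowOf T a, colOf T a) ∈ μ.1.cells := (T.entry.symm a).2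

theorem eq_of_rowOf_colOf {μ : Shape k} {T : StandardTableau μ} {a b : Fin k}
    (h1 : rowOf T a = rowOf T b) (h2 : colOf T a = colOf T b) : a = b :=
  T.entry.symm.injective (Subtype.ext (Prod.ext h1 h2))

theorem exists_letter {μ : Shape k} (T : StandardTableau μ) {i j : ℕ} (h : (i, j) ∈ μ.1.cells) :
    ∃ a, rowOf T a = i ∧ colOf T a = j :=
  ⟨T.entry ⟨(i, j), h⟩, rowOf_entry T _, colOf_entry T _⟩

/-- The number of cells in the first `p` rows. -/
def topCount (μ : Shape k) (p : ℕ) : ℕ := (μ.1.cells.filter fun c => c.1 < p).card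

theorem card_rowOf_lt {μ : Shape k} (T : StandardTableau μ) (p : ℕ) :
    (Finset.univ.filter fun x : Fin k => rowOf T x < p).card = topCount μ p := by
  refine Finset.card_bij (fun x _ => (T.entry.symm x).1) ?_ ?_ ?_
  · intro x hx
    exact Finset.mem_filter.2 ⟨(T.entry.symm x).2, (Finset.mem_filter.1 hx).2⟩
  · intro x _ y _ h
    exact T.entry.symm.injective (Subtype.ext h)
  · intro c hc
    rw [Finset.mem_filter] at hc
    exact ⟨T.entry ⟨c, hc.1⟩, Finset.mem_filter.2 ⟨Finset.mem_univ _, by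
      rw [rowOf_entry]; exact hc.2⟩, by simp⟩

theorem topCount_succ (μ : Shape k) (p : ℕ) :
    topCount μ (p + 1) = topCount μ p + μ.1.rowLen p := by
  rw [YoungDiagram.rowLen_eq_card, topCount, topCount, ← Finset.card_union_of_disjoint]
  · congr 1
    ext c
    simp only [Finset.mem_filter, Finset.mem_union, YoungDiagram.row, YoungDiagram.mem_cells]
    have : c.1 < p + 1 ↔ c.1 < p ∨ c.1 = p := by omega
    rw [this]
    tauto
  · rw [Finset.disjoint_left]
    intro c h1 h2
    simp only [Finset.mem_filter, YoungDiagram.row] at h1 h2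
    omega

theorem shape_eq_of_topCount {lam μ : Shape k} (h : ∀ p, topCount lam p = topCount μ p) :
    lam = μ := by
  have h1 : ∀ p, lam.1.rowLen p = μ.1.rowLen p := fun p => by
    have h1 := topCount_succ lam p
    have h2 := topCount_succ μ p
    rw [h, h] at h1
    omega
  apply Subtype.ext
  ext ⟨i, j⟩
  rw [YoungDiagram.mem_cells, YoungDiagram.mem_cells, YoungDiagram.mem_iff_lt_rowLen,
    YoungDiagram.mem_iff_lt_rowLen, h1]

/-- One direction of the Gale-Ryser theorem: a zero-one matrix with row sums `lam` and column sums
the conjugate of `μ` exists only if `lam` is dominated by `μ`. -/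
theorem topCount_le_of_injective {lam μ : Shape k} (S : StandardTableau lam)
    (T : StandardTableau μ) (σ : Equiv.Perm (Fin k))
    (h : Function.Injective fun x => (rowOf S (σ x), colOf T x)) (p : ℕ) :
    topCount lam p ≤ topCount μ p := by
  have e1 : topCount lam p = (Finset.univ.filter fun x : Fin k => rowOf S (σ x) < p).card := by
    rw [← card_rowOf_lt S]
    exact (Finset.card_bij (fun x _ => σ x) (by simp) (fun x _ y _ h => σ.injective h)
      (fun y hy => ⟨σ⁻¹ y, by simpa using hy, by simp⟩)).symm
  rw [e1, ← card_rowOf_lt T]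
  rw [Finset.card_eq_sum_card_fiberwise (f := colOf T) (t := Finset.univ.image (colOf T))
      (by intro x _; simp),
    Finset.card_eq_sum_card_fiberwise (f := colOf T) (t := Finset.univ.image (colOf T))
      (s := Finset.univ.filter fun x : Fin k => rowOf T x < p) (by intro x _; simp)]
  refine Finset.sum_le_sum fun j _ => ?_
  by_cases hj : ∃ x, colOf T x = j ∧ p ≤ rowOf T x
  · -- the column `j` meets all the first `p` rows
    obtain ⟨y, hy1, hy2⟩ := hj
    trans p
    · rw [← Finset.card_range p]
      refine Finset.card_le_card_of_injOn (fun x => rowOf S (σ x)) ?_ ?_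
      · intro x hx
        simpa using (Finset.mem_filter.1 (Finset.mem_filter.1 hx).1).2
      · intro x hx x' hx' hxx
        refine h (Prod.ext hxx ?_)
        rw [Finset.mem_coe, Finset.mem_filter] at hx hx'
        exact hx.2.trans hx'.2.symm
    · have hc : ∀ i, i < p → (i, j) ∈ μ.1.cells := fun i hi => by
        have := rowOf_colOf_mem T y
        rw [hy1] at this
        exact μ.1.up_left_mem (hi.le.trans hy2) le_rfl this
      have : ∀ i : Fin p, ∃ a, rowOf T a = i ∧ colOf T a = j := fun i =>
        exists_letter T (hc i i.2)
      choose a ha1 ha2 using this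
      calc p = (Finset.univ : Finset (Fin p)).card := by simp
        _ ≤ _ := Finset.card_le_card_of_injOn a
          (by intro i _; simp [ha1, ha2])
          (by
            intro i _ i' _ hii
            have := congrArg (rowOf T) hii
            rw [ha1, ha1] at this
            exact Fin.ext this)
  · push Not at hj
    refine Finset.card_le_card fun x hx => ?_
    simp only [Finset.mem_filter, Finset.mem_univ, true_and] at hx ⊢
    exact ⟨hj x hx.2, hx.2⟩

/-- The minimal separating permutation is unique: it fills in the cells of the diagram in the
order of the columns instead of the rows. -/
theorem eq_transform_of_isMinimal {μ : Shape k} {σ : Equiv.Perm (Fin k)}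
    (hm : IsMinimal (colOf (Sminus μ)) (rowOf (Splus μ)) σ)
    (hs : Separates (colOf (Sminus μ)) (rowOf (Splus μ)) σ) :
    σ = transform (Splus μ) (Sminus μ) := by
  -- in each row of `S₊` the columns of the images increase strictly; dually for `S₋`
  have hcol : ∀ x, colOf (Splus μ) x ≤ colOf (Sminus μ) (σ x) := by
    intro x
    induction h : colOf (Splus μ) x generalizing x with
    | zero => exact Nat.zero_le _
    | succ j ih =>
      have hx := rowOf_colOf_mem (Splus μ) x
      obtain ⟨y, hy1, hy2⟩ := exists_letter (Splus μ)
        (μ.1.up_left_mem (le_refl _) (show j ≤ colOf (Splus μ) x by omega) hx)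
      have hyx : y < x := by
        have := (Splus μ).row_lt ((Splus μ).entry.symm y) ((Splus μ).entry.symm x) hy1
          (by change colOf _ _ < colOf _ _; omega)
        simpa using this
      have h1 := lt_of_block_ascent (monotone_rowOf_Splus μ) hm.2 hyx hy1
      have h2 := monotone_colOf_Sminus μ h1.le
      have h3 : colOf (Sminus μ) (σ y) ≠ colOf (Sminus μ) (σ x) := fun h3 =>
        hyx.ne (hs (Prod.ext h3 hy1))
      have := ih y hy2
      omega
  have hrow : ∀ y, rowOf (Sminus μ) y ≤ rowOf (Splus μ) (σ⁻¹ y) := by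
    intro x
    induction h : rowOf (Sminus μ) x generalizing x with
    | zero => exact Nat.zero_le _
    | succ j ih =>
      have hx := rowOf_colOf_mem (Sminus μ) x
      obtain ⟨y, hy1, hy2⟩ := exists_letter (Sminus μ)
        (μ.1.up_left_mem (show j ≤ rowOf (Sminus μ) x by omega) (le_refl _) hx)
      have hyx : y < x := by
        have := (Sminus μ).col_lt ((Sminus μ).entry.symm y) ((Sminus μ).entry.symm x) hy2
          (by change rowOf _ _ < rowOf _ _; omega)
        simpa using this
      have h1 := lt_of_block_ascent (monotone_colOf_Sminus μ) hm.1 hyx hy2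
      have h2 := monotone_rowOf_Splus μ h1.le
      have h3 : rowOf (Splus μ) (σ⁻¹ y) ≠ rowOf (Splus μ) (σ⁻¹ x) := fun h3 =>
        hyx.ne (σ⁻¹.injective (hs (Prod.ext (by simpa using hy2) h3)))
      have := ih y hy1
      omega
  -- the inequalities are equalities because both sides have the same sum
  have sum_cells : ∀ (T : StandardTableau μ) (f : ℕ × ℕ → ℕ),
      ∑ x, f (rowOf T x, colOf T x) = ∑ c : {c // c ∈ μ.1.cells}, f c.1 := fun T f =>
    Equiv.sum_comp T.entry.symm (fun c => f c.1)
  have hcol' : ∀ x, colOf (Splus μ) x = colOf (Sminus μ) (σ x) := by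
    intro x
    refine (Finset.sum_eq_sum_iff_of_le (fun x _ => hcol x)).1 ?_ x (Finset.mem_univ x)
    rw [Equiv.sum_comp σ (fun x => colOf (Sminus μ) x)]
    exact (sum_cells (Splus μ) Prod.snd).trans (sum_cells (Sminus μ) Prod.snd).symm
  have hrow' : ∀ x, rowOf (Sminus μ) x = rowOf (Splus μ) (σ⁻¹ x) := by
    intro x
    refine (Finset.sum_eq_sum_iff_of_le (fun x _ => hrow x)).1 ?_ x (Finset.mem_univ x)
    rw [Equiv.sum_comp σ⁻¹ (fun x => rowOf (Splus μ) x)]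
    exact (sum_cells (Sminus μ) Prod.fst).trans (sum_cells (Splus μ) Prod.fst).symm
  ext1 x
  refine eq_of_rowOf_colOf (T := Sminus μ) ?_ ?_
  · rw [hrow', perm_inv_apply]
    simp [transform, rowOf]
  · rw [← hcol']
    simp [transform, colOf]

end Shapes

/-! ### The elements `x_T(q)` over a field -/

section YoungSymmetrizer

variable {k : ℕ} {K : Type*} [Field K] {q : Kˣ}

theorem ePlus_mul_mul_eMinus (hq : (q : K) ^ 2 ≠ -1) {lam μ : Shape k}
    (hp : ∃ p, ¬ topCount lam p ≤ topCount μ p) (x : Hecke q k) :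
    ePlus q lam * x * eMinus q μ = 0 := by
  obtain ⟨p, hp⟩ := hp
  refine mul_mul_eq_zero_of_forall_not_separates (monotone_rowOf_Splus lam)
    (monotone_colOf_Sminus μ) hq (fun i hi => ePlus_mul_gen q hi) (fun i hi => gen_mul_eMinus q hi)
    (fun σ hσ => hp ?_) x
  exact topCount_le_of_injective (Splus lam) (Sminus μ) σ hσ p

/-- The counterpart of `ePlus_mul_mul_eMinus` with the roles of the shapes exchanged. -/
theorem eMinus_mul_mul_ePlus (hq : (q : K) ^ 2 ≠ -1) {lam μ : Shape k}
    (hp : ∃ p, ¬ topCount μ p ≤ topCount lam p) (x : Hecke q k) :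
    eMinus q lam * x * ePlus q μ = 0 := by
  obtain ⟨p, hp⟩ := hp
  refine mul_mul_eq_zero_of_forall_not_separates (monotone_colOf_Sminus lam)
    (monotone_rowOf_Splus μ) hq.symm (fun i hi => eMinus_mul_gen q hi)
    (fun i hi => gen_mul_ePlus q hi) (fun σ hσ => hp ?_) x
  refine topCount_le_of_injective (Splus μ) (Sminus lam) σ⁻¹ ?_ p
  intro y y' h
  simp only [Prod.mk.injEq] at h
  refine σ⁻¹.injective (hσ (Prod.ext ?_ h.1))
  simpa using h.2

/-- The products `e₊ H e₋` and `e₋ H e₊` for the shapes `lam` and `μ` vanish unless `lam` is dominated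
by `μ`, respectively `μ` by `lam`; both products occur in `x_T x x_S`. -/
theorem xT_mul_mul_xT_of_ne (hq : (q : K) ^ 2 ≠ -1) {lam μ : Shape k} (h : lam ≠ μ)
    (T : StandardTableau lam) (S : StandardTableau μ) (x : Hecke q k) :
    xT q T * x * xT q S = 0 := by
  obtain ⟨p, hp⟩ : ∃ p, topCount lam p ≠ topCount μ p := by
    by_contra! hc
    exact h (shape_eq_of_topCount hc)
  rcases lt_or_gt_of_ne hp with hp | hp
  · have := eMinus_mul_mul_ePlus hq ⟨p, hp.not_ge⟩
      (((hPerm q (transform (Sminus lam) T))⁻¹ : (Hecke q k)ˣ) *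
        (hPerm q (transform (Splus lam) T) : Hecke q k) * ePlus q lam *
        ((hPerm q (transform (Splus lam) T))⁻¹ : (Hecke q k)ˣ) * x *
        (hPerm q (transform (Sminus μ) S) : Hecke q k) * eMinus q μ *
        ((hPerm q (transform (Sminus μ) S))⁻¹ : (Hecke q k)ˣ) *
        (hPerm q (transform (Splus μ) S) : Hecke q k))
    have h2 := congrArg (fun y => (hPerm q (transform (Sminus lam) T) : Hecke q k) * y *
      ((hPerm q (transform (Splus μ) S))⁻¹ : (Hecke q k)ˣ)) this
    simpa only [mul_zero, zero_mul, mul_assoc, xT] using h2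
  · have := ePlus_mul_mul_eMinus hq ⟨p, hp.not_ge⟩
      (((hPerm q (transform (Splus lam) T))⁻¹ : (Hecke q k)ˣ) * x *
        (hPerm q (transform (Sminus μ) S) : Hecke q k))
    have h2 := congrArg (fun y => (hPerm q (transform (Sminus lam) T) : Hecke q k) *
      eMinus q lam * ((hPerm q (transform (Sminus lam) T))⁻¹ : (Hecke q k)ˣ) *
      (hPerm q (transform (Splus lam) T) : Hecke q k) * y *
      (((hPerm q (transform (Sminus μ) S))⁻¹ : (Hecke q k)ˣ) *
        (hPerm q (transform (Splus μ) S) : Hecke q k) * ePlus q μ *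
        ((hPerm q (transform (Splus μ) S))⁻¹ : (Hecke q k)ˣ))) this
    simpa only [mul_zero, zero_mul, mul_assoc, xT] using h2

variable (q) in
/-- The element which spans the line `h(σ^T_-) e₋ H e₊ h(σ^S_+)⁻¹`; up to a scalar it is the matrix
unit of the pair `(T, S)` in the simple component of the shape `μ`. -/
noncomputable def crossUnit {μ : Shape k} (T S : StandardTableau μ) : Hecke q k :=
  (hPerm q (transform (Sminus μ) T) : Hecke q k) *
    (eMinus q μ * (hPerm q (transform (Splus μ) (Sminus μ)) : Hecke q k) * ePlus q μ) *
    ((hPerm q (transform (Splus μ) S))⁻¹ : (Hecke q k)ˣ)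

theorem exists_eq_smul_crossUnit (hq : (q : K) ^ 2 ≠ -1) {μ : Shape k} (T S : StandardTableau μ)
    (x : Hecke q k) : ∃ c : K, (hPerm q (transform (Sminus μ) T) : Hecke q k) *
      (eMinus q μ * x * ePlus q μ) * ((hPerm q (transform (Splus μ) S))⁻¹ : (Hecke q k)ˣ) =
      c • crossUnit q T S := by
  obtain ⟨c, hc⟩ := exists_mul_mul_eq_smul (monotone_colOf_Sminus μ) (monotone_rowOf_Splus μ)
    hq.symm (fun i hi => eMinus_mul_gen q hi) (fun i hi => gen_mul_ePlus q hi)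
    (fun σ h1 h2 => eq_transform_of_isMinimal h1 h2) x
  exact ⟨c, by rw [hc, mul_smul_comm, smul_mul_assoc, crossUnit]⟩

theorem exists_xT_eq_smul (hq : (q : K) ^ 2 ≠ -1) {μ : Shape k} (T : StandardTableau μ) :
    ∃ c : K, xT q T = c • crossUnit q T T := by
  obtain ⟨c, hc⟩ := exists_eq_smul_crossUnit hq T T
    (((hPerm q (transform (Sminus μ) T))⁻¹ : (Hecke q k)ˣ) *
      (hPerm q (transform (Splus μ) T) : Hecke q k))
  exact ⟨c, by rw [← hc, xT]; simp only [mul_assoc]⟩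

theorem exists_xT_mul_mul_xT (hq : (q : K) ^ 2 ≠ -1) {μ : Shape k} (T S : StandardTableau μ)
    (x : Hecke q k) : ∃ c : K, xT q T * x * xT q S = c • crossUnit q T S := by
  obtain ⟨c, hc⟩ := exists_eq_smul_crossUnit hq T S
    (((hPerm q (transform (Sminus μ) T))⁻¹ : (Hecke q k)ˣ) *
      (hPerm q (transform (Splus μ) T) : Hecke q k) * ePlus q μ *
      ((hPerm q (transform (Splus μ) T))⁻¹ : (Hecke q k)ˣ) * x *
      (hPerm q (transform (Sminus μ) S) : Hecke q k) * eMinus q μ *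
      ((hPerm q (transform (Sminus μ) S))⁻¹ : (Hecke q k)ˣ) *
      (hPerm q (transform (Splus μ) S) : Hecke q k))
  exact ⟨c, by rw [← hc, xT, xT]; simp only [mul_assoc]⟩

/-- The symmetrizers of two tableaux of the same shape generate the same two-sided ideal, because
both are multiples of `e₋ h(π) e₊` up to invertible factors. -/
theorem exists_xT_eq_mul_xT_mul (hq : (q : K) ^ 2 ≠ -1) {μ : Shape k} (T S : StandardTableau μ)
    (hT : xT q T ≠ 0) : ∃ a b : Hecke q k, xT q S = a * xT q T * b := by
  obtain ⟨c, hc⟩ := exists_xT_eq_smul hq T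
  obtain ⟨d, hd⟩ := exists_xT_eq_smul hq S
  have hc0 : c ≠ 0 := by
    rintro rfl
    rw [zero_smul] at hc
    exact hT hc
  refine ⟨(d * c⁻¹) • ((hPerm q (transform (Sminus μ) S) : Hecke q k) *
    ((hPerm q (transform (Sminus μ) T))⁻¹ : (Hecke q k)ˣ)),
    (hPerm q (transform (Splus μ) T) : Hecke q k) *
      ((hPerm q (transform (Splus μ) S))⁻¹ : (Hecke q k)ˣ), ?_⟩
  rw [hc, hd, mul_smul_comm, smul_mul_assoc, smul_mul_assoc, smul_mul_assoc, smul_smul,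
    mul_comm c, mul_assoc d, inv_mul_cancel₀ hc0, mul_one, crossUnit, crossUnit]
  congr 1
  simp only [mul_assoc, Units.inv_mul_cancel_left]

theorem exists_xT_mul_xT (hq : (q : K) ^ 2 ≠ -1) {μ : Shape k} (T : StandardTableau μ) :
    ∃ ξ : K, xT q T * xT q T = ξ • xT q T := by
  by_cases hT : xT q T = 0
  · exact ⟨0, by rw [hT, mul_zero, smul_zero]⟩
  obtain ⟨c, hc⟩ := exists_xT_eq_smul hq T
  obtain ⟨d, hd⟩ := exists_xT_mul_mul_xT hq T T 1
  have hc0 : c ≠ 0 := by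
    rintro rfl
    rw [zero_smul] at hc
    exact hT hc
  rw [mul_one] at hd
  exact ⟨d * c⁻¹, by
    rw [hd]
    conv_rhs => rw [hc, smul_smul, mul_assoc, inv_mul_cancel₀ hc0, mul_one]⟩

end YoungSymmetrizer

/-! ### Young symmetrizers at `q = 1` -/

section Tableaux

variable {k : ℕ} {μ : Shape k}

theorem StandardTableau.ext_of_entry {S T : StandardTableau μ} (h : S.entry = T.entry) : S = T := by
  cases S
  cases T
  simp only at h
  subst h
  rfl

instance : Finite (StandardTableau μ) :=
  Finite.of_injective (fun T => T.entry) fun _ _ h => StandardTableau.ext_of_entry h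

noncomputable instance : Fintype (StandardTableau μ) := Fintype.ofFinite _

theorem cells_subset_range (μ : Shape k) :
    μ.1.cells ⊆ Finset.range k ×ˢ Finset.range k := by
  rintro ⟨i, j⟩ h
  have h1 : Finset.range (i + 1) ×ˢ {j} ⊆ μ.1.cells := by
    rintro ⟨a, b⟩ hab
    simp only [Finset.mem_product, Finset.mem_range, Finset.mem_singleton] at hab
    exact μ.1.up_left_mem (by omega) (by omega) h
  have h2 : {i} ×ˢ Finset.range (j + 1) ⊆ μ.1.cells := by
    rintro ⟨a, b⟩ hab
    simp only [Finset.mem_product, Finset.mem_range, Finset.mem_singleton] at hab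
    exact μ.1.up_left_mem (by omega) (by omega) h
  have h3 := Finset.card_le_card h1
  have h4 := Finset.card_le_card h2
  have h5 : μ.1.cells.card = k := μ.2
  simp only [Finset.card_product, Finset.card_range, Finset.card_singleton] at h3 h4
  simp only [Finset.mem_product, Finset.mem_range]
  omega

instance : Finite (Shape k) := by
  refine Finite.of_injective
    (fun μ : Shape k => (⟨μ.1.cells, Finset.mem_powerset.2 (cells_subset_range μ)⟩ :
      {s // s ∈ (Finset.range k ×ˢ Finset.range k).powerset})) fun μ ν h => ?_
  exact Subtype.ext (YoungDiagram.ext (congrArg Subtype.val h))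

noncomputable instance : Fintype (Shape k) := Fintype.ofFinite _

theorem rowOf_transform (S T : StandardTableau μ) (a : Fin k) :
    rowOf T (transform S T a) = rowOf S a := by simp [rowOf, transform]

theorem colOf_transform (S T : StandardTableau μ) (a : Fin k) :
    colOf T (transform S T a) = colOf S a := by simp [colOf, transform]

/-- The entries of a standard tableau increase towards the south-east. -/
theorem lt_of_cell_le (T : StandardTableau μ) {a b : Fin k} (h1 : rowOf T a ≤ rowOf T b)
    (h2 : colOf T a ≤ colOf T b) (hab : a ≠ b) : a < b := by
  have hr : ∀ {a b : Fin k}, rowOf T a = rowOf T b → colOf T a < colOf T b → a < b := by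
    intro a b h1 h2
    simpa using T.row_lt (T.entry.symm a) (T.entry.symm b) h1 h2
  have hc : ∀ {a b : Fin k}, colOf T a = colOf T b → rowOf T a < rowOf T b → a < b := by
    intro a b h1 h2
    simpa using T.col_lt (T.entry.symm a) (T.entry.symm b) h1 h2
  obtain ⟨c, hc1, hc2⟩ := exists_letter T
    (μ.1.up_left_mem h1 (le_refl _) (rowOf_colOf_mem T b))
  rcases h2.lt_or_eq with h3 | h3
  · have h4 : a < c := hr hc1.symm (by omega)
    rcases h1.lt_or_eq with h5 | h5
    · exact h4.trans (hc hc2 (by omega))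
    · exact hr h5 h3
  · refine hc h3 (lt_of_le_of_ne h1 fun h4 => hab (eq_of_rowOf_colOf h4 h3))

/-- The order of standard tableaux by the sequence of the rows of the letters. -/
def rowKey (T : StandardTableau μ) : Lex (Fin k → ℕ) := toLex (rowOf T)

/-- At the first letter in which the rows of two standard tableaux differ, the smaller tableau has
a letter in the same row which lies in the same column of the larger one. -/
theorem exists_pair_of_rowKey_lt {T S : StandardTableau μ} (h : rowKey T < rowKey S) :
    ∃ a b, a ≠ b ∧ rowOf T a = rowOf T b ∧ colOf S a = colOf S b := by
  obtain ⟨a, ha, hlt⟩ := h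
  change ∀ b, b < a → rowOf T b = rowOf S b at ha
  change rowOf T a < rowOf S a at hlt
  have same : ∀ b, b < a → colOf T b = colOf S b := by
    intro b
    induction b using WellFoundedLT.induction with
    | _ b ih =>
    intro hb
    have hr := ha b hb
    rcases lt_trichotomy (colOf T b) (colOf S b) with h1 | h1 | h1
    · obtain ⟨c, hc1, hc2⟩ := exists_letter S
        (μ.1.up_left_mem hr.le h1.le (rowOf_colOf_mem S b))
      have hcb : c < b := lt_of_cell_le S (by omega) (by omega) (by rintro rfl; omega)
      have := ih c hcb (hcb.trans hb)
      have h2 := ha c (hcb.trans hb)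
      exact absurd (eq_of_rowOf_colOf (T := T) (h2.trans hc1) (this.trans hc2)) hcb.ne
    · exact h1
    · obtain ⟨c, hc1, hc2⟩ := exists_letter T
        (μ.1.up_left_mem hr.ge h1.le (rowOf_colOf_mem T b))
      have hcb : c < b := lt_of_cell_le T (by omega) (by omega) (by rintro rfl; omega)
      have := ih c hcb (hcb.trans hb)
      have h2 := ha c (hcb.trans hb)
      exact absurd (eq_of_rowOf_colOf (T := S) (h2.symm.trans hc1) (this.symm.trans hc2)) hcb.ne
  have hcol : colOf S a < colOf T a := by
    by_contra! h1
    obtain ⟨c, hc1, hc2⟩ := exists_letter S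
      (μ.1.up_left_mem hlt.le h1 (rowOf_colOf_mem S a))
    have hca : c < a := lt_of_cell_le S (by omega) (by omega) (by rintro rfl; omega)
    exact absurd (eq_of_rowOf_colOf (T := T) ((ha c hca).trans hc1) ((same c hca).trans hc2))
      hca.ne
  obtain ⟨b, hb1, hb2⟩ := exists_letter T
    (μ.1.up_left_mem (le_refl _) hcol.le (rowOf_colOf_mem T a))
  have hba : b < a := lt_of_cell_le T (by omega) (by omega) (by rintro rfl; omega)
  exact ⟨a, b, hba.ne', hb1.symm, by rw [← same b hba, hb2]⟩

/-- In each row the letters of a standard tableau are arranged in increasing order. -/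
theorem rowKey_injective : Function.Injective (rowKey : StandardTableau μ → Lex (Fin k → ℕ)) := by
  intro T S h
  have hr : ∀ a, rowOf T a = rowOf S a := fun a => congrFun h a
  have hc : ∀ a, colOf T a = colOf S a := by
    intro b
    induction b using WellFoundedLT.induction with
    | _ b ih =>
    rcases lt_trichotomy (colOf T b) (colOf S b) with h1 | h1 | h1
    · obtain ⟨c, hc1, hc2⟩ := exists_letter S
        (μ.1.up_left_mem (hr b).le h1.le (rowOf_colOf_mem S b))
      have hcb : c < b := lt_of_cell_le S (by rw [hc1, hr]) (by omega) (by rintro rfl; omega)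
      exact absurd (eq_of_rowOf_colOf (T := T) ((hr c).trans hc1) ((ih c hcb).trans hc2)) hcb.ne
    · exact h1
    · obtain ⟨c, hc1, hc2⟩ := exists_letter T
        (μ.1.up_left_mem (hr b).ge h1.le (rowOf_colOf_mem T b))
      have hcb : c < b := lt_of_cell_le T (by rw [hc1, hr]) (by omega) (by rintro rfl; omega)
      exact absurd (eq_of_rowOf_colOf (T := S) ((hr c).symm.trans hc1)
        ((ih c hcb).symm.trans hc2)) hcb.ne
  refine StandardTableau.ext_of_entry ?_
  rw [← Equiv.symm_symm T.entry, ← Equiv.symm_symm S.entry]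
  congr 1
  ext1 a
  exact Subtype.ext (Prod.ext (hr a) (hc a))

end Tableaux

section One

variable {k : ℕ} {F : Type*} [Field F]

theorem gen_one_mul_gen_one (i : Fin (k - 1)) : gen (1 : Fˣ) i * gen (1 : Fˣ) i = 1 := by
  simp [gen_mul_gen]

theorem hPerm_one_adjSwap_mul (i : Fin (k - 1)) (σ : Equiv.Perm (Fin k)) :
    hPerm (1 : Fˣ) (adjSwap i * σ) = genUnit 1 i * hPerm 1 σ := by
  rcases ascent_or_descent σ⁻¹ i with h | h
  · exact hPerm_adjSwap_mul 1 h
  · have := hPerm_adjSwap_mul (1 : Fˣ) (σ := adjSwap i * σ) (i := i) (by simpa using h)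
    rw [adjSwap_mul_mul] at this
    rw [this, ← mul_assoc]
    have h2 : genUnit (1 : Fˣ) i * genUnit 1 i = 1 := Units.ext (gen_one_mul_gen_one i)
    rw [h2, one_mul]

theorem hPerm_one_mul (σ τ : Equiv.Perm (Fin k)) :
    hPerm (1 : Fˣ) (σ * τ) = hPerm 1 σ * hPerm 1 τ := by
  induction σ using perm_induction_left with
  | one => rw [one_mul, hPerm_one, one_mul]
  | step i σ _ ih => rw [mul_assoc, hPerm_one_adjSwap_mul, ih, hPerm_one_adjSwap_mul, mul_assoc]

variable (F) in
/-- At `q = 1`, the Hecke algebra is the group algebra: `σ ↦ h(σ)` is multiplicative. -/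
noncomputable def hHom (k : ℕ) : Equiv.Perm (Fin k) →* Hecke (1 : Fˣ) k where
  toFun σ := (hPerm (1 : Fˣ) σ).val
  map_one' := by rw [hPerm_one, Units.val_one]
  map_mul' σ τ := by rw [hPerm_one_mul, Units.val_mul]

theorem hHom_apply (σ : Equiv.Perm (Fin k)) :
    hHom F k σ = (hPerm (1 : Fˣ) σ : Hecke (1 : Fˣ) k) := rfl

theorem hPerm_one_inv (σ : Equiv.Perm (Fin k)) :
    (((hPerm (1 : Fˣ) σ)⁻¹ : (Hecke (1 : Fˣ) k)ˣ) : Hecke (1 : Fˣ) k) = hHom F k σ⁻¹ := by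
  rw [hHom_apply]
  congr 1
  rw [inv_eq_iff_mul_eq_one, ← hPerm_one_mul, mul_inv_cancel, hPerm_one]

theorem hBasis_one_apply (σ : Equiv.Perm (Fin k)) : hBasis (1 : Fˣ) σ = hHom F k σ :=
  hBasis_apply _ _

theorem sign_eq_neg_one_pow (σ : Equiv.Perm (Fin k)) :
    Equiv.Perm.sign σ = (-1) ^ length σ := by
  induction σ using perm_induction_left with
  | one => simp [length_one]
  | step i σ h ih =>
    rw [map_mul, ih, length_adjSwap_mul h, adjSwap_eq, Equiv.Perm.sign_swap (lo_lt_hi i).ne,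
      pow_succ']

variable (F) in
/-- The sign character with values in `F`. -/
def sgn (σ : Equiv.Perm (Fin k)) : F := ((Equiv.Perm.sign σ : ℤ) : F)

theorem sgn_mul (σ τ : Equiv.Perm (Fin k)) : sgn F (σ * τ) = sgn F σ * sgn F τ := by
  simp [sgn]

theorem sgn_swap {a b : Fin k} (h : a ≠ b) : sgn F (Equiv.swap a b) = -1 := by
  simp [sgn, Equiv.Perm.sign_swap h]

variable (F) in
/-- The sum of the permutations which preserve the blocks of `ρ`. -/
noncomputable def symSum (ρ : Fin k → ℕ) : Hecke (1 : Fˣ) k :=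
  ∑ σ ∈ Finset.univ.filter fun σ : Equiv.Perm (Fin k) => ∀ a, ρ (σ a) = ρ a, hHom F k σ

variable (F) in
/-- The signed sum of the permutations which preserve the blocks of `κ`. -/
noncomputable def altSum (κ : Fin k → ℕ) : Hecke (1 : Fˣ) k :=
  ∑ σ ∈ Finset.univ.filter fun σ : Equiv.Perm (Fin k) => ∀ a, κ (σ a) = κ a,
    sgn F σ • hHom F k σ

theorem conj_mem_iff {ρ ρ' : Fin k → ℕ} {π : Equiv.Perm (Fin k)} (h : ∀ a, ρ' (π a) = ρ a)
    (σ : Equiv.Perm (Fin k)) :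
    (∀ a, ρ' ((π * σ * π⁻¹) a) = ρ' a) ↔ ∀ a, ρ (σ a) = ρ a := by
  simp only [Equiv.Perm.mul_apply, h]
  constructor
  · intro h1 a
    have := h1 (π a)
    rwa [perm_inv_apply, h] at this
  · intro h1 a
    rw [h1, ← h, perm_apply_inv]

theorem hHom_mul_symSum_mul {ρ ρ' : Fin k → ℕ} {π : Equiv.Perm (Fin k)}
    (h : ∀ a, ρ' (π a) = ρ a) : hHom F k π * symSum F ρ * hHom F k π⁻¹ = symSum F ρ' := by
  rw [symSum, symSum, Finset.mul_sum, Finset.sum_mul]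
  refine Finset.sum_equiv (MulAut.conj π).toEquiv ?_ ?_
  · intro σ
    simp only [Finset.mem_filter, Finset.mem_univ, true_and]
    exact (conj_mem_iff h σ).symm
  · intro σ _
    rw [← map_mul, ← map_mul]
    rfl

theorem hHom_mul_altSum_mul {ρ ρ' : Fin k → ℕ} {π : Equiv.Perm (Fin k)}
    (h : ∀ a, ρ' (π a) = ρ a) : hHom F k π * altSum F ρ * hHom F k π⁻¹ = altSum F ρ' := by
  rw [altSum, altSum, Finset.mul_sum, Finset.sum_mul]
  refine Finset.sum_equiv (MulAut.conj π).toEquiv ?_ ?_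
  · intro σ
    simp only [Finset.mem_filter, Finset.mem_univ, true_and]
    exact (conj_mem_iff h σ).symm
  · intro σ _
    rw [mul_smul_comm, smul_mul_assoc, ← map_mul, ← map_mul]
    have h1 : Equiv.Perm.sign (π * σ * π⁻¹) = Equiv.Perm.sign σ := by
      rw [map_mul, map_mul, map_inv, mul_right_comm, mul_inv_cancel, one_mul]
    change _ = sgn F (π * σ * π⁻¹) • _
    rw [sgn, sgn, h1]
    rfl

theorem ePlus_one (μ : Shape k) : ePlus (1 : Fˣ) μ = symSum F (rowOf (Splus μ)) := rfl

theorem eMinus_one (μ : Shape k) : eMinus (1 : Fˣ) μ = altSum F (colOf (Sminus μ)) := by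
  refine Finset.sum_congr rfl fun σ _ => ?_
  rw [hHom_apply, sgn, sign_eq_neg_one_pow]
  simp

/-- At `q = 1` the element `x_T` is the classical Young symmetrizer of `T`. -/
theorem xT_one {μ : Shape k} (T : StandardTableau μ) :
    xT (1 : Fˣ) T = altSum F (colOf T) * symSum F (rowOf T) := by
  rw [xT, hPerm_one_inv, hPerm_one_inv, ePlus_one, eMinus_one, ← hHom_apply, ← hHom_apply,
    hHom_mul_altSum_mul (colOf_transform (Sminus μ) T), mul_assoc (altSum F _),
    mul_assoc (altSum F _), hHom_mul_symSum_mul (rowOf_transform (Splus μ) T)]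

theorem hHom_mul_xT_one {μ : Shape k} (T S : StandardTableau μ) :
    hHom F k (transform T S) * xT (1 : Fˣ) T = xT (1 : Fˣ) S * hHom F k (transform T S) := by
  have h1 := hHom_mul_altSum_mul (F := F) (colOf_transform T S)
  have h2 := hHom_mul_symSum_mul (F := F) (rowOf_transform T S)
  have h3 : hHom F k (transform T S)⁻¹ * hHom F k (transform T S) = 1 := by
    rw [← map_mul, inv_mul_cancel, map_one]
  rw [xT_one, xT_one, ← h1, ← h2]
  simp only [mul_assoc, h3, mul_one]
  rw [← mul_assoc (hHom F k (transform T S)⁻¹), h3, one_mul]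

theorem symSum_mul_swap {ρ : Fin k → ℕ} {a b : Fin k} (h : ρ a = ρ b) :
    symSum F ρ * hHom F k (Equiv.swap a b) = symSum F ρ := by
  rw [symSum, Finset.sum_mul]
  refine Finset.sum_equiv (Equiv.mulRight (Equiv.swap a b)) ?_ ?_
  · intro σ
    simp only [Finset.mem_filter, Finset.mem_univ, true_and, Equiv.coe_mulRight,
      Equiv.Perm.mul_apply]
    have hs : ∀ c, ρ (Equiv.swap a b c) = ρ c := by
      intro c
      rw [Equiv.swap_apply_def]
      split_ifs with h1 h2
      · rw [h1, h]
      · rw [h2, h]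
      · rfl
    constructor
    · intro h1 c
      rw [h1, hs]
    · intro h1 c
      have := h1 (Equiv.swap a b c)
      rwa [Equiv.swap_apply_self, hs] at this
  · intro σ _
    rw [← map_mul]
    rfl

theorem swap_mul_altSum {κ : Fin k → ℕ} {a b : Fin k} (hab : a ≠ b) (h : κ a = κ b) :
    hHom F k (Equiv.swap a b) * altSum F κ = (-1 : F) • altSum F κ := by
  rw [altSum, Finset.mul_sum, Finset.smul_sum]
  refine Finset.sum_equiv (Equiv.mulLeft (Equiv.swap a b)) ?_ ?_
  · intro σ
    simp only [Finset.mem_filter, Finset.mem_univ, true_and, Equiv.coe_mulLeft,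
      Equiv.Perm.mul_apply]
    have hs : ∀ c, κ (Equiv.swap a b c) = κ c := by
      intro c
      rw [Equiv.swap_apply_def]
      split_ifs with h1 h2
      · rw [h1, h]
      · rw [h2, h]
      · rfl
    simp only [hs]
  · intro σ _
    rw [mul_smul_comm, ← map_mul, Equiv.coe_mulLeft, sgn_mul, sgn_swap hab, smul_smul,
      ← mul_assoc, neg_mul_neg, one_mul, one_mul]

theorem symSum_mul_altSum [CharZero F] {ρ κ : Fin k → ℕ} {a b : Fin k} (hab : a ≠ b)
    (h1 : ρ a = ρ b) (h2 : κ a = κ b) : symSum F ρ * altSum F κ = 0 := by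
  have h3 : symSum F ρ * altSum F κ = (-1 : F) • (symSum F ρ * altSum F κ) := by
    conv_lhs => rw [← symSum_mul_swap h1, mul_assoc, swap_mul_altSum hab h2, mul_smul_comm]
  have h4 : (2 : F) • (symSum F ρ * altSum F κ) = 0 := by
    linear_combination (norm := module) h3
  exact (smul_eq_zero.1 h4).resolve_left two_ne_zero

theorem xT_one_mul_xT_one_of_lt [CharZero F] {μ : Shape k} {T S : StandardTableau μ}
    (h : rowKey T < rowKey S) : xT (1 : Fˣ) T * xT (1 : Fˣ) S = 0 := by
  obtain ⟨a, b, hab, h1, h2⟩ := exists_pair_of_rowKey_lt h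
  rw [xT_one, xT_one, mul_assoc, ← mul_assoc (symSum F _), symSum_mul_altSum hab h1 h2, zero_mul,
    mul_zero]

theorem trace_mulLeft_one (x : Hecke (1 : Fˣ) k) :
    LinearMap.trace F _ (LinearMap.mulLeft F x) =
      (Fintype.card (Equiv.Perm (Fin k)) : F) * (hBasis (1 : Fˣ)).repr x 1 := by
  rw [LinearMap.trace_eq_matrix_trace F (hBasis (1 : Fˣ))]
  have h1 : ∀ σ : Equiv.Perm (Fin k),
      (hBasis (1 : Fˣ)).repr (x * hHom F k σ) σ = (hBasis (1 : Fˣ)).repr x 1 := by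
    intro σ
    conv_lhs => rw [← (hBasis (1 : Fˣ)).sum_repr x]
    simp only [Finset.sum_mul, smul_mul_assoc, map_sum, map_smul, hBasis_one_apply, ← map_mul]
    simp only [← hBasis_one_apply, Module.Basis.repr_self, Finsupp.coe_finsetSum,
      Finset.sum_apply, Finsupp.smul_apply, smul_eq_mul, Finsupp.single_apply, mul_eq_right,
      mul_ite, mul_one, mul_zero, Finset.sum_ite_eq', Finset.mem_univ, if_true]
  simp only [Matrix.trace, Matrix.diag_apply, LinearMap.toMatrix_apply, hBasis_one_apply,
    LinearMap.mulLeft_apply, h1, Finset.sum_const, Finset.card_univ, nsmul_eq_mul]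

/-- Only the identity lies both in the column group and in the row group of `T`. -/
theorem hBasis_repr_xT_one {μ : Shape k} (T : StandardTableau μ) :
    (hBasis (1 : Fˣ)).repr (xT (1 : Fˣ) T) 1 = 1 := by
  rw [xT_one, altSum, symSum, Finset.sum_mul_sum]
  simp only [smul_mul_assoc, ← map_mul, map_sum, map_smul]
  simp only [← hBasis_one_apply, Module.Basis.repr_self, Finsupp.coe_finsetSum,
      Finset.sum_apply, Finsupp.smul_apply, smul_eq_mul, Finsupp.single_apply]
  have key : ∀ σ τ : Equiv.Perm (Fin k), (∀ a, colOf T (σ a) = colOf T a) →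
      (∀ a, rowOf T (τ a) = rowOf T a) → σ * τ = 1 → σ = 1 ∧ τ = 1 := by
    intro σ τ h1 h2 h3
    have h4 : σ = 1 := by
      ext1 a
      refine eq_of_rowOf_colOf (T := T) ?_ (h1 a)
      have h5 : σ⁻¹ = τ := inv_eq_of_mul_eq_one_right h3
      have := h2 (σ a)
      rw [← h5, perm_inv_apply] at this
      exact this.symm
    subst h4
    exact ⟨rfl, by simpa using h3⟩
  rw [Finset.sum_eq_single_of_mem 1 (by simp), Finset.sum_eq_single_of_mem 1 (by simp)]
  · simp [sgn]
  · intro τ hτ hne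
    rw [if_neg, mul_zero]
    intro h
    exact hne (key 1 τ (fun _ => rfl) (Finset.mem_filter.1 hτ).2 h).2
  · intro σ hσ hne
    refine Finset.sum_eq_zero fun τ hτ => ?_
    rw [if_neg, mul_zero]
    intro h
    exact hne (key σ τ (Finset.mem_filter.1 hσ).2 (Finset.mem_filter.1 hτ).2 h).1

/-- A Young symmetrizer is not nilpotent, because its coefficient at the identity is the trace of
the left multiplication up to the factor `k!`. -/
theorem xT_one_mul_self_ne_zero [CharZero F] {μ : Shape k} (T : StandardTableau μ) :
    xT (1 : Fˣ) T * xT (1 : Fˣ) T ≠ 0 := by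
  intro h
  have h1 : IsNilpotent (LinearMap.mulLeft F (xT (1 : Fˣ) T)) := by
    refine ⟨2, ?_⟩
    rw [LinearMap.pow_mulLeft, sq, h, LinearMap.mulLeft_zero_eq_zero]
  have h2 := (LinearMap.isNilpotent_trace_of_isNilpotent h1).eq_zero
  rw [trace_mulLeft_one, hBasis_repr_xT_one, mul_one] at h2
  exact Fintype.card_ne_zero (by exact_mod_cast h2)

theorem one_sq_ne_neg_one [CharZero F] : (((1 : Fˣ) : F)) ^ 2 ≠ -1 := by
  rw [Units.val_one, one_pow]
  intro h
  have : (2 : F) = 0 := by linear_combination h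
  exact two_ne_zero this

/-- Pairs of standard tableaux of the same shape. -/
abbrev TableauPair (k : ℕ) : Type := Σ μ : Shape k, StandardTableau μ × StandardTableau μ

open Classical in
/-- Young's natural basis of the group algebra. The products `x_S x_T` with `S < T` vanish, so that
multiplying a relation by `x_S` and `x_T` isolates an extremal coefficient. -/
theorem linearIndependent_xT_one [CharZero F] :
    LinearIndependent F fun p : TableauPair k =>
      xT (1 : Fˣ) p.2.1 * hHom F k (transform p.2.2 p.2.1) := by
  rw [Fintype.linearIndependent_iff]
  intro g hg
  by_contra! hne
  obtain ⟨p₁, hp₁⟩ := hne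
  let key : TableauPair k → Lex (Fin k → ℕ) ×ₗ (Lex (Fin k → ℕ))ᵒᵈ := fun p =>
    toLex (rowKey p.2.1, OrderDual.toDual (rowKey p.2.2))
  obtain ⟨p, hp, hmin⟩ := Finset.exists_min_image (Finset.univ.filter fun p => g p ≠ 0) key
    ⟨p₁, by simpa using hp₁⟩
  obtain ⟨μ, T', T⟩ := p
  have hg' := congrArg (fun x => xT (1 : Fˣ) T' * x * xT (1 : Fˣ) T) hg
  simp only [Finset.mul_sum, Finset.sum_mul, mul_zero, zero_mul] at hg'
  rw [Finset.sum_eq_single_of_mem (⟨μ, T', T⟩ : TableauPair k) (Finset.mem_univ _)] at hg'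
  · obtain ⟨ξ, hξ⟩ := exists_xT_mul_xT (one_sq_ne_neg_one (F := F)) T'
    have hξ0 : ξ ≠ 0 := by
      rintro rfl
      rw [zero_smul] at hξ
      exact xT_one_mul_self_ne_zero T' hξ
    rw [mul_smul_comm, smul_mul_assoc, ← mul_assoc, hξ, smul_mul_assoc, smul_mul_assoc,
      ← hHom_mul_xT_one, mul_assoc, smul_smul] at hg'
    rcases smul_eq_zero.1 hg' with h | h
    · exact (mul_ne_zero (Finset.mem_filter.1 hp).2 hξ0) h
    · refine xT_one_mul_self_ne_zero (F := F) T ?_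
      rw [hHom_apply] at h
      exact (Units.mul_right_eq_zero _).1 h
  · rintro ⟨ν, S', S⟩ - hne
    by_cases h0 : g ⟨ν, S', S⟩ = 0
    · rw [h0, zero_smul, mul_zero, zero_mul]
    have hle := hmin ⟨ν, S', S⟩ (by simpa using h0)
    rw [mul_smul_comm, smul_mul_assoc]
    suffices h : xT (1 : Fˣ) T' * (xT (1 : Fˣ) S' * hHom F k (transform S S')) * xT (1 : Fˣ) T = 0 by
      rw [h, smul_zero]
    by_cases hμ : μ = ν
    · subst hμ
      rw [Prod.Lex.le_iff] at hle
      rcases hle with hle | ⟨hle1, hle2⟩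
      · rw [← mul_assoc, xT_one_mul_xT_one_of_lt hle, zero_mul, zero_mul]
      · have e1 : T' = S' := rowKey_injective hle1
        subst e1
        have hle3 : rowKey S ≤ rowKey T := hle2
        rcases hle3.lt_or_eq with h | h
        · rw [← hHom_mul_xT_one, mul_assoc, mul_assoc, xT_one_mul_xT_one_of_lt h, mul_zero,
            mul_zero]
        · exact absurd (by rw [rowKey_injective h]) hne
    · have := xT_mul_mul_xT_of_ne (one_sq_ne_neg_one (F := F)) hμ T' S' 1
      rw [mul_one] at this
      rw [← mul_assoc, this, zero_mul, zero_mul]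

end One

/-! ### Counting pairs of standard tableaux -/

section Counting

theorem exists_sdiff_eq_singleton {n : ℕ} {lam : Shape n} {μ : Shape (n + 1)} (h : lam.1 ≤ μ.1) :
    ∃ c, μ.1.cells \ lam.1.cells = {c} := by
  rw [← Finset.card_eq_one, Finset.card_sdiff_of_subset (YoungDiagram.cells_subset_iff.2 h)]
  have h1 : μ.1.cells.card = n + 1 := μ.2
  have h2 : lam.1.cells.card = n := lam.2
  omega

theorem eq_of_mem_of_notMem {n : ℕ} {lam : Shape n} {μ : Shape (n + 1)} (h : lam.1 ≤ μ.1)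
    {c d : ℕ × ℕ} (hc : c ∈ μ.1.cells) (hc' : c ∉ lam.1.cells) (hd : d ∈ μ.1.cells)
    (hd' : d ∉ lam.1.cells) : c = d := by
  obtain ⟨e, he⟩ := exists_sdiff_eq_singleton h
  have h1 : c ∈ μ.1.cells \ lam.1.cells := Finset.mem_sdiff.2 ⟨hc, hc'⟩
  have h2 : d ∈ μ.1.cells \ lam.1.cells := Finset.mem_sdiff.2 ⟨hd, hd'⟩
  rw [he, Finset.mem_singleton] at h1 h2
  rw [h1, h2]

/-- The filling which extends a tableau by the last letter in the new cell. -/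
def extendFun {n : ℕ} {lam : Shape n} (μ : Shape (n + 1)) (T : StandardTableau lam)
    (c : {c // c ∈ μ.1.cells}) : Fin (n + 1) :=
  if h : c.1 ∈ lam.1.cells then (T.entry ⟨c.1, h⟩).castSucc else Fin.last n

theorem extendFun_injective {n : ℕ} {lam : Shape n} {μ : Shape (n + 1)} (h : lam.1 ≤ μ.1)
    (T : StandardTableau lam) : Function.Injective (extendFun μ T) := by
  intro c d hcd
  unfold extendFun at hcd
  by_cases hc : c.1 ∈ lam.1.cells <;> by_cases hd : d.1 ∈ lam.1.cells <;>
    simp only [hc, hd, dif_pos, dif_neg, not_false_eq_true] at hcd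
  · have := T.entry.injective (Fin.castSucc_injective n hcd)
    exact Subtype.ext (congrArg (fun c => c.1) this)
  · exact absurd hcd (Fin.castSucc_lt_last _).ne
  · exact absurd hcd.symm (Fin.castSucc_lt_last _).ne
  · exact Subtype.ext (eq_of_mem_of_notMem h c.2 hc d.2 hd)

theorem extendFun_lt {n : ℕ} {lam : Shape n} {μ : Shape (n + 1)} (h : lam.1 ≤ μ.1)
    (T : StandardTableau lam) {c d : {c // c ∈ μ.1.cells}} (hcd : c.1 ≤ d.1) (hne : c ≠ d)
    (hT : ∀ hc hd, T.entry ⟨c.1, hc⟩ < T.entry ⟨d.1, hd⟩) : extendFun μ T c < extendFun μ T d := by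
  unfold extendFun
  by_cases hd : d.1 ∈ lam.1.cells
  · have hc : c.1 ∈ lam.1.cells := lam.1.isLowerSet hcd hd
    simp only [hc, hd, dif_pos]
    exact hT hc hd
  · have hc : c.1 ∈ lam.1.cells := by
      by_contra hc
      exact hne (Subtype.ext (eq_of_mem_of_notMem h c.2 hc d.2 hd))
    simp only [hc, hd, dif_pos, dif_neg, not_false_eq_true]
    exact Fin.castSucc_lt_last _

/-- The extension of a standard tableau by the last letter in the new cell. -/
noncomputable def extend {n : ℕ} {lam : Shape n} {μ : Shape (n + 1)} (h : lam.1 ≤ μ.1)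
    (T : StandardTableau lam) : StandardTableau μ where
  entry := Equiv.ofBijective (extendFun μ T)
    ((Fintype.bijective_iff_injective_and_card _).2 ⟨extendFun_injective h T, by
      rw [Fintype.card_coe, Fintype.card_fin]
      exact μ.2⟩)
  row_lt c d h1 h2 := extendFun_lt h T (Prod.mk_le_mk.2 ⟨h1.le, h2.le⟩)
    (by rintro rfl; exact lt_irrefl _ h2) fun _ _ => T.row_lt _ _ h1 h2
  col_lt c d h1 h2 := extendFun_lt h T (Prod.mk_le_mk.2 ⟨h2.le, h1.le⟩)
    (by rintro rfl; exact lt_irrefl _ h2) fun _ _ => T.col_lt _ _ h1 h2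

theorem extend_injective {n : ℕ} (μ : Shape (n + 1)) : Function.Injective
    (fun p : Σ lam : {lam : Shape n // lam.1 ≤ μ.1}, StandardTableau lam.1 =>
      extend p.1.2 p.2) := by
  rintro ⟨⟨lam, h⟩, T⟩ ⟨⟨ν, h'⟩, T'⟩ heq
  have key : ∀ c : {c // c ∈ μ.1.cells}, extendFun μ T c = extendFun μ T' c := fun c =>
    congrArg (fun S : StandardTableau μ => S.entry c) heq
  have hmem : ∀ c, c ∈ lam.1.cells ↔ c ∈ ν.1.cells := by
    intro c
    by_cases hc : c ∈ μ.1.cells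
    · have := key ⟨c, hc⟩
      unfold extendFun at this
      by_cases h1 : c ∈ lam.1.cells <;> by_cases h2 : c ∈ ν.1.cells <;>
        simp only [h1, h2, dif_pos, dif_neg, not_false_eq_true] at this ⊢
      · exact absurd this (Fin.castSucc_lt_last _).ne
      · exact absurd this.symm (Fin.castSucc_lt_last _).ne
    · exact ⟨fun h1 => absurd (h h1) hc, fun h1 => absurd (h' h1) hc⟩
  obtain rfl : lam = ν := Subtype.ext (YoungDiagram.ext (Finset.ext hmem))
  obtain rfl : T = T' := by
    refine StandardTableau.ext_of_entry (Equiv.ext fun c => ?_)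
    have := key ⟨c.1, h c.2⟩
    unfold extendFun at this
    have hc : c.1 ∈ lam.1.cells := c.2
    simp only [hc, dif_pos] at this
    exact Fin.castSucc_injective n this
  rfl

open Classical in
/-- The number of ways to build up a diagram by adding one cell after the other. -/
noncomputable def numChains : (n : ℕ) → Shape n → ℕ
  | 0, _ => 1
  | n + 1, μ => ∑ lam : Shape n, if lam.1 ≤ μ.1 then numChains n lam else 0

instance (μ : Shape 0) : Nonempty (StandardTableau μ) := ⟨Splus μ⟩

open Classical in
theorem numChains_le_card {n : ℕ} (μ : Shape n) :
    numChains n μ ≤ Fintype.card (StandardTableau μ) := by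
  induction n with
  | zero => exact Fintype.card_pos
  | succ n ih =>
    calc numChains (n + 1) μ
        = ∑ lam : Shape n, if lam.1 ≤ μ.1 then numChains n lam else 0 := rfl
      _ = ∑ lam : {lam : Shape n // lam.1 ≤ μ.1}, numChains n lam.1 := by
        rw [← Finset.sum_filter, Finset.sum_subtype]
        simp
      _ ≤ ∑ lam : {lam : Shape n // lam.1 ≤ μ.1}, Fintype.card (StandardTableau lam.1) :=
        Finset.sum_le_sum fun lam _ => ih lam.1
      _ = Fintype.card (Σ lam : {lam : Shape n // lam.1 ≤ μ.1}, StandardTableau lam.1) :=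
        (Fintype.card_sigma).symm
      _ ≤ _ := Fintype.card_le_of_injective _ (extend_injective μ)

open Classical in
/-- The diagrams with one more cell correspond to the addable rows. -/
theorem card_above {n : ℕ} (lam : Shape n) :
    (Finset.univ.filter fun μ : Shape (n + 1) => lam.1 ≤ μ.1).card =
      ((Finset.range (n + 1)).filter fun i =>
        i = 0 ∨ lam.1.rowLen i < lam.1.rowLen (i - 1)).card := by
  symm
  have hlow : ∀ i, (i = 0 ∨ lam.1.rowLen i < lam.1.rowLen (i - 1)) →
      IsLowerSet ((insert (i, lam.1.rowLen i) lam.1.cells : Finset (ℕ × ℕ)) : Set (ℕ × ℕ)) := by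
    rintro i hi ⟨a, b⟩ ⟨c, d⟩ hle hmem
    obtain ⟨h1, h2⟩ := Prod.mk_le_mk.1 hle
    simp only [Finset.coe_insert, Set.mem_insert_iff, Prod.mk.injEq, Finset.mem_coe,
      YoungDiagram.mem_cells, YoungDiagram.mem_iff_lt_rowLen] at hmem ⊢
    rcases hmem with ⟨rfl, rfl⟩ | hmem
    · rcases h1.lt_or_eq with h3 | h3
      · have := lam.1.rowLen_anti c (a - 1) (by omega)
        omega
      · subst h3
        omega
    · have := lam.1.rowLen_anti c a h1
      omega
  have hnot : ∀ i, (i, lam.1.rowLen i) ∉ lam.1.cells := fun i h => by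
    rw [YoungDiagram.mem_cells, YoungDiagram.mem_iff_lt_rowLen] at h
    exact lt_irrefl _ h
  refine Finset.card_bij (fun i hi => (⟨⟨insert (i, lam.1.rowLen i) lam.1.cells,
    hlow i (Finset.mem_filter.1 hi).2⟩, by
      change (insert (i, lam.1.rowLen i) lam.1.cells).card = _
      rw [Finset.card_insert_of_notMem (hnot i)]
      exact congrArg (· + 1) lam.2⟩ : Shape (n + 1))) ?_ ?_ ?_
  · intro i hi
    simp only [Finset.mem_filter, Finset.mem_univ, true_and, ← YoungDiagram.cells_subset_iff]
    exact Finset.subset_insert _ _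
  · intro i hi j hj hij
    have h1 : insert (i, lam.1.rowLen i) lam.1.cells = insert (j, lam.1.rowLen j) lam.1.cells :=
      congrArg (fun μ : Shape (n + 1) => μ.1.cells) hij
    have h2 : (i, lam.1.rowLen i) ∈ insert (j, lam.1.rowLen j) lam.1.cells := by
      rw [← h1]
      exact Finset.mem_insert_self _ _
    rcases Finset.mem_insert.1 h2 with h3 | h3
    · exact congrArg Prod.fst h3
    · exact absurd h3 (hnot i)
  · intro μ hμ
    have hle : lam.1 ≤ μ.1 := (Finset.mem_filter.1 hμ).2
    obtain ⟨⟨i, j⟩, hc⟩ := exists_sdiff_eq_singleton hle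
    have hcm : (i, j) ∈ μ.1.cells \ lam.1.cells := by rw [hc]; exact Finset.mem_singleton_self _
    obtain ⟨hc1, hc2⟩ := Finset.mem_sdiff.1 hcm
    have hc3 : lam.1.rowLen i ≤ j := by
      rwa [YoungDiagram.mem_cells, YoungDiagram.mem_iff_lt_rowLen, not_lt] at hc2
    have hj : j = lam.1.rowLen i := by
      have h1 : (i, lam.1.rowLen i) ∈ μ.1.cells := μ.1.up_left_mem (le_refl _) hc3 hc1
      have := eq_of_mem_of_notMem hle hc1 hc2 h1 (hnot i)
      exact congrArg Prod.snd this
    have hi : i = 0 ∨ lam.1.rowLen i < lam.1.rowLen (i - 1) := by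
      by_contra! hcon
      have h1 : (i - 1, j) ∈ μ.1.cells := μ.1.up_left_mem (by omega) (le_refl _) hc1
      have h2 : (i - 1, j) ∉ lam.1.cells := by
        rw [YoungDiagram.mem_cells, YoungDiagram.mem_iff_lt_rowLen]
        omega
      have := congrArg Prod.fst (eq_of_mem_of_notMem hle hc1 hc2 h1 h2)
      simp only at this
      omega
    have hin : i < n + 1 := by
      have := cells_subset_range μ hc1
      simp only [Finset.mem_product, Finset.mem_range] at this
      exact this.1
    refine ⟨i, Finset.mem_filter.2 ⟨Finset.mem_range.2 hin, hi⟩, ?_⟩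
    apply Subtype.ext
    apply YoungDiagram.ext
    change insert (i, lam.1.rowLen i) lam.1.cells = μ.1.cells
    rw [← hj, Finset.insert_eq, ← hc, Finset.sdiff_union_of_subset
      (YoungDiagram.cells_subset_iff.2 hle)]

open Classical in
/-- The diagrams with one cell less correspond to the removable rows. -/
theorem card_below {n : ℕ} (μ : Shape (n + 1)) :
    (Finset.univ.filter fun lam : Shape n => lam.1 ≤ μ.1).card =
      ((Finset.range (n + 1)).filter fun i => μ.1.rowLen (i + 1) < μ.1.rowLen i).card := by
  symm
  have hlow : ∀ i, μ.1.rowLen (i + 1) < μ.1.rowLen i →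
      IsLowerSet ((μ.1.cells.erase (i, μ.1.rowLen i - 1) : Finset (ℕ × ℕ)) : Set (ℕ × ℕ)) := by
    rintro i hi ⟨a, b⟩ ⟨c, d⟩ hle hmem
    obtain ⟨h1, h2⟩ := Prod.mk_le_mk.1 hle
    simp only [Finset.mem_coe, Finset.mem_erase, ne_eq, Prod.mk.injEq,
      YoungDiagram.mem_cells, YoungDiagram.mem_iff_lt_rowLen] at hmem ⊢
    obtain ⟨h3, h4⟩ := hmem
    have h5 := μ.1.rowLen_anti c a h1
    refine ⟨?_, by omega⟩
    rintro ⟨rfl, rfl⟩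
    rcases h1.lt_or_eq with h6 | h6
    · have := μ.1.rowLen_anti (c + 1) a (by omega)
      omega
    · subst h6
      omega
  have hmem : ∀ i, μ.1.rowLen (i + 1) < μ.1.rowLen i → (i, μ.1.rowLen i - 1) ∈ μ.1.cells :=
    fun i h => by
      rw [YoungDiagram.mem_cells, YoungDiagram.mem_iff_lt_rowLen]
      omega
  refine Finset.card_bij (fun i hi => (⟨⟨μ.1.cells.erase (i, μ.1.rowLen i - 1),
    hlow i (Finset.mem_filter.1 hi).2⟩, by
      change (μ.1.cells.erase (i, μ.1.rowLen i - 1)).card = _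
      rw [Finset.card_erase_of_mem (hmem i (Finset.mem_filter.1 hi).2)]
      exact congrArg (· - 1) μ.2⟩ : Shape n)) ?_ ?_ ?_
  · intro i hi
    simp only [Finset.mem_filter, Finset.mem_univ, true_and, ← YoungDiagram.cells_subset_iff]
    exact Finset.erase_subset _ _
  · intro i hi j hj hij
    have h1 : μ.1.cells.erase (i, μ.1.rowLen i - 1) = μ.1.cells.erase (j, μ.1.rowLen j - 1) :=
      congrArg (fun μ : Shape n => μ.1.cells) hij
    by_contra hne
    have h2 : (i, μ.1.rowLen i - 1) ∈ μ.1.cells.erase (j, μ.1.rowLen j - 1) :=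
      Finset.mem_erase.2 ⟨fun h => hne (congrArg Prod.fst h), hmem i (Finset.mem_filter.1 hi).2⟩
    rw [← h1] at h2
    exact absurd h2 (Finset.notMem_erase _ _)
  · intro lam hlam
    have hle : lam.1 ≤ μ.1 := (Finset.mem_filter.1 hlam).2
    obtain ⟨⟨i, j⟩, hc⟩ := exists_sdiff_eq_singleton hle
    have hcm : (i, j) ∈ μ.1.cells \ lam.1.cells := by rw [hc]; exact Finset.mem_singleton_self _
    obtain ⟨hc1, hc2⟩ := Finset.mem_sdiff.1 hcm
    have hc3 : j < μ.1.rowLen i := by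
      rwa [YoungDiagram.mem_cells, YoungDiagram.mem_iff_lt_rowLen] at hc1
    have hj : j = μ.1.rowLen i - 1 := by
      by_contra hne
      have h1 : (i, j + 1) ∈ μ.1.cells := by
        rw [YoungDiagram.mem_cells, YoungDiagram.mem_iff_lt_rowLen]
        omega
      have h2 : (i, j + 1) ∉ lam.1.cells := fun h =>
        hc2 (lam.1.up_left_mem (le_refl _) (Nat.le_succ j) h)
      have := congrArg Prod.snd (eq_of_mem_of_notMem hle hc1 hc2 h1 h2)
      simp at this
    have hi : μ.1.rowLen (i + 1) < μ.1.rowLen i := by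
      by_contra! hcon
      have h1 : (i + 1, j) ∈ μ.1.cells := by
        rw [YoungDiagram.mem_cells, YoungDiagram.mem_iff_lt_rowLen]
        omega
      have h2 : (i + 1, j) ∉ lam.1.cells := fun h =>
        hc2 (lam.1.up_left_mem (Nat.le_succ i) (le_refl _) h)
      have := congrArg Prod.fst (eq_of_mem_of_notMem hle hc1 hc2 h1 h2)
      simp at this
    have hin : i < n + 1 := by
      have := cells_subset_range μ hc1
      simp only [Finset.mem_product, Finset.mem_range] at this
      exact this.1
    refine ⟨i, Finset.mem_filter.2 ⟨Finset.mem_range.2 hin, hi⟩, ?_⟩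
    apply Subtype.ext
    apply YoungDiagram.ext
    change μ.1.cells.erase (i, μ.1.rowLen i - 1) = lam.1.cells
    rw [← hj, ← Finset.sdiff_singleton_eq_erase, ← hc, Finset.sdiff_sdiff_eq_self
      (YoungDiagram.cells_subset_iff.2 hle)]

open Classical in
theorem card_above_eq_card_below_add_one {n : ℕ} (μ : Shape (n + 1)) :
    (Finset.univ.filter fun ν : Shape (n + 2) => μ.1 ≤ ν.1).card =
      (Finset.univ.filter fun lam : Shape n => lam.1 ≤ μ.1).card + 1 := by
  rw [card_above, card_below]
  have : (Finset.range (n + 1 + 1)).filter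
      (fun i => i = 0 ∨ μ.1.rowLen i < μ.1.rowLen (i - 1)) =
      insert 0 (((Finset.range (n + 1)).filter fun i => μ.1.rowLen (i + 1) < μ.1.rowLen i).map
        ⟨Nat.succ, Nat.succ_injective⟩) := by
    ext i
    rcases i with _ | i
    · simp
    · simp
  rw [this, Finset.card_insert_of_notMem (by simp), Finset.card_map]

open Classical in
theorem card_above_zero (μ : Shape 0) :
    (Finset.univ.filter fun ν : Shape 1 => μ.1 ≤ ν.1).card = 1 := by
  rw [card_above, zero_add, Finset.range_one, Finset.filter_singleton]
  simp

theorem eq_of_le_of_shape {n : ℕ} {lam ν : Shape n} (h : lam.1 ≤ ν.1) : lam = ν := by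
  refine Subtype.ext (YoungDiagram.ext (Finset.eq_of_subset_of_card_le h ?_))
  have h1 : lam.1.cells.card = n := lam.2
  have h2 : ν.1.cells.card = n := ν.2
  omega

open Classical in
/-- Two different diagrams with the same number of cells have a common diagram with one cell more
if and only if they have one with one cell less; both are unique. -/
theorem card_common_above {n : ℕ} {lam ν : Shape (n + 1)} (hne : lam ≠ ν) :
    (Finset.univ.filter fun μ : Shape (n + 2) => lam.1 ≤ μ.1 ∧ ν.1 ≤ μ.1).card =
      (Finset.univ.filter fun κ : Shape n => κ.1 ≤ lam.1 ∧ κ.1 ≤ ν.1).card := by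
  have h1 : lam.1.cells.card = n + 1 := lam.2
  have h2 : ν.1.cells.card = n + 1 := ν.2
  have hcard := Finset.card_union_add_card_inter lam.1.cells ν.1.cells
  have hlt : (lam.1.cells ∩ ν.1.cells).card < n + 1 := by
    by_contra! hc
    have h3 := Finset.eq_of_subset_of_card_le
      (Finset.inter_subset_left (s₁ := lam.1.cells) (s₂ := ν.1.cells)) (by omega)
    exact hne (eq_of_le_of_shape (Finset.inter_eq_left.1 h3))
  have up : ∀ μ : Shape (n + 2), lam.1 ≤ μ.1 → ν.1 ≤ μ.1 → lam.1 ⊔ ν.1 = μ.1 := by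
    intro μ h3 h4
    have h5 : μ.1.cells.card = n + 2 := μ.2
    refine YoungDiagram.ext (Finset.eq_of_subset_of_card_le
      (YoungDiagram.cells_subset_iff.2 (sup_le h3 h4)) ?_)
    rw [YoungDiagram.cells_sup]
    omega
  have down : ∀ κ : Shape n, κ.1 ≤ lam.1 → κ.1 ≤ ν.1 → κ.1 = lam.1 ⊓ ν.1 := by
    intro κ h3 h4
    have h5 : κ.1.cells.card = n := κ.2
    refine YoungDiagram.ext (Finset.eq_of_subset_of_card_le
      (YoungDiagram.cells_subset_iff.2 (le_inf h3 h4)) ?_)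
    rw [YoungDiagram.cells_inf]
    omega
  have hup1 : (Finset.univ.filter fun μ : Shape (n + 2) => lam.1 ≤ μ.1 ∧ ν.1 ≤ μ.1).card ≤ 1 := by
    rw [Finset.card_le_one]
    intro a ha b hb
    simp only [Finset.mem_filter, Finset.mem_univ, true_and] at ha hb
    exact Subtype.ext ((up a ha.1 ha.2).symm.trans (up b hb.1 hb.2))
  have hdown1 : (Finset.univ.filter fun κ : Shape n => κ.1 ≤ lam.1 ∧ κ.1 ≤ ν.1).card ≤ 1 := by
    rw [Finset.card_le_one]
    intro a ha b hb
    simp only [Finset.mem_filter, Finset.mem_univ, true_and] at ha hb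
    exact Subtype.ext ((down a ha.1 ha.2).trans (down b hb.1 hb.2).symm)
  by_cases hn : (lam.1.cells ∩ ν.1.cells).card = n
  · have e1 : 0 < (Finset.univ.filter fun μ : Shape (n + 2) => lam.1 ≤ μ.1 ∧ ν.1 ≤ μ.1).card := by
      refine Finset.card_pos.2 ⟨⟨lam.1 ⊔ ν.1, ?_⟩, ?_⟩
      · change (lam.1 ⊔ ν.1).cells.card = _
        rw [YoungDiagram.cells_sup]
        omega
      · simp
    have e2 : 0 < (Finset.univ.filter fun κ : Shape n => κ.1 ≤ lam.1 ∧ κ.1 ≤ ν.1).card := by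
      refine Finset.card_pos.2 ⟨⟨lam.1 ⊓ ν.1, ?_⟩, ?_⟩
      · change (lam.1 ⊓ ν.1).cells.card = _
        rw [YoungDiagram.cells_inf]
        omega
      · simp
    omega
  · have e1 : (Finset.univ.filter fun μ : Shape (n + 2) => lam.1 ≤ μ.1 ∧ ν.1 ≤ μ.1) = ∅ := by
      rw [Finset.filter_eq_empty_iff]
      rintro μ - ⟨h3, h4⟩
      have h5 : μ.1.cells.card = n + 2 := μ.2
      rw [← up μ h3 h4, YoungDiagram.cells_sup] at h5
      omega
    have e2 : (Finset.univ.filter fun κ : Shape n => κ.1 ≤ lam.1 ∧ κ.1 ≤ ν.1) = ∅ := by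
      rw [Finset.filter_eq_empty_iff]
      rintro κ - ⟨h3, h4⟩
      have h5 : κ.1.cells.card = n := κ.2
      rw [down κ h3 h4, YoungDiagram.cells_inf] at h5
      omega
    simp only [e1, e2, Finset.card_empty]

open Classical in
/-- Unfolding the last step of a chain: the coefficient of `numChains n ν` is the number of common
upper neighbours of `lam` and `ν`. -/
theorem sum_numChains_above_eq (n : ℕ) (lam : Shape n) :
    ∑ μ : Shape (n + 1), (if lam.1 ≤ μ.1 then numChains (n + 1) μ else 0) =
      ∑ ν : Shape n, (Finset.univ.filter fun μ : Shape (n + 1) =>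
        lam.1 ≤ μ.1 ∧ ν.1 ≤ μ.1).card * numChains n ν := by
  simp only [Finset.card_filter, Finset.sum_mul]
  rw [Finset.sum_comm]
  refine Finset.sum_congr rfl fun μ _ => ?_
  by_cases h : lam.1 ≤ μ.1
  · simp [h, numChains]
  · simp [h]

open Classical in
/-- Building up a diagram and then adding one more cell: by the commutation relation between adding
and removing cells, this multiplies the number of chains by the number of cells. -/
theorem sum_numChains_above (n : ℕ) (lam : Shape n) :
    ∑ μ : Shape (n + 1), (if lam.1 ≤ μ.1 then numChains (n + 1) μ else 0) =
      (n + 1) * numChains n lam := by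
  induction n with
  | zero =>
    have hsub : ∀ ν : Shape 0, ν = lam := fun ν =>
      Subtype.ext (YoungDiagram.ext ((Finset.card_eq_zero.1 ν.2).trans
        (Finset.card_eq_zero.1 lam.2).symm))
    rw [sum_numChains_above_eq, Finset.sum_eq_single lam (fun b _ hb => absurd (hsub b) hb)
      (fun h => absurd (Finset.mem_univ _) h)]
    simp only [and_self]
    rw [card_above_zero]
  | succ n ih =>
    have step : ∀ ν : Shape (n + 1), (Finset.univ.filter fun μ : Shape (n + 2) =>
        lam.1 ≤ μ.1 ∧ ν.1 ≤ μ.1).card = (Finset.univ.filter fun κ : Shape n =>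
        κ.1 ≤ lam.1 ∧ κ.1 ≤ ν.1).card + if lam = ν then 1 else 0 := by
      intro ν
      by_cases h : lam = ν
      · subst h
        simp only [and_self, if_true]
        exact card_above_eq_card_below_add_one lam
      · rw [if_neg h, add_zero, card_common_above h]
    have h2 : ∑ ν : Shape (n + 1), (Finset.univ.filter fun κ : Shape n =>
        κ.1 ≤ lam.1 ∧ κ.1 ≤ ν.1).card * numChains (n + 1) ν = (n + 1) * numChains (n + 1) lam := by
      simp only [Finset.card_filter, Finset.sum_mul]
      rw [Finset.sum_comm]
      have h3 : ∀ κ : Shape n, ∑ ν : Shape (n + 1),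
          (if κ.1 ≤ lam.1 ∧ κ.1 ≤ ν.1 then 1 else 0) * numChains (n + 1) ν =
          if κ.1 ≤ lam.1 then (n + 1) * numChains n κ else 0 := by
        intro κ
        by_cases h : κ.1 ≤ lam.1
        · rw [if_pos h, ← ih κ]
          simp [h]
        · simp [h]
      simp only [h3]
      conv_rhs => rw [numChains, Finset.mul_sum]
      refine Finset.sum_congr rfl fun κ _ => ?_
      rw [mul_ite, mul_zero]
    rw [sum_numChains_above_eq]
    have h4 : ∀ ν : Shape (n + 1), (Finset.univ.filter fun μ : Shape (n + 2) =>
        lam.1 ≤ μ.1 ∧ ν.1 ≤ μ.1).card * numChains (n + 1) ν =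
        (Finset.univ.filter fun κ : Shape n => κ.1 ≤ lam.1 ∧ κ.1 ≤ ν.1).card *
          numChains (n + 1) ν + if lam = ν then numChains (n + 1) ν else 0 := by
      intro ν
      rw [step, add_mul, ite_mul, one_mul, zero_mul]
    rw [Finset.sum_congr rfl fun ν _ => h4 ν, Finset.sum_add_distrib, h2, Finset.sum_ite_eq,
      if_pos (Finset.mem_univ _)]
    ring

open Classical in
/-- The identity `∑ f_μ² = k!` for the numbers of chains in Young's lattice. -/
theorem sum_numChains_sq (n : ℕ) : ∑ μ : Shape n, numChains n μ ^ 2 = n.factorial := by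
  induction n with
  | zero =>
    have : Unique (Shape 0) :=
      { default := ⟨⊥, rfl⟩
        uniq := fun ν => Subtype.ext (YoungDiagram.ext (Finset.card_eq_zero.1 ν.2)) }
    rw [Fintype.sum_unique]
    simp [numChains]
  | succ n ih =>
    have h1 : ∀ μ : Shape (n + 1), numChains (n + 1) μ ^ 2 =
        ∑ lam : Shape n, (if lam.1 ≤ μ.1 then numChains (n + 1) μ else 0) * numChains n lam := by
      intro μ
      rw [sq]
      conv_lhs => rw [numChains, Finset.sum_mul]
      refine Finset.sum_congr rfl fun lam _ => ?_
      by_cases h : lam.1 ≤ μ.1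
      · rw [if_pos h, if_pos h, mul_comm]
        rfl
      · simp [h]
    simp only [h1]
    rw [Finset.sum_comm]
    simp only [← Finset.sum_mul, sum_numChains_above]
    simp only [mul_assoc, ← Finset.mul_sum, ← sq]
    rw [ih, Nat.factorial_succ]

/-- There are at least `k!` pairs of standard tableaux of the same shape, because every chain of
diagrams comes from a standard tableau. -/
theorem factorial_le_card_tableauPair (k : ℕ) :
    k.factorial ≤ Fintype.card (TableauPair k) := by
  rw [← sum_numChains_sq, Fintype.card_sigma]
  refine Finset.sum_le_sum fun μ _ => ?_
  rw [Fintype.card_prod, ← sq]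
  exact Nat.pow_le_pow_left (numChains_le_card μ) 2

end Counting

/-! ### Tensor space at `q = 1` -/

section Permutation

variable {k m n : ℕ} {F : Type*} [Field F]

/-- The sign by which a transposition of two equal letters acts. -/
def letterSign (F : Type*) [Field F] (m n : ℕ) (x : Fin (m + n)) : F := if parity m n x = 0 then 1 else -1

/-- At `q = 1` the generators permute the basis tensors up to sign. -/
theorem Psi_gen_one (i : Fin (k - 1)) (f : Fin k → Fin (m + n)) :
    ∃ ε : F, ε * ε = 1 ∧ (f (lo i) = f (hi i) → ε = letterSign F m n (f (lo i))) ∧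
      Psi (1 : Fˣ) m n k (gen 1 i) (tensorBasis F m n k f) =
        ε • tensorBasis F m n k (f ∘ adjSwap i) := by
  have h1 : Psi (1 : Fˣ) m n k (gen 1 i) (tensorBasis F m n k f) =
      Rdiag (1 : Fˣ) m n (f (lo i)) (f (hi i)) • tensorBasis F m n k f +
      Rswap (1 : Fˣ) m n (f (lo i)) (f (hi i)) • tensorBasis F m n k (f ∘ adjSwap i) := by
    rw [Psi_gen]
    exact rOp_basis 1 m n k i f
  rw [h1]
  by_cases h : f (lo i) = f (hi i)
  · have h2 : f ∘ adjSwap i = f := by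
      funext a
      rw [Function.comp_apply, adjSwap_eq, Equiv.swap_apply_def]
      split_ifs with h3 h4
      · rw [h3, h]
      · rw [h4, h]
      · rfl
    refine ⟨letterSign F m n (f (lo i)), ?_, fun _ => rfl, ?_⟩
    · unfold letterSign
      split_ifs <;> simp
    · rw [h2, ← h, Rswap_self, zero_smul, add_zero]
      simp [Rdiag, letterSign]
  · refine ⟨(-1) ^ (parity m n (f (lo i)) * parity m n (f (hi i))), ?_, fun h' => absurd h' h, ?_⟩
    · rw [← mul_pow]
      simp
    · have h3 : Rdiag (1 : Fˣ) m n (f (lo i)) (f (hi i)) = 0 := by simp [Rdiag, h]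
      rw [h3, zero_smul, zero_add, Rswap, if_neg h, Units.val_one, mul_one]

theorem Psi_hHom (σ : Equiv.Perm (Fin k)) (f : Fin k → Fin (m + n)) :
    ∃ ε : F, ε * ε = 1 ∧ Psi (1 : Fˣ) m n k (hHom F k σ) (tensorBasis F m n k f) =
        ε • tensorBasis F m n k (f ∘ (σ⁻¹ : Equiv.Perm (Fin k))) := by
  induction σ using perm_induction_left with
  | one => exact ⟨1, by simp, by simp⟩
  | step i σ h ih =>
    obtain ⟨ε, h1, h2⟩ := ih
    obtain ⟨δ, h3, -, h4⟩ := Psi_gen_one (F := F) i (f ∘ (σ⁻¹ : Equiv.Perm (Fin k)))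
    refine ⟨ε * δ, by rw [mul_mul_mul_comm, h1, h3, one_mul], ?_⟩
    rw [hHom_apply, ← gen_mul_hPerm 1 h, map_mul, Module.End.mul_apply, ← hHom_apply, h2, map_smul,
      h4, smul_smul, mul_inv_rev, adjSwap_inv, Equiv.Perm.coe_mul, Function.comp_assoc]

/-- A transposition of two equal letters acts by the sign of the letter, because it is conjugate to
an adjacent transposition. -/
theorem Psi_swap {a b : Fin k} (hab : a ≠ b) {f : Fin k → Fin (m + n)} (h : f a = f b) :
    Psi (1 : Fˣ) m n k (hHom F k (Equiv.swap a b)) (tensorBasis F m n k f) =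
      letterSign F m n (f a) • tensorBasis F m n k f := by
  have hk : 0 < k - 1 := by
    have h1 := a.2
    have h2 := b.2
    have h3 : a.1 ≠ b.1 := fun h => hab (Fin.ext h)
    omega
  let i : Fin (k - 1) := ⟨0, hk⟩
  obtain ⟨σ, hσ1, hσ2⟩ : ∃ σ : Equiv.Perm (Fin k), σ (lo i) = a ∧ σ (hi i) = b := by
    let τ := Equiv.swap (lo i) a
    have h1 : τ (hi i) ≠ a := by
      rw [← Equiv.swap_apply_left (lo i) a]
      exact fun h => (lo_lt_hi i).ne' (τ.injective h)
    refine ⟨Equiv.swap b (τ (hi i)) * τ, ?_, ?_⟩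
    · rw [Equiv.Perm.mul_apply, Equiv.swap_apply_left, Equiv.swap_apply_of_ne_of_ne hab h1.symm]
    · rw [Equiv.Perm.mul_apply, Equiv.swap_apply_right]
  have e : Equiv.swap a b = σ * adjSwap i * σ⁻¹ := by
    rw [← hσ1, ← hσ2, adjSwap_eq, Equiv.swap_apply_apply]
  obtain ⟨ε, -, hε⟩ := Psi_hHom (F := F) σ⁻¹ f
  obtain ⟨δ, -, hδ, hδ'⟩ := Psi_gen_one (F := F) i (f ∘ σ)
  have h1 : (f ∘ σ) (lo i) = (f ∘ σ) (hi i) := by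
    rw [Function.comp_apply, Function.comp_apply, hσ1, hσ2, h]
  have h2 : (f ∘ σ) ∘ adjSwap i = f ∘ σ := by
    funext x
    rw [Function.comp_apply, adjSwap_eq, Equiv.swap_apply_def]
    split_ifs with h3 h4
    · rw [h3, h1]
    · rw [h4, h1]
    · rfl
  have h3 : hHom F k (adjSwap i) = gen (1 : Fˣ) i := by
    have := gen_mul_hPerm (1 : Fˣ) (σ := 1) (i := i) (lo_lt_hi i)
    rw [hPerm_one, Units.val_one, mul_one, mul_one] at this
    exact this.symm
  have h4 : Psi (1 : Fˣ) m n k (hHom F k σ) (Psi (1 : Fˣ) m n k (hHom F k σ⁻¹)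
      (tensorBasis F m n k f)) = tensorBasis F m n k f := by
    rw [← Module.End.mul_apply, ← map_mul, ← map_mul, mul_inv_cancel, map_one, map_one,
      Module.End.one_apply]
  rw [inv_inv] at hε
  rw [e, map_mul, map_mul, map_mul, map_mul, Module.End.mul_apply, Module.End.mul_apply, hε,
    map_smul, map_smul, h3, hδ', h2, map_smul, hδ h1, smul_comm, ← map_smul, ← hε, h4,
    Function.comp_apply, hσ1]

end Permutation

/-! ### Shapes outside the hook -/

section Outside

theorem exists_max_of_bounded {α : Type*} (P : α → Prop) (φ : α → ℕ) {a₀ : α} (h₀ : P a₀) {B : ℕ}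
    (hB : ∀ a, P a → φ a ≤ B) : ∃ a, P a ∧ ∀ b, P b → φ b ≤ φ a := by
  have hne : (φ '' {a | P a}).Nonempty := ⟨_, a₀, h₀, rfl⟩
  have hbd : BddAbove (φ '' {a | P a}) := ⟨B, by rintro _ ⟨a, ha, rfl⟩; exact hB a ha⟩
  obtain ⟨a, ha, hmax⟩ := Nat.sSup_mem hne hbd
  exact ⟨a, ha, fun b hb => hmax ▸ le_csSup hbd ⟨b, hb, rfl⟩⟩

variable {k : ℕ}

/-- The number of positions which the filling `g` puts in row `i`. -/
def fiberCount (g : Fin k → ℕ) (i : ℕ) : ℕ := (Finset.univ.filter fun a => g a = i).card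

theorem sum_le_of_fiberCount {g g' : Fin k → ℕ} (h : ∀ i, fiberCount g i = fiberCount g' i)
    (P : Fin k → Prop) [DecidablePred P] :
    ∑ a ∈ Finset.univ.filter P, g a ≤ k * ∑ a, g' a := by
  have h1 : ∀ a, g a ≤ ∑ a, g' a := by
    intro a
    have h2 : 0 < fiberCount g' (g a) := by
      rw [← h]
      exact Finset.card_pos.2 ⟨a, by simp⟩
    obtain ⟨b, hb⟩ := Finset.card_pos.1 h2
    rw [← (Finset.mem_filter.1 hb).2]
    exact Finset.single_le_sum (f := g') (fun _ _ => Nat.zero_le _) (Finset.mem_univ b)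
  calc ∑ a ∈ Finset.univ.filter P, g a ≤ ∑ a, g a :=
        Finset.sum_le_sum_of_subset (Finset.filter_subset _ _)
    _ ≤ ∑ _a : Fin k, ∑ a, g' a := Finset.sum_le_sum fun a _ => h1 a
    _ = k * ∑ a, g' a := by simp

/-- A highest weight vector of a tensor product of `s.card` symmetric powers has at most `s.card`
rows. Here `f` divides the `k` positions into blocks, and `W` is a function of the fillings which
put each position in a row. It is symmetric in the positions of each block from `s`, and it is
annihilated by the operators which send `h ↦ W h` to the sum of the values of `W` at the fillings
obtained from `h` by moving one position of these blocks from row `i` to row `i + 1`. The proof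
removes the blocks one at a time, the block of `x` being placed as low as possible: then the
condition holds without this block, so that the other blocks lie in the first `s.card` rows, and
the condition for the full set forces the block of `x` into the first `s.card + 1` rows. -/
theorem lt_card_of_symmetric (F : Type*) {X M : Type*} [DecidableEq X] [Field F] [CharZero F]
    [AddCommGroup M] [Module F M] {f : Fin k → X} {W : (Fin k → ℕ) → M}
    (hcount : ∀ g g', W g ≠ 0 → W g' ≠ 0 → ∀ i, fiberCount g i = fiberCount g' i)
    (s : Finset X)
    (hsym : ∀ (g : Fin k → ℕ) (a b : Fin k), a ≠ b → f a = f b → f a ∈ s →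
      W (g ∘ Equiv.swap a b) = W g)
    (g : Fin k → ℕ) (hg : W g ≠ 0)
    (hE : ∀ h : Fin k → ℕ, (∀ a, f a ∉ s → h a = g a) → ∀ i,
      ∑ a ∈ Finset.univ.filter (fun a => f a ∈ s ∧ h a = i), W (Function.update h a (i + 1)) = 0)
    (a : Fin k) (ha : f a ∈ s) : g a < s.card := by
  induction s using Finset.induction_on generalizing g a with
  | empty => simp at ha
  | insert x s hx ih =>
    -- among the fillings in question choose one which is lowest in the block of `x`
    obtain ⟨g₁, ⟨hg₁, hoff⟩, hmax⟩ := exists_max_of_bounded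
      (fun g' : Fin k → ℕ => W g' ≠ 0 ∧ ∀ a, f a ∉ insert x s → g' a = g a)
      (fun g' => ∑ a ∈ Finset.univ.filter (fun a => f a = x), g' a) ⟨hg, fun _ _ => rfl⟩
      (B := k * ∑ a, g a) (fun g' hg' => sum_le_of_fiberCount (hcount g' g hg'.1 hg) _)
    have split : ∀ (h : Fin k → ℕ) (i : ℕ) (w : Fin k → M),
        ∑ a ∈ Finset.univ.filter (fun a => f a ∈ insert x s ∧ h a = i), w a =
        ∑ a ∈ Finset.univ.filter (fun a => f a = x ∧ h a = i), w a +
        ∑ a ∈ Finset.univ.filter (fun a => f a ∈ s ∧ h a = i), w a := by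
      intro h i w
      rw [← Finset.sum_union]
      · congr 1
        ext a
        simp only [Finset.mem_filter, Finset.mem_univ, true_and, Finset.mem_insert,
          Finset.mem_union]
        tauto
      · rw [Finset.disjoint_left]
        intro a h1 h2
        simp only [Finset.mem_filter, Finset.mem_univ, true_and] at h1 h2
        exact hx (h1.1 ▸ h2.1)
    have hs : ∀ a, f a ∈ s → g₁ a < s.card := by
      intro a ha
      refine ih (fun g a b hab h hs => hsym g a b hab h (Finset.mem_insert_of_mem hs)) g₁ hg₁ ?_
        a ha
      intro h hh i
      have h1 := hE h (fun a ha => (hh a fun h' => ha (Finset.mem_insert_of_mem h')).trans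
        (hoff a ha)) i
      rw [split, Finset.sum_eq_zero, zero_add] at h1
      · exact h1
      · -- moving a position in the block of `x` leads to a lower filling
        intro b hb
        simp only [Finset.mem_filter, Finset.mem_univ, true_and] at hb
        by_contra hne
        have h2 := hmax (Function.update h b (i + 1)) ⟨hne, fun a ha => ?_⟩
        · refine h2.not_gt (Finset.sum_lt_sum (fun a ha => ?_) ⟨b, by simp [hb.1], ?_⟩)
          · have h3 : f a = x := (Finset.mem_filter.1 ha).2
            have h4 : h a = g₁ a := hh a (h3 ▸ hx)
            rw [Function.update_apply, ← h4]
            split_ifs with h5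
            · rw [h5, hb.2]
              exact Nat.le_succ i
            · exact le_rfl
          · have h4 : h b = g₁ b := hh b (hb.1 ▸ hx)
            rw [Function.update_self, ← h4, hb.2]
            exact Nat.lt_succ_self i
        · have h3 : a ≠ b := by
            rintro rfl
            exact ha (hb.1 ▸ Finset.mem_insert_self _ _)
          rw [Function.update_of_ne h3]
          exact (hh a fun h' => ha (Finset.mem_insert_of_mem h')).trans (hoff a ha)
    -- if the block of `x` met row `i + 1` for some `i ≥ s.card`, the relation for the filling with
    -- one position moved back to row `i` would read `N • W g₁ = 0` with `N > 0`
    have hx' : ∀ a, f a = x → g₁ a < s.card + 1 := by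
      intro a ha
      by_contra! hcon
      obtain ⟨i, hi⟩ : ∃ i, g₁ a = i + 1 := ⟨g₁ a - 1, by omega⟩
      have h1 := hE (Function.update g₁ a i) (fun b hb => by
        rw [Function.update_of_ne (by rintro rfl; exact hb (ha ▸ Finset.mem_insert_self _ _))]
        exact hoff b hb) i
      rw [split] at h1
      have h2 : ∑ b ∈ Finset.univ.filter (fun b => f b ∈ s ∧ Function.update g₁ a i b = i),
          W (Function.update (Function.update g₁ a i) b (i + 1)) = 0 := by
        refine Finset.sum_eq_zero fun b hb => ?_
        simp only [Finset.mem_filter, Finset.mem_univ, true_and] at hb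
        have h3 : b ≠ a := by
          rintro rfl
          exact hx (ha ▸ hb.1)
        have h4 := hs b hb.1
        rw [Function.update_of_ne h3] at hb
        omega
      have h3 : ∀ b ∈ Finset.univ.filter (fun b => f b = x ∧ Function.update g₁ a i b = i),
          W (Function.update (Function.update g₁ a i) b (i + 1)) = W g₁ := by
        intro b hb
        simp only [Finset.mem_filter, Finset.mem_univ, true_and] at hb
        by_cases hba : b = a
        · subst hba
          rw [Function.update_idem, ← hi, Function.update_eq_self]
        · rw [Function.update_of_ne hba] at hb
          rw [← hsym g₁ a b (Ne.symm hba) (ha.trans hb.1.symm) (ha ▸ Finset.mem_insert_self _ _)]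
          congr 1
          funext c
          rw [Function.comp_apply, Equiv.swap_apply_def, Function.update_apply,
            Function.update_apply]
          by_cases hc : c = b
          · subst hc
            rw [if_pos rfl, if_neg hba, if_pos rfl, hi]
          · by_cases hc' : c = a
            · subst hc'
              rw [if_neg hc, if_pos rfl, if_pos rfl, hb.2]
            · rw [if_neg hc, if_neg hc', if_neg hc', if_neg hc]
      rw [h2, add_zero, Finset.sum_congr rfl h3, Finset.sum_const, ← Nat.cast_smul_eq_nsmul F] at h1
      rcases smul_eq_zero.1 h1 with h4 | h4
      · have h5 : a ∈ Finset.univ.filter (fun b => f b = x ∧ Function.update g₁ a i b = i) := by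
          simp [ha]
        exact Finset.card_ne_zero_of_mem h5 (by exact_mod_cast h4)
      · exact hg₁ h4
    have hall : ∀ a, f a ∈ insert x s → g₁ a < (insert x s).card := by
      intro a ha
      rw [Finset.card_insert_of_notMem hx]
      rcases Finset.mem_insert.1 ha with h | h
      · exact hx' a h
      · exact (hs a h).trans (Nat.lt_succ_self _)
    -- the fillings `g` and `g₁` have the same number of positions in each row
    by_contra! hcon
    have h1 := hcount g g₁ hg hg₁ (g a)
    have h2 : ∀ h : Fin k → ℕ, fiberCount h (g a) =
        (Finset.univ.filter fun b => f b ∈ insert x s ∧ h b = g a).card +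
        (Finset.univ.filter fun b => f b ∉ insert x s ∧ h b = g a).card := by
      intro h
      rw [← Finset.card_union_of_disjoint, fiberCount]
      · congr 1
        ext b
        simp only [Finset.mem_filter, Finset.mem_univ, true_and, Finset.mem_union]
        tauto
      · rw [Finset.disjoint_left]
        intro b h1 h2
        exact (Finset.mem_filter.1 h2).2.1 (Finset.mem_filter.1 h1).2.1
    have h3 : (Finset.univ.filter fun b => f b ∉ insert x s ∧ g₁ b = g a) =
        Finset.univ.filter fun b => f b ∉ insert x s ∧ g b = g a := by
      ext b
      simp only [Finset.mem_filter, Finset.mem_univ, true_and]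
      constructor
      · rintro ⟨h4, h5⟩
        exact ⟨h4, by rw [← hoff b h4, h5]⟩
      · rintro ⟨h4, h5⟩
        exact ⟨h4, by rw [hoff b h4, h5]⟩
    have h4 : 0 < (Finset.univ.filter fun b => f b ∈ insert x s ∧ g b = g a).card :=
      Finset.card_pos.2 ⟨a, by simpa using Finset.mem_insert.1 ha⟩
    have h5 : (Finset.univ.filter fun b => f b ∈ insert x s ∧ g₁ b = g a) = ∅ := by
      rw [Finset.filter_eq_empty_iff]
      rintro b - ⟨h6, h7⟩
      have := hall b h6
      omega
    rw [h2, h2, h3, h5, Finset.card_empty] at h1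
    omega

end Outside

section Annihilation

variable {k m n : ℕ} {F : Type*} [Field F] {μ : Shape k}

theorem altSum_mul_swap {κ : Fin k → ℕ} {a b : Fin k} (hab : a ≠ b) (h : κ a = κ b) :
    altSum F κ * hHom F k (Equiv.swap a b) = (-1 : F) • altSum F κ := by
  have h1 : hHom F k (Equiv.swap a b) * altSum F κ * hHom F k (Equiv.swap a b)⁻¹ = altSum F κ := by
    refine hHom_mul_altSum_mul fun x => ?_
    rw [Equiv.swap_apply_def]
    split_ifs with h2 h3
    · rw [h2, h]
    · rw [h3, h]
    · rfl
  rw [swap_mul_altSum hab h, Equiv.swap_inv, smul_mul_assoc] at h1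
  conv_rhs => rw [← h1, smul_smul, neg_one_mul, neg_neg, one_smul]

/-- The letter above `b`. In row `0`, where `0 - 1 = 0`, this is `b` itself. -/
theorem exists_above (T : StandardTableau μ) (b : Fin k) :
    ∃ d, rowOf T d = rowOf T b - 1 ∧ colOf T d = colOf T b := by
  refine exists_letter T ?_
  have h := rowOf_colOf_mem T b
  rw [YoungDiagram.mem_cells] at h ⊢
  exact μ.1.up_left_mem (Nat.sub_le _ _) le_rfl h

variable (F) in
/-- The sum of the permutations which take the letters to the rows of `T` prescribed by `g`. -/
noncomputable def rowSum (T : StandardTableau μ) (g : Fin k → ℕ) : Hecke (1 : Fˣ) k :=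
  ∑ σ ∈ Finset.univ.filter fun σ : Equiv.Perm (Fin k) => ∀ a, rowOf T (σ a) = g a, hHom F k σ

theorem rowSum_comp_swap (T : StandardTableau μ) (g : Fin k → ℕ) (a b : Fin k) :
    rowSum F T (g ∘ Equiv.swap a b) = rowSum F T g * hHom F k (Equiv.swap a b) := by
  rw [rowSum, rowSum, Finset.sum_mul]
  refine Finset.sum_equiv (Equiv.mulRight (Equiv.swap a b)) ?_ ?_
  · intro σ
    simp only [Finset.mem_filter, Finset.mem_univ, true_and, Equiv.coe_mulRight,
      Equiv.Perm.mul_apply, Function.comp_apply]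
    constructor
    · intro h x
      rw [h, Equiv.swap_apply_self]
    · intro h x
      rw [← h, Equiv.swap_apply_self]
  · intro σ _
    rw [Equiv.coe_mulRight, ← map_mul, mul_assoc, Equiv.swap_mul_self, mul_one]

theorem fiberCount_comp (g : Fin k → ℕ) (σ : Equiv.Perm (Fin k)) (i : ℕ) :
    fiberCount (fun a => g (σ a)) i = fiberCount g i := by
  refine Finset.card_bij (fun a _ => σ a) (by simp) (fun a _ b _ h => σ.injective h) fun b hb => ?_
  exact ⟨σ.symm b, by simpa using hb, by simp⟩

theorem fiberCount_of_rowSum_ne_zero {T : StandardTableau μ} {g : Fin k → ℕ}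
    (h : rowSum F T g ≠ 0) (i : ℕ) : fiberCount g i = fiberCount (rowOf T) i := by
  obtain ⟨σ, hσ, -⟩ := Finset.exists_ne_zero_of_sum_ne_zero h
  rw [← fiberCount_comp (rowOf T) σ]
  congr 1
  funext a
  exact ((Finset.mem_filter.1 hσ).2 a).symm

/-- The sum over all ways of moving one position from row `i` to row `i + 1` is zero: the terms
cancel in pairs which differ by the transposition of a letter with the one above it. -/
theorem altSum_mul_sum_rowSum_update (T : StandardTableau μ) (h : Fin k → ℕ) (i : ℕ) :
    ∑ a ∈ Finset.univ.filter (fun a => h a = i),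
      altSum F (colOf T) * rowSum F T (Function.update h a (i + 1)) = 0 := by
  choose above habove using exists_above T
  simp only [rowSum, Finset.mul_sum]
  rw [Finset.sum_sigma']
  have key : ∀ p : (_ : Fin k) × Equiv.Perm (Fin k), h p.1 = i →
      (∀ x, rowOf T (p.2 x) = Function.update h p.1 (i + 1) x) →
      rowOf T (p.2 p.1) = i + 1 ∧ rowOf T (above (p.2 p.1)) = i ∧
        p.2 p.1 ≠ above (p.2 p.1) ∧ p.2⁻¹ (above (p.2 p.1)) ≠ p.1 := by
    intro p h1 h2
    have h3 : rowOf T (p.2 p.1) = i + 1 := by rw [h2, Function.update_self]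
    have h4 : rowOf T (above (p.2 p.1)) = i := by rw [(habove _).1, h3, Nat.add_sub_cancel]
    have h5 : p.2 p.1 ≠ above (p.2 p.1) := by
      intro h'
      have := congrArg (rowOf T) h'
      omega
    refine ⟨h3, h4, h5, fun h' => h5 ?_⟩
    have := perm_apply_inv p.2 (above (p.2 p.1))
    rwa [h'] at this
  refine Finset.sum_involution (fun p _ => ⟨p.2⁻¹ (above (p.2 p.1)),
    Equiv.swap (p.2 p.1) (above (p.2 p.1)) * p.2⟩) ?_ ?_ ?_ ?_
  · rintro ⟨a, σ⟩ hp
    simp only [Finset.mem_sigma, Finset.mem_filter, Finset.mem_univ, true_and] at hp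
    obtain ⟨-, -, h5, -⟩ := key ⟨a, σ⟩ hp.1 hp.2
    dsimp only at h5 ⊢
    rw [map_mul, ← mul_assoc, altSum_mul_swap h5 (habove _).2.symm, smul_mul_assoc]
    module
  · rintro ⟨a, σ⟩ hp - h'
    simp only [Finset.mem_sigma, Finset.mem_filter, Finset.mem_univ, true_and] at hp
    exact (key ⟨a, σ⟩ hp.1 hp.2).2.2.2 (congrArg Sigma.fst h')
  · rintro ⟨a, σ⟩ hp
    simp only [Finset.mem_sigma, Finset.mem_filter, Finset.mem_univ, true_and] at hp ⊢
    obtain ⟨h3, h4, h5, h6⟩ := key ⟨a, σ⟩ hp.1 hp.2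
    dsimp only at h3 h4 h5 h6
    have h7 : h (σ⁻¹ (above (σ a))) = i := by
      have := hp.2 (σ⁻¹ (above (σ a)))
      rw [perm_apply_inv, h4, Function.update_of_ne h6] at this
      exact this.symm
    refine ⟨h7, fun x => ?_⟩
    rw [Equiv.Perm.mul_apply]
    by_cases hxa : x = a
    · rw [hxa, Equiv.swap_apply_left, h4, Function.update_of_ne h6.symm, hp.1]
    · by_cases hxb : x = σ⁻¹ (above (σ a))
      · rw [hxb, perm_apply_inv, Equiv.swap_apply_right, h3, Function.update_self]
      · rw [Function.update_of_ne hxb, Equiv.swap_apply_of_ne_of_ne, hp.2,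
          Function.update_of_ne hxa]
        · exact fun h' => hxa (σ.injective h')
        · intro h'
          rw [← h', perm_inv_apply] at hxb
          exact hxb rfl
  · rintro ⟨a, σ⟩ hp
    have e1 : (Equiv.swap (σ a) (above (σ a)) * σ) (σ⁻¹ (above (σ a))) = σ a := by
      rw [Equiv.Perm.mul_apply, perm_apply_inv, Equiv.swap_apply_right]
    have e2 : (Equiv.swap (σ a) (above (σ a)) * σ)⁻¹ (above (σ a)) = a := by
      rw [mul_inv_rev, Equiv.Perm.mul_apply, Equiv.swap_inv, Equiv.swap_apply_right,
        perm_inv_apply]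
    dsimp only
    rw [e1, e2, ← mul_assoc, Equiv.swap_mul_self, one_mul]

theorem fiberCount_rowOf (T : StandardTableau μ) (i : ℕ) :
    fiberCount (rowOf T) i = μ.1.rowLen i := by
  rw [YoungDiagram.rowLen_eq_card]
  refine Finset.card_bij (fun x _ => (T.entry.symm x).1) ?_ ?_ ?_
  · intro x hx
    rw [YoungDiagram.row, Finset.mem_filter]
    exact ⟨(T.entry.symm x).2, (Finset.mem_filter.1 hx).2⟩
  · intro x _ y _ h
    exact T.entry.symm.injective (Subtype.ext h)
  · intro c hc
    rw [YoungDiagram.row, Finset.mem_filter] at hc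
    exact ⟨T.entry ⟨c, hc.1⟩, Finset.mem_filter.2 ⟨Finset.mem_univ _, by
      rw [rowOf_entry]; exact hc.2⟩, by simp⟩

theorem Psi_rowSum_comp_swap (T : StandardTableau μ) {f : Fin k → Fin (m + n)} (g : Fin k → ℕ)
    {a b : Fin k} (hab : a ≠ b) (h : f a = f b) :
    Psi (1 : Fˣ) m n k (altSum F (colOf T) * rowSum F T (g ∘ Equiv.swap a b))
        (tensorBasis F m n k f) =
      letterSign F m n (f a) • Psi (1 : Fˣ) m n k (altSum F (colOf T) * rowSum F T g)
        (tensorBasis F m n k f) := by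
  rw [rowSum_comp_swap, ← mul_assoc, map_mul, Module.End.mul_apply, Psi_swap hab h, map_smul]

/-- A Young symmetrizer of shape outside the `(m, n)` hook kills tensor space. For a word `f`, the
vectors indexed by the fillings of the positions by rows are symmetric in the positions of an even
letter, alternating in those of an odd letter, and they satisfy the relations of
`altSum_mul_sum_rowSum_update`. If the odd letters lie as low as possible, the even letters occur
only in the first `m` rows, by `lt_card_of_symmetric`. So row `m` consists of odd letters, each at
most once, and has at most `n` cells. -/
theorem Psi_xT_one_eq_zero [CharZero F] (h : ¬ IsHook m n μ) (T : StandardTableau μ) :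
    Psi (1 : Fˣ) m n k (xT 1 T) = 0 := by
  by_contra hne
  apply h
  obtain ⟨f, hf⟩ : ∃ f, Psi (1 : Fˣ) m n k (xT 1 T) (tensorBasis F m n k f) ≠ 0 := by
    by_contra! hcon
    exact hne ((tensorBasis F m n k).ext fun f => by rw [hcon f, LinearMap.zero_apply])
  let W : (Fin k → ℕ) → TensorV F m n k := fun g =>
    Psi (1 : Fˣ) m n k (altSum F (colOf T) * rowSum F T g) (tensorBasis F m n k f)
  have hW : W (rowOf T) ≠ 0 := by
    rw [xT_one] at hf
    exact hf
  have hcount : ∀ g, W g ≠ 0 → ∀ i, fiberCount g i = fiberCount (rowOf T) i := by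
    intro g hg
    refine fiberCount_of_rowSum_ne_zero (F := F) fun h' => hg ?_
    change Psi (1 : Fˣ) m n k _ _ = 0
    rw [h', mul_zero, map_zero, LinearMap.zero_apply]
  have hsymm : ∀ (g : Fin k → ℕ) {a b : Fin k}, a ≠ b → f a = f b →
      W (g ∘ Equiv.swap a b) = letterSign F m n (f a) • W g :=
    fun g _ _ hab h => Psi_rowSum_comp_swap T g hab h
  have hE : ∀ (h : Fin k → ℕ) (i : ℕ), ∑ a ∈ Finset.univ.filter (fun a => h a = i),
      W (Function.update h a (i + 1)) = 0 := by
    intro h i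
    have := congrArg (fun x => Psi (1 : Fˣ) m n k x (tensorBasis F m n k f))
      (altSum_mul_sum_rowSum_update (F := F) T h i)
    simpa only [map_sum, LinearMap.sum_apply, map_zero, LinearMap.zero_apply] using this
  let s : Finset (Fin (m + n)) := Finset.univ.filter fun x => x.1 < m
  have hs : ∀ x, x ∈ s ↔ x.1 < m := by simp [s]
  have hcard : s.card ≤ m := by
    calc s.card ≤ (Finset.range m).card :=
          Finset.card_le_card_of_injOn Fin.val (fun x hx => by simpa using (hs x).1 hx)
            Fin.val_injective.injOn
      _ = m := Finset.card_range m
  obtain ⟨g, hg, hmax⟩ := exists_max_of_bounded (fun g : Fin k → ℕ => W g ≠ 0)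
    (fun g => ∑ a ∈ Finset.univ.filter (fun a => f a ∉ s), g a) hW (B := k * ∑ a, rowOf T a)
    (fun g hg => sum_le_of_fiberCount (hcount g hg) _)
  have heven : ∀ a, f a ∈ s → g a < m := by
    intro a ha
    refine lt_of_lt_of_le (lt_card_of_symmetric F (f := f) (W := W) ?_ s ?_ g hg ?_ a ha) hcard
    · exact fun g g' h h' i => (hcount g h i).trans (hcount g' h' i).symm
    · intro g a b hab h ha
      rw [hsymm g hab h, letterSign, parity, if_pos ((hs _).1 ha), if_pos rfl, one_smul]
    · intro h hh i
      rw [← hE h i]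
      refine Finset.sum_subset (fun a ha => ?_) fun a ha ha' => ?_
      · simp only [Finset.mem_filter, Finset.mem_univ, true_and] at ha ⊢
        exact ha.2
      · simp only [Finset.mem_filter, Finset.mem_univ, true_and] at ha ha'
        have ha'' : f a ∉ s := fun h' => ha' ⟨h', ha⟩
        -- moving an odd letter down contradicts the choice of `g`
        by_contra hne
        refine (hmax _ hne).not_gt (Finset.sum_lt_sum (fun b hb => ?_) ⟨a, by simpa using ha'', ?_⟩)
        · rw [← hh b (by simpa using hb), Function.update_apply]
          split_ifs with h'
          · rw [h', ha]
            exact Nat.le_succ i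
          · exact le_rfl
        · rw [← hh a ha'', Function.update_self, ha]
          exact Nat.lt_succ_self i
  rw [IsHook, ← fiberCount_rowOf T, ← hcount g hg, fiberCount]
  calc _ ≤ (Finset.univ.filter fun x : Fin (m + n) => m ≤ x.1).card := by
        refine Finset.card_le_card_of_injOn f (fun a ha => ?_) fun a ha b hb hab => ?_
        · simp only [Finset.coe_filter, Finset.mem_univ, true_and, Set.mem_ofPred_eq] at ha ⊢
          by_contra! hcon
          exact (heven a ((hs _).2 hcon)).ne ha
        · simp only [Finset.coe_filter, Finset.mem_univ, true_and, Set.mem_ofPred_eq] at ha hb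
          by_contra hne
          have hodd : ¬ (f a).1 < m := fun h' => (heven a ((hs _).2 h')).ne ha
          have h1 : g ∘ Equiv.swap a b = g := by
            funext x
            rw [Function.comp_apply, Equiv.swap_apply_def]
            split_ifs with h2 h3
            · rw [h2, ha, hb]
            · rw [h3, ha, hb]
            · rfl
          have h2 := hsymm g hne hab
          rw [h1, letterSign, parity, if_neg hodd, if_neg one_ne_zero] at h2
          have h3 : (2 : F) • W g = 0 := by
            rw [two_smul]
            nth_rewrite 2 [h2]
            nth_rewrite 1 [← one_smul F (W g)]
            rw [← add_smul, add_neg_cancel, zero_smul]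
          exact hg ((smul_eq_zero.1 h3).resolve_left two_ne_zero)
    _ ≤ (Finset.range n).card := by
        refine Finset.card_le_card_of_injOn (fun x => x.1 - m) (fun x hx => ?_)
          fun x hx y hy h => ?_
        · have := x.2
          simp only [Finset.coe_filter, Finset.mem_univ, true_and, Set.mem_ofPred_eq,
            Finset.coe_range, Set.mem_Iio] at hx ⊢
          omega
        · simp only [Finset.coe_filter, Finset.mem_univ, true_and, Set.mem_ofPred_eq] at hx hy h
          exact Fin.ext (by omega)
    _ = n := Finset.card_range n

end Annihilation

/-! ### Shapes inside the hook -/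

section Inside

variable {k m n : ℕ} {F : Type*} [Field F] {μ : Shape k}

/-- A permutation which preserves the word `f` and moves only even letters, or only odd letters,
acts on the tensor of `f` by the trivial character, or by the sign, respectively. -/
theorem Psi_hHom_of_comp_eq (χ : Equiv.Perm (Fin k) →* F) {ε : F}
    (hχ : ∀ a b, a ≠ b → χ (Equiv.swap a b) = ε) {f : Fin k → Fin (m + n)}
    (σ : Equiv.Perm (Fin k)) (hf : ∀ a, f (σ a) = f a)
    (hσ : ∀ a, σ a ≠ a → letterSign F m n (f a) = ε) :
    Psi (1 : Fˣ) m n k (hHom F k σ) (tensorBasis F m n k f) = χ σ • tensorBasis F m n k f := by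
  induction hN : σ.support.card using Nat.strong_induction_on generalizing σ with
  | _ N ih =>
    by_cases h1 : σ = 1
    · rw [h1, map_one, map_one, map_one, Module.End.one_apply, one_smul]
    · obtain ⟨a, ha⟩ : ∃ a, σ a ≠ a := by
        by_contra! hcon
        exact h1 (Equiv.ext hcon)
      have h2 : σ = Equiv.swap a (σ a) * (Equiv.swap a (σ a) * σ) := by
        rw [← mul_assoc, Equiv.swap_mul_self, one_mul]
      have h3 : ∀ b, f (Equiv.swap a (σ a) b) = f b := by
        intro b
        rw [Equiv.swap_apply_def]
        split_ifs with h4 h5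
        · rw [h4, hf]
        · rw [h5, hf]
        · rfl
      have h4 := ih _ (hN ▸ Equiv.Perm.card_support_swap_mul ha) (Equiv.swap a (σ a) * σ)
        (fun b => by rw [Equiv.Perm.mul_apply, h3, hf]) (fun b hb => hσ b fun h => hb ?_) rfl
      · have h5 : χ σ = χ (Equiv.swap a (σ a) * σ) * ε := by
          conv_lhs => rw [h2, map_mul, hχ _ _ ha.symm, mul_comm]
        rw [h5, ← smul_smul, ← hσ a ha, ← Psi_swap ha.symm (hf a).symm, ← map_smul, ← h4,
          ← Module.End.mul_apply, ← map_mul, ← map_mul, ← h2]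
      · rw [Equiv.Perm.mul_apply, h, Equiv.swap_apply_of_ne_of_ne]
        · rintro rfl
          exact ha h
        · intro h'
          rw [h'] at h
          exact ha (σ.injective h)

/-- The word of the canonical filling of a hook shape: even letters number the first `m` rows,
odd letters the columns below them. -/
theorem exists_hookWord (h : IsHook m n μ) (T : StandardTableau μ) :
    ∃ f : Fin k → Fin (m + n), (∀ a, rowOf T a < m → (f a).1 = rowOf T a) ∧
      ∀ a, m ≤ rowOf T a → (f a).1 = m + colOf T a := by
  have key : ∀ a, ∃ x : Fin (m + n), (rowOf T a < m → x.1 = rowOf T a) ∧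
      (m ≤ rowOf T a → x.1 = m + colOf T a) := by
    intro a
    rcases lt_or_ge (rowOf T a) m with h1 | h1
    · exact ⟨⟨rowOf T a, by omega⟩, fun _ => rfl, fun h2 => absurd h1 h2.not_gt⟩
    · have h2 : colOf T a < n := by
        have h3 := rowOf_colOf_mem T a
        rw [YoungDiagram.mem_cells, YoungDiagram.mem_iff_lt_rowLen] at h3
        exact h3.trans_le ((μ.1.rowLen_anti _ _ h1).trans h)
      exact ⟨⟨m + colOf T a, by omega⟩, fun h3 => absurd h3 h1.not_gt, fun _ => rfl⟩
  choose f hf using key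
  exact ⟨f, fun a => (hf a).1, fun a => (hf a).2⟩

/-- The tensor of the hook word has a positive coefficient in its own image: a product `c r` of a
column and a row permutation fixes the word only if `r` moves even letters and `c` odd ones, and
then its sign is cancelled by the sign of `c` in the Young symmetrizer. -/
theorem Psi_xT_one_ne_zero [CharZero F] (h : IsHook m n μ) (T : StandardTableau μ) :
    Psi (1 : Fˣ) m n k (xT 1 T) ≠ 0 := by
  obtain ⟨f, hf1, hf2⟩ := exists_hookWord h T
  let sgnHom : Equiv.Perm (Fin k) →* F :=
    ((Int.castRingHom F).toMonoidHom.comp (Units.coeHom ℤ)).comp Equiv.Perm.sign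
  have hsq : ∀ σ : Equiv.Perm (Fin k), sgn F σ * sgn F σ = 1 := by
    intro σ
    rcases Int.units_eq_one_or (Equiv.Perm.sign σ) with h | h <;> simp [sgn, h]
  have term : ∀ c r : Equiv.Perm (Fin k), (∀ a, colOf T (c a) = colOf T a) →
      (∀ a, rowOf T (r a) = rowOf T a) →
      (tensorBasis F m n k).repr (Psi (1 : Fˣ) m n k (sgn F c • hHom F k c * hHom F k r)
        (tensorBasis F m n k f)) f = if ∀ a, f (c (r a)) = f a then 1 else 0 := by
    intro c r hc hr
    split_ifs with hcr
    · -- `r` fixes the letters below row `m`, and `c` fixes those in the first `m` rows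
      have hr1 : ∀ a, m ≤ rowOf T a → r a = a := by
        intro a ha
        have h1 := congrArg Fin.val (hcr a)
        rw [hf2 a ha] at h1
        rcases lt_or_ge (rowOf T (c (r a))) m with h2 | h2
        · rw [hf1 _ h2] at h1
          omega
        · rw [hf2 _ h2, hc] at h1
          exact eq_of_rowOf_colOf (hr a) (by omega)
      have hc1 : ∀ a, rowOf T a < m → c a = a := by
        intro b hb
        obtain ⟨a, rfl⟩ := r.surjective b
        rw [hr] at hb
        have h1 := congrArg Fin.val (hcr a)
        rw [hf1 a hb] at h1
        rcases lt_or_ge (rowOf T (c (r a))) m with h2 | h2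
        · rw [hf1 _ h2] at h1
          exact eq_of_rowOf_colOf (h1.trans (hr a).symm) (hc _)
        · rw [hf2 _ h2] at h1
          omega
      have hr2 : Psi (1 : Fˣ) m n k (hHom F k r) (tensorBasis F m n k f) =
          (1 : F) • tensorBasis F m n k f := by
        refine Psi_hHom_of_comp_eq (1 : Equiv.Perm (Fin k) →* F) (fun _ _ _ => rfl) r ?_ ?_
        · intro a
          rcases lt_or_ge (rowOf T a) m with h1 | h1
          · exact Fin.ext (by rw [hf1 a h1, hf1 _ ((hr a).trans_lt h1), hr])
          · rw [hr1 a h1]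
        · intro a ha
          have h1 : rowOf T a < m := by
            by_contra! hcon
            exact ha (hr1 a hcon)
          rw [letterSign, parity, hf1 a h1, if_pos h1]
          rfl
      have hc2 : Psi (1 : Fˣ) m n k (hHom F k c) (tensorBasis F m n k f) =
          sgn F c • tensorBasis F m n k f := by
        refine Psi_hHom_of_comp_eq sgnHom (ε := -1) (fun _ _ h => sgn_swap h) c ?_ ?_
        · intro a
          rcases lt_or_ge (rowOf T a) m with h1 | h1
          · rw [hc1 a h1]
          · rcases lt_or_ge (rowOf T (c a)) m with h2 | h2
            · rw [c.injective (hc1 _ h2)]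
            · exact Fin.ext (by rw [hf2 a h1, hf2 _ h2, hc])
        · intro a ha
          have h1 : m ≤ rowOf T a := by
            by_contra! hcon
            exact ha (hc1 a hcon)
          rw [letterSign, parity, hf2 a h1, if_neg (show ¬ m + colOf T a < m by omega),
            if_neg one_ne_zero]
      rw [map_mul, Module.End.mul_apply, hr2, one_smul, map_smul, LinearMap.smul_apply, hc2,
        smul_smul, hsq, one_smul, Module.Basis.repr_self, Finsupp.single_eq_same]
    · obtain ⟨ε, -, hε⟩ := Psi_hHom (F := F) (c * r) f
      rw [smul_mul_assoc, ← map_mul, map_smul, LinearMap.smul_apply, hε, map_smul, map_smul,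
        Module.Basis.repr_self, Finsupp.smul_apply, Finsupp.smul_apply, Finsupp.single_apply,
        if_neg, smul_zero, smul_zero]
      intro h'
      refine hcr fun a => ?_
      have := congrFun h' ((c * r) a)
      rw [Function.comp_apply, perm_inv_apply] at this
      exact this.symm
  intro h0
  have h1 : (tensorBasis F m n k).repr (Psi (1 : Fˣ) m n k (xT 1 T) (tensorBasis F m n k f)) f
      = 0 := by
    rw [h0, LinearMap.zero_apply, map_zero, Finsupp.zero_apply]
  rw [xT_one, altSum, symSum, Finset.sum_mul_sum, ← Finset.sum_product', map_sum,
    LinearMap.sum_apply, map_sum, Finsupp.finsetSum_apply,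
    Finset.sum_congr rfl fun p hp => term p.1 p.2
      (Finset.mem_filter.1 (Finset.mem_product.1 hp).1).2
      (Finset.mem_filter.1 (Finset.mem_product.1 hp).2).2, Finset.sum_boole, Nat.cast_eq_zero,
    Finset.card_eq_zero, Finset.filter_eq_empty_iff] at h1
  exact h1 (x := (1, 1)) (by simp) (by simp)

end Inside

/-! ### Specialization at `q = 1` -/

section Specialization

variable {k : ℕ} {O K F : Type*} [CommRing O] [Field K] [Field F] [Algebra O K] [Algebra O F]
  {qO : Oˣ} {q : Kˣ}

/-- The trace of an idempotent is its rank. -/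
theorem exists_trace_eq_natCast {W : Type*} [AddCommGroup W] [Module K W] [FiniteDimensional K W]
    {f : Module.End K W} (hf : IsIdempotentElem f) :
    ∃ d : ℕ, LinearMap.trace K W f = d ∧ (d = 0 → f = 0) := by
  refine ⟨Module.finrank K (LinearMap.range f), ?_, fun h => ?_⟩
  · exact ((LinearMap.isProj_range_iff_isIdempotentElem _).2 hf).trace
  · exact LinearMap.range_eq_bot.1 (Submodule.finrank_eq_zero.1 h)

theorem finrank_hecke (q : Kˣ) : Module.finrank K (Hecke q k) = k.factorial := by
  rw [Module.finrank_eq_card_basis (hBasis q), Fintype.card_perm, Fintype.card_fin]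

/-- Linear independence of `k!` elements of the Hecke algebra is the non-vanishing of a
determinant, so it is inherited by the generic algebra from the specialization. -/
theorem linearIndependent_heckeMap (hK : algebraMap O K qO = q)
    (hF : algebraMap O F qO = (1 : Fˣ)) (hinj : Function.Injective (algebraMap O K))
    {ι : Type*} [Fintype ι] (hcard : Fintype.card ι = k.factorial) (v : ι → Hecke qO k)
    (hv : LinearIndependent F fun i => heckeMap k hF (v i)) :
    LinearIndependent K fun i => heckeMap k hK (v i) := by
  classical
  have e : ι ≃ Equiv.Perm (Fin k) :=
    Fintype.equivOfCardEq (by rw [hcard, Fintype.card_perm, Fintype.card_fin])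
  have hdet : (Matrix.of fun i j => (hBasis (1 : Fˣ)).repr (heckeMap k hF (v i)) (e j)).det ≠ 0 := by
    rw [← isUnit_iff_ne_zero, ← Matrix.isUnit_iff_isUnit_det,
      ← Matrix.linearIndependent_rows_iff_isUnit]
    exact hv.map' ((hBasis (1 : Fˣ)).equivFun.trans (LinearEquiv.funCongrLeft F F e)).toLinearMap
      (LinearEquiv.ker _)
  rw [heckeMap_matrix_det hF] at hdet
  have hdet' : (Matrix.of fun i j => (hBasis q).repr (heckeMap k hK (v i)) (e j)).det ≠ 0 := by
    rw [heckeMap_matrix_det hK]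
    intro h
    rw [(injective_iff_map_eq_zero _).1 hinj _ h, map_zero] at hdet
    exact hdet rfl
  rw [← isUnit_iff_ne_zero, ← Matrix.isUnit_iff_isUnit_det,
    ← Matrix.linearIndependent_rows_iff_isUnit] at hdet'
  exact LinearIndependent.of_comp
    ((hBasis q).equivFun.trans (LinearEquiv.funCongrLeft K K e)).toLinearMap hdet'

variable [CharZero F]

variable (k) in
open Classical in
/-- Young's natural basis bounds the number of pairs from above. -/
theorem card_tableauPair : Fintype.card (TableauPair k) = k.factorial := by
  refine le_antisymm ?_ (factorial_le_card_tableauPair k)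
  have := (linearIndependent_xT_one (F := ℚ) (k := k)).fintype_card_le_finrank
  rwa [finrank_hecke] at this

/-- The generic algebra is the sum of the right ideals generated by the `x_T`. -/
theorem span_xT_mul (hK : algebraMap O K qO = q) (hF : algebraMap O F qO = (1 : Fˣ))
    (hinj : Function.Injective (algebraMap O K)) :
    Submodule.span K (Set.range fun p : TableauPair k =>
      xT q p.2.1 * (hPerm q (transform p.2.2 p.2.1)).val) = ⊤ := by
  classical
  have h1 := linearIndependent_heckeMap hK hF hinj (card_tableauPair k)
    (fun p : TableauPair k => xT qO p.2.1 * (hPerm qO (transform p.2.2 p.2.1)).val) (by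
      simp only [map_mul, heckeMap_xT, heckeMap_hPerm, ← hHom_apply]
      exact linearIndependent_xT_one)
  simp only [map_mul, heckeMap_xT, heckeMap_hPerm] at h1
  exact h1.span_eq_top_of_card_eq_finrank' (by rw [card_tableauPair, finrank_hecke])

/-- The generic algebra is the sum of the left ideals generated by the `x_T`. -/
theorem span_mul_xT (hK : algebraMap O K qO = q) (hF : algebraMap O F qO = (1 : Fˣ))
    (hinj : Function.Injective (algebraMap O K)) :
    Submodule.span K (Set.range fun p : TableauPair k =>
      (hPerm q (transform p.2.2 p.2.1)).val * xT q p.2.2) = ⊤ := by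
  classical
  have h1 := linearIndependent_heckeMap hK hF hinj (card_tableauPair k)
    (fun p : TableauPair k => (hPerm qO (transform p.2.2 p.2.1)).val * xT qO p.2.2) (by
      simp only [map_mul, heckeMap_xT, heckeMap_hPerm, ← hHom_apply, hHom_mul_xT_one]
      exact linearIndependent_xT_one)
  simp only [map_mul, heckeMap_xT, heckeMap_hPerm] at h1
  exact h1.span_eq_top_of_card_eq_finrank' (by rw [card_tableauPair, finrank_hecke])

theorem sq_ne_neg_one (hK : algebraMap O K qO = q) (hF : algebraMap O F qO = (1 : Fˣ))
    (hinj : Function.Injective (algebraMap O K)) : (q : K) ^ 2 ≠ -1 := by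
  intro h
  have h1 : (qO : O) ^ 2 = -1 := hinj (by rw [map_pow, hK, h, map_neg, map_one])
  apply one_sq_ne_neg_one (F := F)
  rw [← hF, ← map_pow, h1, map_neg, map_one]

variable {μ : Shape k}

theorem xT_mul_self_ne_zero (hK : algebraMap O K qO = q) (hF : algebraMap O F qO = (1 : Fˣ))
    (hinj : Function.Injective (algebraMap O K)) (T : StandardTableau μ) :
    xT q T * xT q T ≠ 0 := by
  intro h
  rw [← heckeMap_xT hK, ← map_mul] at h
  have h1 := (injective_iff_map_eq_zero _).1 (heckeMap_injective hK hinj) _ h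
  apply xT_one_mul_self_ne_zero (F := F) T
  rw [← heckeMap_xT hF, ← map_mul, h1, map_zero]

theorem Psi_xT_ne_zero (hK : algebraMap O K qO = q) (hF : algebraMap O F qO = (1 : Fˣ))
    (hinj : Function.Injective (algebraMap O K)) {m n : ℕ} (h : IsHook m n μ)
    (T : StandardTableau μ) : Psi q m n k (xT q T) ≠ 0 := by
  intro h0
  rw [← heckeMap_xT hK] at h0
  have h1 := Psi_heckeMap_eq_zero hK hinj m n h0
  apply Psi_xT_one_ne_zero (F := F) h T
  have h2 := toMatrix_Psi_heckeMap hF m n (xT qO T)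
  rw [h1, map_zero, heckeMap_xT, Matrix.map_zero _ (map_zero _)] at h2
  exact (LinearMap.toMatrix _ _).map_eq_zero_iff.1 h2

theorem yT_mul_self (hq : (q : K) ^ 2 ≠ -1) {T : StandardTableau μ} (hT : xT q T * xT q T ≠ 0) :
    xi q T ≠ 0 ∧ xT q T * xT q T = xi q T • xT q T ∧ yT q T * yT q T = yT q T := by
  -- `xi` is a choice of a scalar with this property, which exists
  have h1 : xT q T * xT q T = xi q T • xT q T := Classical.epsilon_spec (exists_xT_mul_xT hq T)
  have h2 : xi q T ≠ 0 := by
    intro h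
    rw [h, zero_smul] at h1
    exact hT h1
  refine ⟨h2, h1, ?_⟩
  rw [yT, smul_mul_smul_comm, h1, smul_smul, mul_assoc, inv_mul_cancel₀ h2, mul_one]

/-- The trace of `Ψ(x_T)` is `ξ` times the rank of the idempotent `Ψ(y_T)`. It can be computed at
`q = 1`, where it vanishes while `ξ` does not. -/
theorem Psi_xT_eq_zero (hK : algebraMap O K qO = q) (hF : algebraMap O F qO = (1 : Fˣ))
    (hinj : Function.Injective (algebraMap O K)) {m n : ℕ} (h : ¬ IsHook m n μ)
    (T : StandardTableau μ) : Psi q m n k (xT q T) = 0 := by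
  obtain ⟨h1, h2, h3⟩ := yT_mul_self (sq_ne_neg_one hK hF hinj) (xT_mul_self_ne_zero hK hF hinj T)
  have hx : xT q T = xi q T • yT q T := by
    rw [yT, smul_smul, mul_inv_cancel₀ h1, one_smul]
  have hid : IsIdempotentElem (Psi q m n k (yT q T)) := by
    rw [IsIdempotentElem, ← map_mul, h3]
  obtain ⟨d, hd⟩ : ∃ d : ℕ, LinearMap.trace K _ (Psi q m n k (yT q T)) = d ∧
      (d = 0 → Psi q m n k (yT q T) = 0) :=
    have : FiniteDimensional K (TensorV K m n k) := .of_basis (tensorBasis K m n k)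
    exists_trace_eq_natCast hid
  -- the scalar `ξ` is a quotient of two coordinates, which are defined over `O`
  let p : O := (hBasis qO).repr (xT qO T) 1
  let r : O := (hBasis qO).repr (xT qO T * xT qO T) 1
  have hp : algebraMap O F p = 1 := by
    rw [← hBasis_repr_heckeMap hF, heckeMap_xT, hBasis_repr_xT_one]
  have hr : algebraMap O F r ≠ 0 := by
    obtain ⟨ξ, hξ⟩ := exists_xT_mul_xT (one_sq_ne_neg_one (F := F)) T
    rw [← hBasis_repr_heckeMap hF, map_mul, heckeMap_xT, hξ, map_smul, Finsupp.smul_apply,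
      hBasis_repr_xT_one, smul_eq_mul, mul_one]
    rintro rfl
    rw [zero_smul] at hξ
    exact xT_one_mul_self_ne_zero T hξ
  have hpr : xi q T * algebraMap O K p = algebraMap O K r := by
    rw [← hBasis_repr_heckeMap hK, ← hBasis_repr_heckeMap hK, map_mul, heckeMap_xT, h2, map_smul,
      Finsupp.smul_apply, smul_eq_mul]
  have htr : p * LinearMap.trace O _ (Psi qO m n k (xT qO T)) = r * d := by
    apply hinj
    rw [map_mul, map_mul, ← trace_Psi_heckeMap hK, heckeMap_xT, hx, map_smul, map_smul, hd.1,
      map_natCast, ← hpr, smul_eq_mul]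
    ring
  have htr' := congrArg (algebraMap O F) htr
  rw [map_mul, map_mul, ← trace_Psi_heckeMap hF, heckeMap_xT, Psi_xT_one_eq_zero h, map_zero,
    mul_zero, map_natCast, eq_comm, mul_eq_zero, Nat.cast_eq_zero] at htr'
  rw [hx, map_smul, hd.2 (htr'.resolve_left hr), smul_zero]

end Specialization

/-! ### Laurent polynomials -/

open Polynomial in
/-- A subring of `ℂ(q)` which contains `q` as a unit and admits the specialization `q ↦ 1`: the ring
of Laurent polynomials `ℂ[q, q⁻¹]`. -/
theorem exists_specialization : ∃ (O : Type) (_ : CommRing O) (_ : Algebra O Cq) (_ : Algebra O ℂ)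
    (qO : Oˣ), Function.Injective (algebraMap O Cq) ∧ algebraMap O Cq qO = qvar ∧
      algebraMap O ℂ qO = (1 : ℂˣ) := by
  let O := Localization.Away (X : ℂ[X])
  let g : ℂ[X] →+* Cq := (algebraMap ℂ[X] (RatFunc ℂ) : ℂ[X] →+* RatFunc ℂ)
  have hgX : g X = qvar := RatFunc.algebraMap_X
  have hg : IsUnit (g X) := hgX ▸ qvar.isUnit
  have he : IsUnit (evalRingHom (1 : ℂ) X) := by simp
  let φ : O →+* Cq := IsLocalization.Away.lift (X : ℂ[X]) hg
  let ψ : O →+* ℂ := IsLocalization.Away.lift (X : ℂ[X]) he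
  have hu : IsUnit (algebraMap ℂ[X] O X) := IsLocalization.Away.algebraMap_isUnit X
  refine ⟨O, inferInstance, φ.toAlgebra, ψ.toAlgebra, hu.unit, ?_, ?_, ?_⟩
  · change Function.Injective φ
    refine (IsLocalization.lift_injective_iff _).2 fun x y => ?_
    have h1 : Function.Injective (algebraMap ℂ[X] O) :=
      IsLocalization.injective O (powers_le_nonZeroDivisors_of_noZeroDivisors X_ne_zero)
    have h2 : Function.Injective g := RatFunc.algebraMap_injective ℂ
    rw [h1.eq_iff, h2.eq_iff]
  · change φ (algebraMap ℂ[X] O X) = _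
    rw [IsLocalization.Away.lift_eq, hgX]
  · change ψ (algebraMap ℂ[X] O X) = _
    rw [IsLocalization.Away.lift_eq]
    simp

/-! ### Direct sum decompositions -/

section Decomposition

theorem isInternal_of_projections {ι M S : Type*} [Fintype ι] [DecidableEq ι] [AddCommMonoid M]
    [SetLike S M] [AddSubmonoidClass S M] (A : ι → S) (P : ι → M →+ M)
    (hmem : ∀ i x, P i x ∈ A i) (hsum : ∀ x, ∑ i, P i x = x)
    (hne : ∀ i j, i ≠ j → ∀ x ∈ A j, P i x = 0) : DirectSum.IsInternal A := by
  classical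
  have hself : ∀ i, ∀ x ∈ A i, P i x = x := by
    intro i x hx
    conv_rhs => rw [← hsum x]
    rw [Finset.sum_eq_single i (fun j _ hj => hne j i hj x hx)
      (fun h => absurd (Finset.mem_univ i) h)]
  have hcoe : ∀ x : DirectSum ι fun i => A i,
      DirectSum.coeAddMonoidHom A x = ∑ i, (x i : M) := by
    intro x
    rw [DirectSum.coeAddMonoidHom_eq_dfinsuppSum, DFinsupp.sum_eq_sum_fintype]
    · rfl
    · exact fun i => rfl
  have hP : ∀ (x : DirectSum ι fun i => A i) i, P i (DirectSum.coeAddMonoidHom A x) = x i := by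
    intro x i
    rw [hcoe, map_sum, Finset.sum_eq_single i (fun j _ hj => hne i j hj.symm _ (x j).2)
      (fun h => absurd (Finset.mem_univ i) h), hself i _ (x i).2]
  constructor
  · intro x y h
    refine DFinsupp.ext fun i => Subtype.ext ?_
    rw [← hP x i, h]
    exact hP y i
  · intro x
    refine ⟨∑ i, DirectSum.of (fun i => A i) i ⟨P i x, hmem i x⟩, ?_⟩
    rw [map_sum]
    simp only [DirectSum.coeAddMonoidHom_of]
    exact hsum x

/-- If an algebra is the sum of right ideals `y i A` whose dimensions add up to at most its own
dimension, the sum is direct, and the decomposition of `1` gives elements `a i` as stated. -/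
theorem exists_dual_of_sum_finrank_le {K A ι : Type*} [Field K] [Ring A] [Algebra K A]
    [FiniteDimensional K A] [Fintype ι] (y : ι → A)
    (htop : ⨆ i, LinearMap.range (LinearMap.mulLeft K (y i)) = ⊤)
    (hle : ∑ i, Module.finrank K (LinearMap.range (LinearMap.mulLeft K (y i))) ≤
      Module.finrank K A) :
    ∃ a : ι → A, ∑ i, y i * a i = 1 ∧ ∀ i j, i ≠ j → y i * a i * y j = 0 := by
  classical
  let M : ι → Submodule K A := fun i => LinearMap.range (LinearMap.mulLeft K (y i))
  let Φ : (∀ i, M i) →ₗ[K] A := ∑ i, (M i).subtype ∘ₗ LinearMap.proj i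
  have hΦ : ∀ z, Φ z = ∑ i, (z i : A) := by
    intro z
    simp [Φ]
  have hsurj : Function.Surjective Φ := by
    rw [← LinearMap.range_eq_top, eq_top_iff, ← htop]
    refine iSup_le fun i x hx => ⟨Pi.single i ⟨x, hx⟩, ?_⟩
    rw [hΦ, Finset.sum_eq_single i, Pi.single_eq_same]
    · intro j _ hj
      rw [Pi.single_eq_of_ne hj]
      rfl
    · exact fun h => absurd (Finset.mem_univ i) h
  have hfin : Module.finrank K (∀ i, M i) = Module.finrank K A := by
    refine le_antisymm ?_ (LinearMap.finrank_le_finrank_of_surjective hsurj)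
    rw [Module.finrank_pi_fintype]
    exact hle
  have hinj : Function.Injective Φ :=
    (LinearMap.injective_iff_surjective_of_finrank_eq_finrank hfin).2 hsurj
  obtain ⟨z, hz⟩ := hsurj 1
  choose a ha using fun i => (z i).2
  have ha' : ∀ i, y i * a i = z i := ha
  refine ⟨a, ?_, fun i j hij => ?_⟩
  · rw [← hz, hΦ]
    exact Finset.sum_congr rfl fun i _ => ha' i
  · -- two decompositions of `y j`
    have h1 : Φ (fun i => ⟨y i * a i * y j, a i * y j, by
        rw [LinearMap.mulLeft_apply, mul_assoc]⟩) =
        Φ (Pi.single j ⟨y j, 1, by rw [LinearMap.mulLeft_apply, mul_one]⟩) := by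
      rw [hΦ, hΦ, Finset.sum_eq_single (f := fun i =>
        ((Pi.single j (⟨y j, 1, by rw [LinearMap.mulLeft_apply, mul_one]⟩ : M j) :
          ∀ i, M i) i : A)) j, Pi.single_eq_same]
      · dsimp only
        rw [← Finset.sum_mul, Finset.sum_congr rfl fun i _ => ha' i, ← hΦ, hz, one_mul]
      · intro i _ hi
        rw [Pi.single_eq_of_ne hi]
        rfl
      · exact fun h => absurd (Finset.mem_univ j) h
    have h2 := congrArg Subtype.val (congrFun (hinj h1) i)
    rw [Pi.single_eq_of_ne hij] at h2
    exact h2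

/-- The elements `i` with `y A i = 0` form a two-sided ideal. -/
def rightAnnihilator {A : Type*} [Ring A] (y : A) : TwoSidedIdeal A :=
  .mk' {i | ∀ x, y * x * i = 0} (fun x => mul_zero _)
    (fun {i j} hi hj x => by rw [mul_add, hi, hj, add_zero])
    (fun {i} hi x => by rw [mul_neg, hi, neg_zero])
    (fun {z i} hi x => by rw [← mul_assoc, mul_assoc y, hi])
    (fun {i z} hi x => by rw [← mul_assoc, hi, zero_mul])

theorem mem_rightAnnihilator {A : Type*} [Ring A] {y i : A} :
    i ∈ rightAnnihilator y ↔ ∀ x, y * x * i = 0 := by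
  rw [rightAnnihilator, TwoSidedIdeal.mem_mk']
  rfl

end Decomposition

/-! ### The Hecke algebra over `ℂ(q)` -/

section Generic

variable {k m n : ℕ} {lam μ : Shape k}

theorem qvar_sq_ne_neg_one : (qvar : Cq) ^ 2 ≠ -1 := by
  obtain ⟨O, _, _, _, qO, h1, h2, h3⟩ := exists_specialization
  exact sq_ne_neg_one h2 h3 h1

theorem yT_spec (T : StandardTableau μ) :
    xi qvar T ≠ 0 ∧ xT qvar T * xT qvar T = xi qvar T • xT qvar T ∧
      yT qvar T * yT qvar T = yT qvar T := by
  obtain ⟨O, _, _, _, qO, h1, h2, h3⟩ := exists_specialization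
  exact yT_mul_self qvar_sq_ne_neg_one (xT_mul_self_ne_zero h2 h3 h1 T)

theorem xT_qvar_ne_zero (T : StandardTableau μ) : xT qvar T ≠ 0 := by
  obtain ⟨O, _, _, _, qO, h1, h2, h3⟩ := exists_specialization
  intro h
  apply xT_mul_self_ne_zero h2 h3 h1 T
  rw [h, mul_zero]

theorem xT_eq_smul_yT (T : StandardTableau μ) : xT qvar T = xi qvar T • yT qvar T := by
  rw [yT, smul_smul, mul_inv_cancel₀ (yT_spec T).1, one_smul]

theorem yT_mul_yT (T : StandardTableau μ) : yT qvar T * yT qvar T = yT qvar T := (yT_spec T).2.2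

theorem Psi_yT_eq_zero (h : ¬ IsHook m n μ) (T : StandardTableau μ) :
    Psi qvar m n k (yT qvar T) = 0 := by
  obtain ⟨O, _, _, _, qO, h1, h2, h3⟩ := exists_specialization
  rw [yT, map_smul, Psi_xT_eq_zero h2 h3 h1 h, smul_zero]

theorem Psi_yT_ne_zero (h : IsHook m n μ) (T : StandardTableau μ) :
    Psi qvar m n k (yT qvar T) ≠ 0 := by
  obtain ⟨O, _, _, _, qO, h1, h2, h3⟩ := exists_specialization
  intro h0
  apply Psi_xT_ne_zero h2 h3 h1 h T
  rw [xT_eq_smul_yT, map_smul, h0, smul_zero]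

theorem yT_mul_mul_yT_of_ne (h : lam ≠ μ) (T : StandardTableau lam) (S : StandardTableau μ)
    (x : Hecke qvar k) : yT qvar T * x * yT qvar S = 0 := by
  rw [yT, yT, smul_mul_assoc, smul_mul_assoc, mul_smul_comm,
    xT_mul_mul_xT_of_ne qvar_sq_ne_neg_one h, smul_zero, smul_zero]

theorem exists_yT_mul_mul_yT (T S : StandardTableau μ) (x : Hecke qvar k) :
    ∃ c : Cq, yT qvar T * x * yT qvar S = c • crossUnit qvar T S := by
  obtain ⟨c, hc⟩ := exists_xT_mul_mul_xT qvar_sq_ne_neg_one T S x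
  exact ⟨(xi qvar T)⁻¹ * ((xi qvar S)⁻¹ * c), by
    rw [yT, yT, smul_mul_assoc, smul_mul_assoc, mul_smul_comm, hc, smul_smul, smul_smul, mul_assoc]⟩

theorem exists_yT_eq_mul_yT_mul (T S : StandardTableau μ) :
    ∃ a b : Hecke qvar k, yT qvar S = a * yT qvar T * b := by
  obtain ⟨a, b, h⟩ := exists_xT_eq_mul_xT_mul qvar_sq_ne_neg_one T S (xT_qvar_ne_zero T)
  refine ⟨((xi qvar S)⁻¹ * xi qvar T) • a, b, ?_⟩
  have hS : yT qvar S = (xi qvar S)⁻¹ • xT qvar S := rfl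
  rw [hS, h, xT_eq_smul_yT T]
  simp only [smul_mul_assoc, mul_smul_comm, smul_smul]

theorem span_yT_mul : Submodule.span Cq (Set.range fun p : TableauPair k =>
    yT qvar p.2.1 * (hPerm qvar (transform p.2.2 p.2.1)).val) = ⊤ := by
  obtain ⟨O, _, _, _, qO, h1, h2, h3⟩ := exists_specialization
  rw [eq_top_iff, ← span_xT_mul h2 h3 h1, Submodule.span_le]
  rintro _ ⟨p, rfl⟩
  dsimp only
  rw [xT_eq_smul_yT, smul_mul_assoc]
  exact Submodule.smul_mem _ _ (Submodule.subset_span ⟨p, rfl⟩)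

theorem span_mul_yT : Submodule.span Cq (Set.range fun p : TableauPair k =>
    (hPerm qvar (transform p.2.2 p.2.1)).val * yT qvar p.2.2) = ⊤ := by
  obtain ⟨O, _, _, _, qO, h1, h2, h3⟩ := exists_specialization
  rw [eq_top_iff, ← span_mul_xT h2 h3 h1, Submodule.span_le]
  rintro _ ⟨p, rfl⟩
  dsimp only
  rw [xT_eq_smul_yT, mul_smul_comm]
  exact Submodule.smul_mem _ _ (Submodule.subset_span ⟨p, rfl⟩)

/-- The left ideals generated by the `y_T` add up to the whole algebra. -/
theorem eq_zero_of_yT_mul {x : Hecke qvar k}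
    (h : ∀ (μ : Shape k) (T : StandardTableau μ), yT qvar T * x = 0) : x = 0 := by
  have h1 : (1 : Hecke qvar k) ∈ LinearMap.ker (LinearMap.mulRight Cq x) := by
    have h2 : (⊤ : Submodule Cq (Hecke qvar k)) ≤ LinearMap.ker (LinearMap.mulRight Cq x) := by
      rw [← span_mul_yT, Submodule.span_le]
      rintro _ ⟨p, rfl⟩
      rw [SetLike.mem_coe, LinearMap.mem_ker, LinearMap.mulRight_apply, mul_assoc, h, mul_zero]
    exact h2 trivial
  rwa [LinearMap.mem_ker, LinearMap.mulRight_apply, one_mul] at h1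

/-- The right ideals generated by the `y_T` add up to the whole algebra. -/
theorem eq_zero_of_mul_yT {x : Hecke qvar k}
    (h : ∀ (μ : Shape k) (T : StandardTableau μ), x * yT qvar T = 0) : x = 0 := by
  have h1 : (1 : Hecke qvar k) ∈ LinearMap.ker (LinearMap.mulLeft Cq x) := by
    have h2 : (⊤ : Submodule Cq (Hecke qvar k)) ≤ LinearMap.ker (LinearMap.mulLeft Cq x) := by
      rw [← span_yT_mul, Submodule.span_le]
      rintro _ ⟨p, rfl⟩
      rw [SetLike.mem_coe, LinearMap.mem_ker, LinearMap.mulLeft_apply, ← mul_assoc, h, zero_mul]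
    exact h2 trivial
  rwa [LinearMap.mem_ker, LinearMap.mulLeft_apply, mul_one] at h1

/-- The right ideal `y_T H` is the sum of the `y_T H y_S`, which are lines for `S` of the same shape and
vanish for the other ones. -/
theorem finrank_yT_mul_le (T : StandardTableau μ) :
    Module.finrank Cq (LinearMap.range (LinearMap.mulLeft Cq (yT qvar T))) ≤
      Fintype.card (StandardTableau μ) := by
  have h1 : LinearMap.range (LinearMap.mulLeft Cq (yT qvar T)) ≤
      Submodule.span Cq (Set.range fun S : StandardTableau μ => crossUnit qvar T S) := by
    rw [LinearMap.range_eq_map, ← span_mul_yT, Submodule.map_span_le]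
    rintro _ ⟨⟨ν, S', S⟩, rfl⟩
    dsimp only
    rw [LinearMap.mulLeft_apply, ← mul_assoc]
    by_cases h : μ = ν
    · subst h
      obtain ⟨c, hc⟩ := exists_yT_mul_mul_yT T S (hPerm qvar (transform S S')).val
      rw [hc]
      exact Submodule.smul_mem _ _ (Submodule.subset_span ⟨S, rfl⟩)
    · rw [yT_mul_mul_yT_of_ne h]
      exact zero_mem _
  exact (Submodule.finrank_mono h1).trans (finrank_range_le_card _)

/-- The decomposition of `1` along the right ideals generated by the Young symmetrizers. -/
theorem exists_dual_yT (k : ℕ) : ∃ a : (Σ μ : Shape k, StandardTableau μ) → Hecke qvar k,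
    ∑ T, yT qvar T.2 * a T = 1 ∧ ∀ T S, T ≠ S → yT qvar T.2 * a T * yT qvar S.2 = 0 := by
  refine exists_dual_of_sum_finrank_le (K := Cq) _ ?_ ?_
  · rw [eq_top_iff, ← span_yT_mul, Submodule.span_le]
    rintro _ ⟨p, rfl⟩
    exact Submodule.mem_iSup_of_mem ⟨p.1, p.2.1⟩ ⟨_, rfl⟩
  · rw [finrank_hecke, ← card_tableauPair, Fintype.card_sigma, Fintype.sum_sigma]
    refine Finset.sum_le_sum fun μ _ => ?_
    rw [Fintype.card_prod, ← smul_eq_mul, ← Finset.card_univ, ← Finset.sum_const]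
    exact Finset.sum_le_sum fun T _ => finrank_yT_mul_le T

theorem yT_mem_blockIdeal (T : StandardTableau μ) : yT qvar T ∈ blockIdeal qvar μ :=
  TwoSidedIdeal.subset_span ⟨T, rfl⟩

theorem yT_mul_mul_eq_zero_of_mem_blockIdeal (h : lam ≠ μ) (T : StandardTableau lam)
    {i : Hecke qvar k} (hi : i ∈ blockIdeal qvar μ) (x : Hecke qvar k) : yT qvar T * x * i = 0 := by
  have h1 : blockIdeal qvar μ ≤ rightAnnihilator (yT qvar T) := by
    refine TwoSidedIdeal.span_le.2 ?_
    rintro _ ⟨S, rfl⟩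
    exact mem_rightAnnihilator.2 (yT_mul_mul_yT_of_ne h T S)
  exact mem_rightAnnihilator.1 (h1 hi) x

/-- A nonzero ideal inside `I_μ` contains a nonzero element of some `y_S H y_T`. -/
theorem isAtom_blockIdeal (μ : Shape k) : IsAtom (blockIdeal qvar μ) := by
  have hne : ∀ T : StandardTableau μ, yT qvar T ≠ 0 := by
    intro T h
    apply xT_qvar_ne_zero T
    rw [xT_eq_smul_yT, h, smul_zero]
  refine ⟨fun h => hne (Splus μ) ?_, fun J hJ => ?_⟩
  · rw [← TwoSidedIdeal.mem_bot (Hecke qvar k), ← h]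
    exact yT_mem_blockIdeal _
  by_contra hbot
  apply hJ.not_ge
  obtain ⟨j, hj, hj0⟩ : ∃ j ∈ J, j ≠ 0 := by
    by_contra! hcon
    exact hbot (le_bot_iff.1 fun j hj => (TwoSidedIdeal.mem_bot _).2 (hcon j hj))
  obtain ⟨S, T, hST⟩ : ∃ S T : StandardTableau μ, yT qvar S * j * yT qvar T ≠ 0 := by
    by_contra! hcon
    refine hj0 (eq_zero_of_yT_mul fun ν S => eq_zero_of_mul_yT fun ν' T => ?_)
    by_cases h1 : ν = ν'
    · by_cases h2 : ν = μ
      · subst h1 h2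
        exact hcon S T
      · have := yT_mul_mul_eq_zero_of_mem_blockIdeal h2 S (hJ.le hj) 1
        rw [mul_one] at this
        rw [this, zero_mul]
    · exact yT_mul_mul_yT_of_ne h1 S T j
  obtain ⟨c, hc⟩ := exists_yT_mul_mul_yT S T j
  have hc0 : c ≠ 0 := by
    rintro rfl
    rw [zero_smul] at hc
    exact hST hc
  have hmem : ∀ (c : Cq) {x : Hecke qvar k}, x ∈ J → c • x ∈ J := by
    intro c x hx
    rw [Algebra.smul_def]
    exact J.mul_mem_left _ _ hx
  -- `J` contains the line `y_S H y_T`, hence the symmetrizer `y_S`, and all its conjugates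
  have hcross : crossUnit qvar S T ∈ J := by
    have h1 : yT qvar S * j * yT qvar T ∈ J := J.mul_mem_right _ _ (J.mul_mem_left _ _ hj)
    rw [hc] at h1
    have h2 := hmem c⁻¹ h1
    rwa [smul_smul, inv_mul_cancel₀ hc0, one_smul] at h2
  have hS : yT qvar S ∈ J := by
    obtain ⟨a, b, hab⟩ := exists_yT_eq_mul_yT_mul T S
    obtain ⟨d, hd⟩ := exists_yT_mul_mul_yT S T a
    rw [← yT_mul_yT S]
    nth_rewrite 2 [hab]
    rw [← mul_assoc, ← mul_assoc, hd]
    exact J.mul_mem_right _ _ (hmem d hcross)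
  refine TwoSidedIdeal.span_le.2 ?_
  rintro _ ⟨T', rfl⟩
  obtain ⟨a, b, hab⟩ := exists_yT_eq_mul_yT_mul S T'
  dsimp only
  rw [hab]
  exact J.mul_mem_right _ _ (J.mul_mem_left _ _ hS)

/-- A block of hook shape acts faithfully, because it is a simple ideal which does not act by
zero. -/
theorem eq_zero_of_Psi_eq_zero (h : IsHook m n μ) {x : Hecke qvar k} (hx : x ∈ blockIdeal qvar μ)
    (h0 : Psi qvar m n k x = 0) : x = 0 := by
  let N : TwoSidedIdeal (Hecke qvar k) := TwoSidedIdeal.ker (Psi qvar m n k)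
  rcases (isAtom_blockIdeal μ).le_iff.1 (inf_le_left : blockIdeal qvar μ ⊓ N ≤ _) with h1 | h1
  · rw [← TwoSidedIdeal.mem_bot (Hecke qvar k), ← h1]
    exact (TwoSidedIdeal.mem_inf _).2 ⟨hx, (TwoSidedIdeal.mem_ker _).2 h0⟩
  · exfalso
    refine Psi_yT_ne_zero h (Splus μ) ((TwoSidedIdeal.mem_ker (Psi qvar m n k)).1 ?_)
    have h2 := yT_mem_blockIdeal (Splus μ)
    rw [← h1] at h2
    exact ((TwoSidedIdeal.mem_inf _).1 h2).2

/-- The central idempotents: units of the ideals `I_μ`. -/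
theorem exists_blockUnits (k : ℕ) : ∃ e : Shape k → Hecke qvar k,
    (∀ μ, e μ ∈ blockIdeal qvar μ) ∧ ∑ μ, e μ = 1 ∧
      ∀ lam μ, lam ≠ μ → ∀ x ∈ blockIdeal qvar μ, e lam * x = 0 := by
  obtain ⟨a, h1, -⟩ := exists_dual_yT k
  refine ⟨fun μ => ∑ T : StandardTableau μ, yT qvar T * a ⟨μ, T⟩, fun μ => ?_, ?_, ?_⟩
  · exact sum_mem fun T _ => TwoSidedIdeal.mul_mem_right _ _ _ (yT_mem_blockIdeal T)
  · rw [← h1, Fintype.sum_sigma]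
  · intro lam μ h x hx
    dsimp only
    rw [Finset.sum_mul]
    exact Finset.sum_eq_zero fun T _ => yT_mul_mul_eq_zero_of_mem_blockIdeal h T hx _

theorem isInternal_blockIdeal : DirectSum.IsInternal fun μ : Shape k => blockIdeal qvar μ := by
  obtain ⟨e, h1, h2, h3⟩ := exists_blockUnits k
  refine isInternal_of_projections _ (fun μ => AddMonoidHom.mulLeft (e μ)) ?_ ?_ ?_
  · exact fun μ x => TwoSidedIdeal.mul_mem_right _ _ _ (h1 μ)
  · intro x
    simp only [AddMonoidHom.coe_mulLeft]
    rw [← Finset.sum_mul, h2, one_mul]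
  · exact fun lam μ h x hx => h3 lam μ h x hx

theorem ker_Psi (m n k : ℕ) (x : Hecke qvar k) :
    x ∈ (⨆ μ : {μ : Shape k // ¬ IsHook m n μ}, blockIdeal qvar μ.1) ↔
      Psi qvar m n k x = 0 := by
  constructor
  · intro hx
    have h1 : (⨆ μ : {μ : Shape k // ¬ IsHook m n μ}, blockIdeal qvar μ.1) ≤
        TwoSidedIdeal.ker (Psi qvar m n k) := by
      refine iSup_le fun μ => TwoSidedIdeal.span_le.2 ?_
      rintro _ ⟨T, rfl⟩
      exact (TwoSidedIdeal.mem_ker _).2 (Psi_yT_eq_zero μ.2 T)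
    exact (TwoSidedIdeal.mem_ker _).1 (h1 hx)
  · intro hx
    obtain ⟨e, h1, h2, h3⟩ := exists_blockUnits k
    rw [← one_mul x, ← h2, Finset.sum_mul]
    refine sum_mem fun μ _ => ?_
    by_cases hμ : IsHook m n μ
    · rw [eq_zero_of_Psi_eq_zero hμ (TwoSidedIdeal.mul_mem_right _ _ _ (h1 μ))
        (by rw [map_mul, hx, mul_zero])]
      exact zero_mem _
    · exact le_iSup (fun μ : {μ : Shape k // ¬ IsHook m n μ} => blockIdeal qvar μ.1) ⟨μ, hμ⟩
        (TwoSidedIdeal.mul_mem_right _ _ _ (h1 μ))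

/-- The sum of the blocks of hook shape is a complement of the kernel of the representation. -/
theorem bijective_Psi_hook (m n k : ℕ) : Function.Bijective
    fun x : (⨆ μ : {μ : Shape k // IsHook m n μ}, blockIdeal qvar μ.1 :
      TwoSidedIdeal (Hecke qvar k)) => (Psi qvar m n k).rangeRestrict x.1 := by
  obtain ⟨e, h1, h2, h3⟩ := exists_blockUnits k
  constructor
  · rintro ⟨x, hx⟩ ⟨y, hy⟩ hxy
    apply Subtype.ext
    change x = y
    have hz : Psi qvar m n k (x - y) = 0 := by
      rw [map_sub, sub_eq_zero]
      exact congrArg Subtype.val hxy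
    have hmem := TwoSidedIdeal.sub_mem _ hx hy
    rw [← sub_eq_zero, ← one_mul (x - y), ← h2, Finset.sum_mul]
    refine Finset.sum_eq_zero fun μ _ => ?_
    by_cases hμ : IsHook m n μ
    · exact eq_zero_of_Psi_eq_zero hμ (TwoSidedIdeal.mul_mem_right _ _ _ (h1 μ))
        (by rw [map_mul, hz, mul_zero])
    · have h4 : (⨆ μ : {μ : Shape k // IsHook m n μ}, blockIdeal qvar μ.1) ≤
          rightAnnihilator (e μ) := by
        refine iSup_le fun ν i hi => mem_rightAnnihilator.2 fun z => ?_
        rw [mul_assoc]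
        refine h3 μ ν.1 (fun h => hμ (h ▸ ν.2)) _ (TwoSidedIdeal.mul_mem_left _ _ _ hi)
      have h5 := mem_rightAnnihilator.1 (h4 hmem) 1
      rwa [mul_one] at h5
  · rintro ⟨_, ⟨x, rfl⟩⟩
    classical
    refine ⟨⟨∑ μ ∈ Finset.univ.filter (IsHook m n), e μ * x, sum_mem fun μ hμ =>
      le_iSup (fun μ : {μ : Shape k // IsHook m n μ} => blockIdeal qvar μ.1)
        ⟨μ, (Finset.mem_filter.1 hμ).2⟩ (TwoSidedIdeal.mul_mem_right _ _ _ (h1 μ))⟩, Subtype.ext ?_⟩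
    change Psi qvar m n k _ = Psi qvar m n k x
    conv_rhs => rw [← one_mul x, ← h2, Finset.sum_mul]
    rw [map_sum, map_sum]
    refine Finset.sum_filter_of_ne fun μ _ hne => ?_
    by_contra hμ
    refine hne ((ker_Psi m n k _).1 ?_)
    exact le_iSup (fun μ : {μ : Shape k // ¬ IsHook m n μ} => blockIdeal qvar μ.1) ⟨μ, hμ⟩
      (TwoSidedIdeal.mul_mem_right _ _ _ (h1 μ))

/-- The operators `Ψ(y_T a_T)`, for the dual elements `a_T` of `exists_dual_yT`, are the projections;
those of shape outside the hook vanish. -/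
theorem isInternal_range_Psi_yT (m n k : ℕ) : DirectSum.IsInternal
    fun T : (Σ μ : {μ : Shape k // IsHook m n μ}, StandardTableau μ.1) =>
      LinearMap.range (Psi qvar m n k (yT qvar T.2)) := by
  obtain ⟨a, h1, h2⟩ := exists_dual_yT k
  have : Fintype {μ : Shape k // IsHook m n μ} := Fintype.ofFinite _
  let inc : (Σ μ : {μ : Shape k // IsHook m n μ}, StandardTableau μ.1) →
      (Σ μ : Shape k, StandardTableau μ) := fun T => ⟨T.1.1, T.2⟩
  have hinc : Function.Injective inc := by
    rintro ⟨⟨μ, hμ⟩, T⟩ ⟨⟨ν, hν⟩, S⟩ h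
    obtain ⟨rfl, h'⟩ := Sigma.mk.inj h
    have h'' : T = S := eq_of_heq h'
    rw [h'']
  refine isInternal_of_projections _
    (fun T => (Psi qvar m n k (yT qvar T.2 * a (inc T))).toAddMonoidHom) ?_ ?_ ?_
  · intro T x
    rw [LinearMap.toAddMonoidHom_coe, map_mul]
    exact ⟨_, rfl⟩
  · intro x
    simp only [LinearMap.toAddMonoidHom_coe]
    rw [← LinearMap.sum_apply]
    have h3 : ∑ T, Psi qvar m n k (yT qvar T.2 * a (inc T)) = 1 := by
      rw [← map_one (Psi qvar m n k), ← h1, map_sum]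
      refine Fintype.sum_of_injective inc hinc _ _ (fun T hT => ?_) fun T => rfl
      rw [map_mul, Psi_yT_eq_zero (fun h => hT ⟨⟨⟨T.1, h⟩, T.2⟩, rfl⟩), zero_mul]
    rw [h3, Module.End.one_apply]
  · rintro T S hTS _ ⟨x, rfl⟩
    rw [LinearMap.toAddMonoidHom_coe, ← Module.End.mul_apply, ← map_mul,
      h2 (inc T) (inc S) (hinc.ne hTS), map_zero, LinearMap.zero_apply]

end Generic

end QuantumSuper

theorem mainTheorem5 (m n k : ℕ) :
    -- the ideals `I^q_μ` are simple, and `H_k(q²)` is their direct sum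
    (∀ μ : Shape k, IsAtom (blockIdeal qvar μ)) ∧
    DirectSum.IsInternal (fun μ : Shape k => blockIdeal qvar μ) ∧
    -- `Ψ_q` induces an algebra isomorphism from the quotient by the sum of the non-hook ideals
    -- onto its image
    (∃ e : (Hecke qvar k ⧸
          (⨆ μ : {μ : Shape k // ¬ IsHook m n μ}, blockIdeal qvar μ.1).asIdeal) ≃ₐ[Cq]
        (Psi qvar m n k).range,
      ∀ x : Hecke qvar k,
        (e (Ideal.Quotient.mk _ x) : Module.End Cq (TensorV Cq m n k)) = Psi qvar m n k x) ∧
    -- `Ψ_q` restricts to an isomorphism from the sum of the hook ideals onto its image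
    -- (which is linear, since `Ψ_q` is)
    (∃ e : (⨆ μ : {μ : Shape k // IsHook m n μ}, blockIdeal qvar μ.1 :
          TwoSidedIdeal (Hecke qvar k)) ≃+* (Psi qvar m n k).range,
      ∀ x, (e x : Module.End Cq (TensorV Cq m n k)) = Psi qvar m n k x.1) ∧
    -- tensor space is the direct sum of the images of the `y_T(q)`, `T` of hook shape
    DirectSum.IsInternal
      (fun T : (Σ μ : {μ : Shape k // IsHook m n μ}, StandardTableau μ.1) =>
        LinearMap.range (Psi qvar m n k (yT qvar T.2))) :=
 by
  refine ⟨isAtom_blockIdeal, isInternal_blockIdeal, ?_, ?_, isInternal_range_Psi_yT m n k⟩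
  · have hker : (⨆ μ : {μ : Shape k // ¬ IsHook m n μ}, blockIdeal qvar μ.1).asIdeal =
        RingHom.ker (Psi qvar m n k).rangeRestrict := by
      ext x
      rw [TwoSidedIdeal.mem_asIdeal, ker_Psi, RingHom.mem_ker]
      exact (Subtype.ext_iff (a1 := (Psi qvar m n k).rangeRestrict x) (a2 := 0)).symm
    exact ⟨(Ideal.quotientEquivAlgOfEq Cq hker).trans (Ideal.quotientKerAlgEquivOfSurjective
      (Psi qvar m n k).rangeRestrict_surjective), fun x => rfl⟩
  · let φ : (⨆ μ : {μ : Shape k // IsHook m n μ}, blockIdeal qvar μ.1 :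
        TwoSidedIdeal (Hecke qvar k)) →ₙ+* (Psi qvar m n k).range :=
      { toFun := fun x => (Psi qvar m n k).rangeRestrict x.1
        map_mul' := fun x y => map_mul (Psi qvar m n k).rangeRestrict x.1 y.1
        map_zero' := map_zero (Psi qvar m n k).rangeRestrict
        map_add' := fun x y => map_add (Psi qvar m n k).rangeRestrict x.1 y.1 }
    exact ⟨RingEquiv.ofBijective φ (bijective_Psi_hook m n k), fun x => rfl⟩
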